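/- Let $F$ be a finite extension of $\mathbb{Q}_p$, let $\widetilde{\mathbf G}$ be a connected reductive algebraic group over $F$, and let $\mathbf G$ be a closed $F$-subgroup of $\widetilde{\mathbf G}$ with the same derived group, i.e. $\mathbf G_{\mathrm{der}} = \widetilde{\mathbf G}_{\mathrm{der}} \subseteq \mathbf G \subseteq \widetilde{\mathbf G}$. Put $G=\mathbf G(F)$ and $\widetilde G=\widetilde{\mathbf G}(F)$. Let $\widetilde\sigma$ be an irreducible smooth complex representation of $\widetilde G$, and let $\sigma$ be an irreducible smooth complex representation of $G$ that is isomorphic to an irreducible constituent of the restriction $\mathrm{Res}_G^{\widetilde G}(\widetilde\sigma)$. Let $$X(\widetilde\sigma)=\{\chi : \chi \text{ a (continuous) character } \widetilde G/G\to\mathbb{C}^\times \text{ with } \widetilde\sigma\simeq\widetilde\sigma\otimes\chi\},$$ let $\Pi_\sigma(G)$ be the set of isomorphism classes of irreducible constituents of $\mathrm{Res}_G^{\widetilde G}(\widetilde\sigma)$, and let $\langle\sigma,\widetilde\sigma\rangle_G=\dim_{\mathbb C}\mathrm{Hom}_G(\sigma,\mathrm{Res}_G^{\widetilde G}(\widetilde\sigma))$.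 Then $X(\widetilde\sigma)$ and $\Pi_\sigma(G)$ are finite, the $\mathrm{Hom}$ spaces below and above are finite-dimensional, and $$|X(\widetilde\sigma)| = \dim_{\mathbb C}\mathrm{Hom}_G\big(\mathrm{Res}_G^{\widetilde G}(\widetilde\sigma),\mathrm{Res}_G^{\widetilde G}(\widetilde\sigma)\big) = |\Pi_\sigma(G)|\cdot\langle\sigma,\widetilde\sigma\rangle_G^{2}.$$ -/

import Mathlib

open Matrix

noncomputable section

/-! ### Linear algebraic groups as closed subgroups of `GL_n` over an algebraically closed field -/

namespace LinAlgGroup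

variable {n : ℕ} {K : Type*} [Field K]

/-- A subset of `GL_n(K)` is `k`-closed if it is the set of common zeros in `GL_n(K)` of a family of
polynomials in the matrix entries with coefficients in `k`. For `k = K` these are the closed
sets of the Zariski topology of `GL_n(K)`. -/
def IsZariskiClosed (k : Type*) [Field k] [Algebra k K] (A : Set (GL (Fin n) K)) : Prop :=
  ∃ I : Set (MvPolynomial (Fin n × Fin n) k),
    A = {g : GL (Fin n) K | ∀ f ∈ I,
      MvPolynomial.aeval (fun ij => (g : Matrix (Fin n) (Fin n) K) ij.1 ij.2) f = 0}

/-- Connectedness of a subset in the Zariski topology of `GL_n(K)` (used for closed subgroups):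
it is not the union of two disjoint nonempty closed subsets. -/
def IsZariskiConnected (H : Subgroup (GL (Fin n) K)) : Prop :=
  ∀ A B : Set (GL (Fin n) K), IsZariskiClosed K A → IsZariskiClosed K B →
    A ∪ B = (H : Set (GL (Fin n) K)) → A ∩ B = ∅ → A = ∅ ∨ B = ∅

/-- A subgroup all of whose elements are unipotent matrices. -/
def IsUnipotentSubgroup (U : Subgroup (GL (Fin n) K)) : Prop :=
  ∀ u ∈ U, IsNilpotent ((u : Matrix (Fin n) (Fin n) K) - 1)

/-- The unipotent radical of `H` is trivial: every closed connected normal unipotent subgroup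
of `H` is trivial. -/
def HasTrivialUnipotentRadical (H : Subgroup (GL (Fin n) K)) : Prop :=
  ∀ U : Subgroup (GL (Fin n) K), U ≤ H → (U.subgroupOf H).Normal →
    IsZariskiClosed K (U : Set (GL (Fin n) K)) → IsZariskiConnected U →
    IsUnipotentSubgroup U → U = ⊥

/-- Let `F` be a field of characteristic zero and `K` an algebraically closed extension. A linear
algebraic group over `F` is given by its group of `K`-points `H`, an `F`-closed subgroup of
`GL_n(K)`. This says that the group is connected and reductive. -/
structure IsConnectedReductive (F : Type*) [Field F] [Algebra F K]
    (H : Subgroup (GL (Fin n) K)) : Prop where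
  closed : IsZariskiClosed F (H : Set (GL (Fin n) K))
  connected : IsZariskiConnected H
  reductive : HasTrivialUnipotentRadical H

/-- The group of `F`-points. When `F` is a topological field, it carries the topology induced from
`GL_n(F)`. -/
def points (F : Type*) [Field F] [Algebra F K] (H : Subgroup (GL (Fin n) K)) :
    Subgroup (GL (Fin n) F) :=
  H.comap (Matrix.GeneralLinearGroup.map (algebraMap F K))

theorem points_mono (F : Type*) [Field F] [Algebra F K] {H₁ H₂ : Subgroup (GL (Fin n) K)}
    (h : H₁ ≤ H₂) : points F H₁ ≤ points F H₂ :=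
  Subgroup.comap_mono h

end LinAlgGroup

/-! ### Complex representations -/

namespace Representation

variable {Γ : Type*} [Group Γ] {V : Type*} [AddCommGroup V] [Module ℂ V]

/-- A representation of a topological group is smooth if all stabilizers of vectors are open. -/
def IsSmooth [TopologicalSpace Γ] (ρ : Representation ℂ Γ V) : Prop :=
  ∀ v : V, IsOpen {g : Γ | ρ g v = v}

/-- The twist `ρ ⊗ χ` by a character. -/
def twist (ρ : Representation ℂ Γ V) (χ : Γ →* ℂˣ) : Representation ℂ Γ V where
  toFun g := (χ g : ℂ) • ρ g
  map_one' := by simp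
  map_mul' g h := by
    ext v
    simp [mul_smul, smul_comm (χ g : ℂ) (χ h : ℂ)]

/-- An irreducible constituent of `ρ`: an irreducible subquotient `upper / lower`, for invariant
subspaces `lower ≤ upper`. -/
structure IrrConstituent (ρ : Representation ℂ Γ V) where
  lower : Subrepresentation ρ
  upper : Subrepresentation ρ
  le : lower ≤ upper
  irreducible : (upper.toRepresentation.quotient
    (lower.toSubmodule.submoduleOf upper.toSubmodule)
    (fun g _ hv => lower.apply_mem_toSubmodule g hv)).IsIrreducible

namespace IrrConstituent

variable {ρ : Representation ℂ Γ V}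

/-- The space of a constituent. -/
abbrev Space (c : IrrConstituent ρ) : Type _ :=
  c.upper.toSubmodule ⧸ c.lower.toSubmodule.submoduleOf c.upper.toSubmodule

/-- A constituent as a representation. -/
def rep (c : IrrConstituent ρ) : Representation ℂ Γ c.Space :=
  c.upper.toRepresentation.quotient
    (c.lower.toSubmodule.submoduleOf c.upper.toSubmodule)
    (fun g _ hv => c.lower.apply_mem_toSubmodule g hv)

/-- Isomorphism of constituents. -/
instance isoSetoid (ρ : Representation ℂ Γ V) : Setoid (IrrConstituent ρ) where
  r c d := Nonempty (c.rep.Equiv d.rep)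
  iseqv :=
    { refl := fun c => ⟨Equiv.refl c.rep⟩
      symm := fun ⟨e⟩ => ⟨e.symm⟩
      trans := fun ⟨e⟩ ⟨f⟩ => ⟨e.trans f⟩ }

end IrrConstituent

/-- The set of isomorphism classes of irreducible constituents of `ρ`. -/
def ConstituentClasses (ρ : Representation ℂ Γ V) : Type _ :=
  Quotient (IrrConstituent.isoSetoid ρ)

/-- `σ` is isomorphic to an irreducible constituent of `ρ`. -/
def IsConstituent {W : Type*} [AddCommGroup W] [Module ℂ W]
    (σ : Representation ℂ Γ W) (ρ : Representation ℂ Γ V) : Prop :=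
  ∃ c : IrrConstituent ρ, Nonempty (σ.Equiv c.rep)

end Representation

namespace LinAlgGroup

variable {n : ℕ} {K : Type*} [Field K] {F : Type*} [Field F] [Algebra F K]
  {G Gt : Subgroup (GL (Fin n) K)} {V : Type*} [AddCommGroup V] [Module ℂ V]

/-- Restriction of a representation of the group of `F`-points of `Gt` to that of `G ≤ Gt`. -/
def res (h : G ≤ Gt) (π : Representation ℂ (points F Gt) V) : Representation ℂ (points F G) V :=
  π.comp (Subgroup.inclusion (points_mono F h))

/-- The characters `χ` of `Gt(F) / G(F)`, that is, the continuous homomorphisms `Gt(F) → ℂˣ` that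
are trivial on `G(F)`, such that `π ≃ π ⊗ χ`. -/
def fixingCharacters [TopologicalSpace F] (h : G ≤ Gt) (π : Representation ℂ (points F Gt) V) :
    Set (points F Gt →ₜ* ℂˣ) :=
  {χ | (∀ g : points F G, χ (Subgroup.inclusion (points_mono F h) g) = 1) ∧
    Nonempty (π.Equiv (π.twist (χ : points F Gt →* ℂˣ)))}

end LinAlgGroup

end

/-! Write `H` for the big group over the algebraic closure and `Γt`, `Γ` for the groups of
`F`-points of `Gt`, `G`. There are two independent halves: `Z(Γt)·Γ` has finite index in `Γt`
(`index_center_sup_ne_zero`), and Clifford theory for the finite abelian quotient `A =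
Γt/(Z(Γt)·Γ)`.

Clifford theory. A smooth irreducible representation of the second countable group `Γt` has
countable dimension, so its endomorphisms are scalars and the centre acts by scalars. Hence
conjugation by `Γt` on `End_Γ(σt)` factors through `A`, and `End_Γ(σt)` splits into eigenspaces. The
eigenspace of `χ` is `Hom(σt, σt ⊗ χ)`, of dimension one if `χ` fixes `σt` and zero otherwise. This
gives `|X(σt)| = dim End_Γ(σt)` (`span_fixingHoms`, `linearIndependent_ofTwist`). The restriction is
a finite direct sum of irreducibles, because the finitely many translates of a maximal
subrepresentation intersect in zero. The irreducible summands are conjugate up to isomorphism, so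
all occur with the same multiplicity `m`. With `r` classes there are `r m` summands, and `dim End =
r m²`.

Finite index. Reductivity enters through the trace form on the Lie algebra of `H`: its radical
consists of nilpotent matrices (Cartan's criterion, by Chevalley's replicas), and a nilpotent
algebra normalized by `H` meets the Lie algebra in zero, since otherwise it would exponentiate into
the unipotent radical. So the form is nondegenerate (`traceRad_eq_bot`) and the Lie algebra is the
sum of its centre and the span of the `gyg⁻¹ - y`. The centre is diagonalized by orthogonal
idempotents `π i` commuting with `H`. Suitable powers of the determinants on the blocks give a
homomorphism `Δ` from `H` to block scalar matrices of `H` which is the `N`-th power on block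
scalars. Its kernel contains the closure of `[H,H]`, hence a subgroup of `G`, with finite index.

Descent to `F`-points. Let `E` be a finite extension of `F` containing the entries of the `π i`. As
`Eˣ/(Eˣ)^N` is finite, on a subgroup of finite index `Δ(g)` is the `N`-th power of a block scalar
matrix over `E`; up to finite index `g = a b` with `a` block scalar in `H` over `E` and `b` in the
closure of `[H,H]`. The cocycle `τ ↦ a⁻¹τ(a)` takes values in a finite group and depends only on the
restriction of `τ` to `E`, so finitely many cocycles occur. Two elements with the same cocycle
differ by an `F`-rational central element times a point of `G`. -/

noncomputable section

namespace LinAlgGroup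

open MvPolynomial

/-! ### Left invariant derivations on polynomials in the matrix entries. -/

section Polynomials

variable {n : ℕ} {K : Type*} [Field K]

/-- Evaluation of a polynomial in the matrix entries at a matrix. -/
def evalMat {S : Type*} [CommRing S] [Algebra K S] (a : Matrix (Fin n) (Fin n) S) :
    MvPolynomial (Fin n × Fin n) K →ₐ[K] S :=
  aeval fun ij => a ij.1 ij.2

@[simp] theorem evalMat_X {S : Type*} [CommRing S] [Algebra K S] (a : Matrix (Fin n) (Fin n) S)
    (ij : Fin n × Fin n) : evalMat a (X ij : MvPolynomial (Fin n × Fin n) K) = a ij.1 ij.2 := by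
  simp [evalMat]

@[simp] theorem evalMat_C {S : Type*} [CommRing S] [Algebra K S] (a : Matrix (Fin n) (Fin n) S)
    (c : K) : evalMat a (C c : MvPolynomial (Fin n × Fin n) K) = algebraMap K S c := by
  simp [evalMat]

theorem evalMat_map {S T : Type*} [CommRing S] [Algebra K S] [CommRing T] [Algebra K T]
    (φ : S →ₐ[K] T) (a : Matrix (Fin n) (Fin n) S) (f : MvPolynomial (Fin n × Fin n) K) :
    φ (evalMat a f) = evalMat (a.map φ) f := by
  have : φ.comp (evalMat a) = evalMat (a.map φ) := by
    ext ij; simp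
  exact DFunLike.congr_fun this f

variable (n K) in
/-- The generic matrix. -/
def genMat : Matrix (Fin n) (Fin n) (MvPolynomial (Fin n × Fin n) K) :=
  Matrix.of fun i j => X (i, j)

@[simp] theorem genMat_map_evalMat {S : Type*} [CommRing S] [Algebra K S]
    (a : Matrix (Fin n) (Fin n) S) : (genMat n K).map (evalMat a) = a := by
  ext i j; simp [genMat]

/-- A constant matrix, as a matrix of polynomials. -/
def constMat (a : Matrix (Fin n) (Fin n) K) :
    Matrix (Fin n) (Fin n) (MvPolynomial (Fin n × Fin n) K) :=
  a.map C

@[simp] theorem constMat_map_evalMat (a b : Matrix (Fin n) (Fin n) K) :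
    (constMat a).map (evalMat b) = a := by
  ext i j; simp [constMat]

/-- The left invariant derivation attached to a matrix. -/
def lieDer (x : Matrix (Fin n) (Fin n) K) :
    Derivation K (MvPolynomial (Fin n × Fin n) K) (MvPolynomial (Fin n × Fin n) K) :=
  mkDerivation K fun ij => (genMat n K * constMat x) ij.1 ij.2

theorem lieDer_X (x : Matrix (Fin n) (Fin n) K) (ij : Fin n × Fin n) :
    lieDer x (X ij) = (genMat n K * constMat x) ij.1 ij.2 := by
  simp [lieDer]

theorem lieDer_add (x y : Matrix (Fin n) (Fin n) K) : lieDer (x + y) = lieDer x + lieDer y := by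
  refine derivation_ext fun ij => ?_
  simp [lieDer_X, constMat, Matrix.mul_apply, mul_add, Finset.sum_add_distrib]

theorem lieDer_smul (c : K) (x : Matrix (Fin n) (Fin n) K) :
    lieDer (c • x) = c • lieDer x := by
  refine derivation_ext fun ij => ?_
  simp only [lieDer_X, constMat, Matrix.mul_apply, Derivation.smul_apply, Finset.smul_sum,
    Matrix.map_apply, Matrix.smul_apply, smul_eq_mul, map_mul, MvPolynomial.smul_eq_C_mul]
  exact Finset.sum_congr rfl fun k _ => by ring

/-- Both sides are derivations, so it suffices to compare them on coordinates, where applying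
`lieDer y` and then `lieDer x` replaces the generic matrix `X` by `X x y`. -/
theorem lieDer_lie (x y : Matrix (Fin n) (Fin n) K) : lieDer ⁅x, y⁆ = ⁅lieDer x, lieDer y⁆ := by
  refine derivation_ext fun ij => ?_
  have key : ∀ x y : Matrix (Fin n) (Fin n) K,
      lieDer x (lieDer y (X ij)) = (genMat n K * constMat (x * y)) ij.1 ij.2 := by
    intro x y
    have : genMat n K * constMat (x * y) = genMat n K * constMat x * constMat y := by
      rw [constMat, Matrix.map_mul, Matrix.mul_assoc]; rfl
    rw [this, lieDer_X, Matrix.mul_apply, map_sum, Matrix.mul_apply]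
    refine Finset.sum_congr rfl fun k _ => ?_
    have h0 : lieDer x (constMat y k ij.2) = 0 := by
      simp [constMat, lieDer]
    rw [Derivation.leibniz, h0, show genMat n K ij.1 k = X (ij.1, k) from rfl, lieDer_X]
    simp [mul_comm]
  rw [Derivation.commutator_apply, key, key, lieDer_X, Ring.lie_def]
  simp [constMat, Matrix.mul_apply, mul_sub, Finset.sum_sub_distrib]

/-- The chain rule for a derivation and a matrix of elements, after a homomorphism. -/
theorem derivation_evalMat {B S : Type*} [CommRing B] [Algebra K B] [CommRing S] [Algebra K S]
    (φ : B →ₐ[K] S) (D : Derivation K B B) (A : Matrix (Fin n) (Fin n) B)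
    (y : Matrix (Fin n) (Fin n) K)
    (h : ∀ i j, φ (D (A i j)) = φ ((A * y.map (algebraMap K B)) i j))
    (f : MvPolynomial (Fin n × Fin n) K) :
    φ (D (evalMat A f)) = φ (evalMat A (lieDer y f)) := by
  induction f using MvPolynomial.induction_on with
  | C a => simp [lieDer]
  | add p q hp hq => simp [hp, hq]
  | mul_X p ij hp =>
    have hX : φ (evalMat A (lieDer y (X ij))) = φ (D (A ij.1 ij.2)) := by
      rw [h, lieDer_X, Matrix.mul_apply, Matrix.mul_apply, map_sum]
      simp [constMat, genMat]
    simp only [map_mul, Derivation.leibniz, smul_eq_mul, map_add, evalMat_X, hp, hX]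

theorem lieDer_evalMat {x y : Matrix (Fin n) (Fin n) K}
    {A : Matrix (Fin n) (Fin n) (MvPolynomial (Fin n × Fin n) K)}
    (h : ∀ i j, lieDer x (A i j) = (A * constMat y) i j) (f : MvPolynomial (Fin n × Fin n) K) :
    lieDer x (evalMat A f) = evalMat A (lieDer y f) :=
  derivation_evalMat (AlgHom.id K _) (lieDer x) A y h f

/-- Left translation of polynomials. -/
theorem lieDer_translate (x g : Matrix (Fin n) (Fin n) K) (f : MvPolynomial (Fin n × Fin n) K) :
    lieDer x (evalMat (constMat g * genMat n K) f) =
      evalMat (constMat g * genMat n K) (lieDer x f) := by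
  refine lieDer_evalMat (fun i j => ?_) f
  rw [Matrix.mul_assoc, Matrix.mul_apply, Matrix.mul_apply, map_sum]
  refine Finset.sum_congr rfl fun k _ => ?_
  rw [Derivation.leibniz, show genMat n K k j = X (k, j) from rfl, lieDer_X]
  simp [constMat, lieDer]

theorem map_mul_evalMat {S T : Type*} [CommRing S] [Algebra K S] [CommRing T] [Algebra K T]
    (φ : S →ₐ[K] T) (a b : Matrix (Fin n) (Fin n) S) :
    (a * b).map φ = a.map φ * b.map φ :=
  Matrix.map_mul (f := φ.toRingHom)

theorem evalMat_translate (g a : Matrix (Fin n) (Fin n) K) (f : MvPolynomial (Fin n × Fin n) K) :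
    evalMat a (evalMat (constMat g * genMat n K) f) = evalMat (g * a) f := by
  rw [evalMat_map, map_mul_evalMat, constMat_map_evalMat, genMat_map_evalMat]

/-- Left invariance moves every differentiation to the identity, where membership in the Lie algebra
is tested. -/
theorem evalMat_lieDer (g x : Matrix (Fin n) (Fin n) K) (f : MvPolynomial (Fin n × Fin n) K) :
    evalMat g (lieDer x f) = evalMat 1 (lieDer x (evalMat (constMat g * genMat n K) f)) := by
  rw [lieDer_translate, evalMat_translate, mul_one]

/-- The ring homomorphism to the dual numbers given by a point and a left invariant tangent
vector. -/
theorem evalMat_dual (g x : Matrix (Fin n) (Fin n) K) (f : MvPolynomial (Fin n × Fin n) K) :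
    evalMat (S := DualNumber K)
        (g.map (TrivSqZeroExt.inl) + (g * x).map (TrivSqZeroExt.inr)) f =
      TrivSqZeroExt.inl (evalMat g f) + TrivSqZeroExt.inr (evalMat g (lieDer x f)) := by
  induction f using MvPolynomial.induction_on with
  | C a => simp [lieDer]; rfl
  | add p q hp hq =>
    simp only [map_add, hp, hq, TrivSqZeroExt.inl_add, TrivSqZeroExt.inr_add]; abel
  | mul_X p ij hp =>
    rw [map_mul, hp, evalMat_X, map_mul, evalMat_X, Derivation.leibniz, lieDer_X, map_add]
    simp only [smul_eq_mul, map_mul, evalMat_X, Matrix.add_apply, Matrix.map_apply]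
    have : evalMat g ((genMat n K * constMat x) ij.1 ij.2) = (g * x) ij.1 ij.2 := by
      have := congrFun (congrFun (map_mul_evalMat (evalMat g) (genMat n K) (constMat x)) ij.1) ij.2
      simpa using this
    rw [this]
    ext
    · simp
    · simp; ring

theorem lieDer_zero : lieDer (0 : Matrix (Fin n) (Fin n) K) = 0 := by
  simpa using lieDer_smul 0 (0 : Matrix (Fin n) (Fin n) K)

/-- The differential at the identity. -/
def diffOne : MvPolynomial (Fin n × Fin n) K →ₗ[K] Module.Dual K (Matrix (Fin n) (Fin n) K) :=
  LinearMap.mk₂ K (fun f x => evalMat 1 (lieDer x f)) (by simp) (by simp)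
    (by simp [lieDer_add]) (by simp [lieDer_smul])

@[simp] theorem diffOne_apply (f : MvPolynomial (Fin n × Fin n) K)
    (x : Matrix (Fin n) (Fin n) K) : diffOne f x = evalMat 1 (lieDer x f) := rfl

end Polynomials

/-! ### The Lie algebra of a group of matrices. -/

section LieAlgebra

variable {n : ℕ} {K : Type*} [Field K]

/-- The ideal of all polynomials that vanish on a set of invertible matrices. -/
def vanIdeal (A : Set (GL (Fin n) K)) : Ideal (MvPolynomial (Fin n × Fin n) K) where
  carrier := {f | ∀ g ∈ A, evalMat (g : Matrix (Fin n) (Fin n) K) f = 0}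
  add_mem' hf hg a ha := by simp [hf a ha, hg a ha]
  zero_mem' a _ := by simp
  smul_mem' c f hf a ha := by simp [hf a ha]

theorem vanIdeal_anti {A B : Set (GL (Fin n) K)} (h : A ⊆ B) : vanIdeal B ≤ vanIdeal A :=
  fun _ hf g hg => hf g (h hg)

/-- The Zariski tangent space at the identity of a set of invertible matrices. -/
def lieAlg (A : Set (GL (Fin n) K)) : Submodule K (Matrix (Fin n) (Fin n) K) :=
  ((vanIdeal A).restrictScalars K |>.map diffOne).dualCoannihilator

theorem mem_lieAlg {A : Set (GL (Fin n) K)} {x : Matrix (Fin n) (Fin n) K} :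
    x ∈ lieAlg A ↔
      ∀ f ∈ vanIdeal A, evalMat (1 : Matrix (Fin n) (Fin n) K) (lieDer x f) = 0 := by
  simp [lieAlg, Submodule.mem_dualCoannihilator]

theorem lieAlg_mono {A B : Set (GL (Fin n) K)} (h : A ⊆ B) : lieAlg A ≤ lieAlg B :=
  fun _ hx => mem_lieAlg.2 fun f hf => mem_lieAlg.1 hx f (vanIdeal_anti h hf)

/-- A tangent vector at the identity extends to a left invariant field that preserves the whole
ideal: its value at `g` is its value at `1` on the translate of `f` by `g`, and this translate again
vanishes on the group. The arguments by iterated differentiation below rest on this. -/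
theorem lieDer_mem_vanIdeal {A : Subgroup (GL (Fin n) K)} {x : Matrix (Fin n) (Fin n) K}
    (hx : x ∈ lieAlg (A : Set (GL (Fin n) K))) {f : MvPolynomial (Fin n × Fin n) K}
    (hf : f ∈ vanIdeal (A : Set (GL (Fin n) K))) :
    lieDer x f ∈ vanIdeal (A : Set (GL (Fin n) K)) := by
  intro g hg
  rw [evalMat_lieDer]
  refine mem_lieAlg.1 hx _ fun a ha => ?_
  rw [evalMat_translate]
  exact hf (g * a) (A.mul_mem hg ha)

theorem lie_mem_lieAlg {A : Subgroup (GL (Fin n) K)} {x y : Matrix (Fin n) (Fin n) K}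
    (hx : x ∈ lieAlg (A : Set (GL (Fin n) K))) (hy : y ∈ lieAlg (A : Set (GL (Fin n) K))) :
    ⁅x, y⁆ ∈ lieAlg (A : Set (GL (Fin n) K)) := by
  refine mem_lieAlg.2 fun f hf => ?_
  rw [lieDer_lie, Derivation.commutator_apply, map_sub,
    mem_lieAlg.1 hx _ (lieDer_mem_vanIdeal hy hf), mem_lieAlg.1 hy _ (lieDer_mem_vanIdeal hx hf),
    sub_zero]

theorem lieDer_conj (x g h : Matrix (Fin n) (Fin n) K) (hg : h * g = 1)
    (f : MvPolynomial (Fin n × Fin n) K) :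
    lieDer x (evalMat (constMat g * genMat n K * constMat h) f) =
      evalMat (constMat g * genMat n K * constMat h) (lieDer (g * x * h) f) := by
  refine lieDer_evalMat (fun i j => ?_) f
  have h1 : constMat g * genMat n K * constMat h * constMat (g * x * h) =
      constMat g * (genMat n K * constMat x) * constMat h := by
    have : constMat h * constMat (g * x * h) = constMat (x * h) := by
      simp only [constMat]
      rw [← Matrix.map_mul, ← Matrix.mul_assoc, ← Matrix.mul_assoc, hg, one_mul]
    have h2 : constMat (x * h) = constMat x * constMat h := by
      simp only [constMat]; rw [Matrix.map_mul]
    rw [Matrix.mul_assoc _ (constMat h), this, h2]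
    simp only [Matrix.mul_assoc]
  rw [h1]
  simp only [Matrix.mul_apply, map_sum, Finset.sum_mul, Finset.mul_sum]
  refine Finset.sum_congr rfl fun k _ => Finset.sum_congr rfl fun l _ => ?_
  have e1 : lieDer x (constMat g i l) = 0 := by simp [constMat, lieDer]
  have e2 : lieDer x (constMat h k j) = 0 := by simp [constMat, lieDer]
  rw [Derivation.leibniz, Derivation.leibniz, e1, e2,
    show genMat n K l k = X (l, k) from rfl, lieDer_X, Matrix.mul_apply]
  simp only [smul_eq_mul, mul_zero, add_zero, zero_add, Finset.mul_sum]
  exact Finset.sum_congr rfl fun _ _ => by ring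

theorem conj_mem_lieAlg {A : Subgroup (GL (Fin n) K)} {x : Matrix (Fin n) (Fin n) K}
    (hx : x ∈ lieAlg (A : Set (GL (Fin n) K))) {g : GL (Fin n) K} (hg : g ∈ A) :
    (g : Matrix (Fin n) (Fin n) K) * x * (g⁻¹ : GL (Fin n) K) ∈
      lieAlg (A : Set (GL (Fin n) K)) := by
  refine mem_lieAlg.2 fun f hf => ?_
  have h1 := lieDer_conj x (g : Matrix (Fin n) (Fin n) K)
    ((g⁻¹ : GL (Fin n) K) : Matrix (Fin n) (Fin n) K) (by rw [← Units.val_mul]; simp) f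
  have h2 := congrArg (evalMat (1 : Matrix (Fin n) (Fin n) K)) h1
  rw [evalMat_map _ _ (lieDer _ f)] at h2
  simp only [map_mul_evalMat, constMat_map_evalMat, genMat_map_evalMat, mul_one] at h2
  rw [← Units.val_mul, mul_inv_cancel, Units.val_one] at h2
  rw [← h2]
  refine mem_lieAlg.1 hx _ fun a ha => ?_
  rw [evalMat_map]
  simp only [map_mul_evalMat, constMat_map_evalMat, genMat_map_evalMat]
  rw [← Units.val_mul, ← Units.val_mul]
  exact hf _ (A.mul_mem (A.mul_mem hg ha) (A.inv_mem hg))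

end LieAlgebra

end LinAlgGroup
end

noncomputable section

/-- Finiteness criterion used for all index estimates below. The map `κ` need not be a homomorphism;
it only has to separate the left cosets of `S`, so choices may enter its definition. -/
theorem Subgroup.relIndex_ne_zero_of_map {Γ α : Type*} [Group Γ] [Finite α] (S T : Subgroup Γ)
    (κ : T → α) (h : ∀ a b : T, κ a = κ b → (a : Γ)⁻¹ * b ∈ S) : S.relIndex T ≠ 0 := by
  have : Finite (T ⧸ S.subgroupOf T) := by
    refine Finite.of_injective (fun q => κ q.out) fun q r hqr => ?_
    rw [← Quotient.out_eq' q, ← Quotient.out_eq' r]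
    exact QuotientGroup.eq.2 (h _ _ hqr)
  rw [Subgroup.relIndex, Subgroup.index]
  exact Nat.card_pos.ne'

namespace LinAlgGroup

open MvPolynomial

/-! ### First order Taylor expansion at the identity matrix. -/

section Taylor

variable {n : ℕ} {K : Type*} [Field K]

variable (n K) in
/-- The maximal ideal of the identity matrix. -/
def idealOne : Ideal (MvPolynomial (Fin n × Fin n) K) :=
  RingHom.ker (evalMat (1 : Matrix (Fin n) (Fin n) K))

theorem mem_idealOne {f : MvPolynomial (Fin n × Fin n) K} :
    f ∈ idealOne n K ↔ evalMat (1 : Matrix (Fin n) (Fin n) K) f = 0 := Iff.rfl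

/-- The affine function vanishing at the identity with a given differential. -/
def linPart (φ : Module.Dual K (Matrix (Fin n) (Fin n) K)) : MvPolynomial (Fin n × Fin n) K :=
  ∑ i, ∑ j, C (φ (Matrix.single i j 1)) * (X (i, j) - C ((1 : Matrix (Fin n) (Fin n) K) i j))

theorem linPart_mem (φ : Module.Dual K (Matrix (Fin n) (Fin n) K)) :
    linPart φ ∈ idealOne n K := by
  simp [mem_idealOne, linPart]

theorem diffOne_X (ij : Fin n × Fin n) (x : Matrix (Fin n) (Fin n) K) :
    diffOne (X ij) x = x ij.1 ij.2 := by
  have := congrFun (congrFun (map_mul_evalMat (evalMat (1 : Matrix (Fin n) (Fin n) K))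
    (genMat n K) (constMat x)) ij.1) ij.2
  simpa [lieDer_X] using this

theorem diffOne_C (c : K) : diffOne (C c : MvPolynomial (Fin n × Fin n) K) = 0 := by
  ext x; simp [lieDer]

theorem diffOne_mul (f g : MvPolynomial (Fin n × Fin n) K) :
    diffOne (f * g) = evalMat (1 : Matrix (Fin n) (Fin n) K) f • diffOne g +
      evalMat (1 : Matrix (Fin n) (Fin n) K) g • diffOne f := by
  ext x; simp [Derivation.leibniz]

theorem diffOne_linPart (φ : Module.Dual K (Matrix (Fin n) (Fin n) K)) :
    diffOne (linPart φ) = φ := by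
  ext x
  rw [linPart]
  simp only [map_sum, diffOne_mul, map_sub, diffOne_C, evalMat_C, evalMat_X, LinearMap.sum_apply,
    LinearMap.smul_apply, diffOne_X, sub_zero, Algebra.algebraMap_self,
    RingHom.id_apply, sub_self, add_zero, smul_zero, smul_eq_mul]
  conv_rhs => rw [Matrix.matrix_eq_sum_single x]
  simp only [map_sum]
  refine Finset.sum_congr rfl fun i _ => Finset.sum_congr rfl fun j _ => ?_
  rw [show Matrix.single i j (x i j) = x i j • Matrix.single i j (1 : K) by
    rw [Matrix.smul_single]; simp, map_smul, smul_eq_mul, mul_comm]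

theorem linPart_add (φ ψ : Module.Dual K (Matrix (Fin n) (Fin n) K)) :
    linPart (φ + ψ) = linPart φ + linPart ψ := by
  simp [linPart, add_mul, Finset.sum_add_distrib]

theorem linPart_smul (c : K) (φ : Module.Dual K (Matrix (Fin n) (Fin n) K)) :
    linPart (c • φ) = C c * linPart φ := by
  simp [linPart, Finset.mul_sum, mul_assoc]

theorem linPart_zero : linPart (0 : Module.Dual K (Matrix (Fin n) (Fin n) K)) = 0 := by
  simp [linPart]

theorem linPart_diffOne_X (ij : Fin n × Fin n) :
    linPart (diffOne (X ij : MvPolynomial (Fin n × Fin n) K)) =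
      X ij - C ((1 : Matrix (Fin n) (Fin n) K) ij.1 ij.2) := by
  obtain ⟨i, j⟩ := ij
  simp only [linPart, diffOne_X]
  rw [Finset.sum_eq_single i, Finset.sum_eq_single j]
  · simp
  · intro b _ hb; simp [Matrix.single, hb]
  · simp
  · intro b _ hb; exact Finset.sum_eq_zero fun c _ => by simp [Matrix.single, hb]
  · simp

theorem taylor_mem (f : MvPolynomial (Fin n × Fin n) K) :
    f - C (evalMat (1 : Matrix (Fin n) (Fin n) K) f) - linPart (diffOne f) ∈ idealOne n K ^ 2 := by
  induction f using MvPolynomial.induction_on with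
  | C a => simp [diffOne_C, linPart_zero]
  | add p q hp hq =>
    have := add_mem hp hq
    simp only [map_add, linPart_add]
    convert this using 1; ring
  | mul_X p ij hp =>
    set x1 := (1 : Matrix (Fin n) (Fin n) K) ij.1 ij.2 with hx1
    have h1 : linPart (diffOne p) * (X ij - C x1) ∈ idealOne n K ^ 2 := by
      rw [pow_two]
      refine Ideal.mul_mem_mul (linPart_mem _) ?_
      simp [mem_idealOne, hx1]
    have h2 := add_mem (Ideal.mul_mem_right (X ij) _ hp) h1
    rw [diffOne_mul, linPart_add, linPart_smul, linPart_smul, linPart_diffOne_X, map_mul,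
      evalMat_X, ← hx1, map_mul]
    convert h2 using 1; ring

theorem mem_idealOne_sq {f : MvPolynomial (Fin n × Fin n) K} (hf : f ∈ idealOne n K)
    (hd : diffOne f = 0) : f ∈ idealOne n K ^ 2 := by
  have := taylor_mem f
  rwa [mem_idealOne.1 hf, hd, linPart_zero, map_zero, sub_zero, sub_zero] at this

end Taylor

/-! ### Ideals stable under a Lie algebra, and subgroups that contain a neighbourhood of the
identity. -/

section Open

variable {n : ℕ} {K : Type*} [Field K]

/-- Finite-dimensional duality: a differential that kills the Lie algebra is already the
differential of some `p` in the ideal of `A`, and `w - p` then has trivial first order part. -/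
theorem mem_sup_sq {A : Set (GL (Fin n) K)} (hA : 1 ∈ A) {w : MvPolynomial (Fin n × Fin n) K}
    (hw : w ∈ idealOne n K) (h : ∀ x ∈ lieAlg A, diffOne w x = 0) :
    w ∈ vanIdeal A ⊔ idealOne n K ^ 2 := by
  have h1 : diffOne w ∈ (lieAlg A).dualAnnihilator := by
    rw [Submodule.mem_dualAnnihilator]; exact h
  rw [lieAlg, Subspace.dualCoannihilator_dualAnnihilator_eq] at h1
  obtain ⟨p, hp, hpw⟩ := h1
  have hp' : p ∈ vanIdeal A := hp
  have h2 : w - p ∈ idealOne n K ^ 2 := by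
    refine mem_idealOne_sq (sub_mem hw ?_) (by rw [map_sub, hpw, sub_self])
    exact mem_idealOne.2 (by simpa using hp' 1 hA)
  rw [← add_sub_cancel p w]
  exact add_mem (Ideal.mem_sup_left hp') (Ideal.mem_sup_right h2)

/-- An Euler field `∑ tᵢ Dᵢ`: the `Dᵢ` are the left invariant derivations of a basis of the Lie
algebra and the `tᵢ` are affine functions with dual differentials. Modulo the ideal of `A` it is the
identity on first order terms. Two ideals `J`, `J'` appear in the first clause because it is applied
both to stable ideals and to an ideal known only to be mapped into a larger one. -/
theorem exists_euler {A : Subgroup (GL (Fin n) K)} :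
    ∃ E : Derivation K (MvPolynomial (Fin n × Fin n) K) (MvPolynomial (Fin n × Fin n) K),
      (∀ (J J' : Ideal (MvPolynomial (Fin n × Fin n) K)),
        (∀ x ∈ lieAlg (A : Set (GL (Fin n) K)), ∀ f ∈ J, lieDer x f ∈ J') →
        ∀ f ∈ J, E f ∈ idealOne n K * J') ∧
      ∀ w ∈ idealOne n K, E w - w ∈ vanIdeal (A : Set (GL (Fin n) K)) ⊔ idealOne n K ^ 2 := by
  set L := lieAlg (A : Set (GL (Fin n) K)) with hL
  let b := Module.finBasis K L
  have hext : ∀ i, ∃ φ : Module.Dual K (Matrix (Fin n) (Fin n) K), φ ∘ₗ L.subtype = b.coord i :=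
    fun i => LinearMap.exists_extend _
  choose φ hφ using hext
  have hφ' : ∀ i j, φ i (b j) = if i = j then 1 else 0 := by
    intro i j
    have := LinearMap.congr_fun (hφ i) (b j)
    simp only [LinearMap.comp_apply, Submodule.subtype_apply] at this
    rw [this]; simp [Finsupp.single_apply, eq_comm]
  have hE : ∀ f, (∑ i, linPart (φ i) • lieDer (b i : Matrix (Fin n) (Fin n) K)) f =
      ∑ i, linPart (φ i) * lieDer (b i : Matrix (Fin n) (Fin n) K) f := by
    intro f
    rw [← Derivation.coeFnAddMonoidHom_apply, map_sum, Finset.sum_apply]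
    rfl
  refine ⟨∑ i, linPart (φ i) • lieDer (b i : Matrix (Fin n) (Fin n) K), ?_, ?_⟩
  · intro J J' h f hf
    rw [hE]
    exact sum_mem fun i _ => Ideal.mul_mem_mul (linPart_mem _) (h _ (b i).2 f hf)
  · intro w hw
    rw [hE]
    set c : _ → K := fun i => diffOne w (b i) with hc
    have h1 : ∑ i, linPart (φ i) * lieDer (b i : Matrix (Fin n) (Fin n) K) w -
        ∑ i, C (c i) * linPart (φ i) ∈ idealOne n K ^ 2 := by
      rw [← Finset.sum_sub_distrib]
      refine sum_mem fun i _ => ?_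
      rw [mul_comm (C _), ← mul_sub, pow_two]
      refine Ideal.mul_mem_mul (linPart_mem _) ?_
      simp [mem_idealOne, hc]
    have h2 : w - ∑ i, C (c i) * linPart (φ i) ∈
        vanIdeal (A : Set (GL (Fin n) K)) ⊔ idealOne n K ^ 2 := by
      refine mem_sup_sq A.one_mem (sub_mem hw (sum_mem fun i _ =>
        Ideal.mul_mem_left _ _ (linPart_mem _))) fun x hx => ?_
      have hsum : diffOne (w - ∑ i, C (c i) * linPart (φ i)) = diffOne w - ∑ i, c i • φ i := by
        simp [map_sub, map_sum, ← MvPolynomial.smul_eq_C_mul, diffOne_linPart]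
      have hz : (diffOne w - ∑ i, c i • φ i) ∘ₗ L.subtype = 0 := by
        refine b.ext fun j => ?_
        simp [hφ', hc]
      rw [hsum]
      exact LinearMap.congr_fun hz ⟨x, hx⟩
    have h3 := sub_mem (SetLike.le_def.1 (le_sup_right (a := vanIdeal (A : Set (GL (Fin n) K)))) h1) h2
    convert h3 using 1; ring

theorem mul_sup_le_sup {R : Type*} [CommRing R] (I P Q : Ideal R) :
    I * (P ⊔ Q) ≤ P ⊔ I * Q := by
  rw [Ideal.mul_sup]
  exact sup_le_sup_right Ideal.mul_le_right _

/-- By the Leibniz rule, a field that is the identity on first order terms multiplies terms of order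
`k` by `k`. -/
theorem euler_pow {P : Ideal (MvPolynomial (Fin n × Fin n) K)}
    {E : Derivation K (MvPolynomial (Fin n × Fin n) K) (MvPolynomial (Fin n × Fin n) K)}
    (h0 : ∀ f, E f ∈ idealOne n K)
    (h1 : ∀ w ∈ idealOne n K, E w - w ∈ P ⊔ idealOne n K ^ 2) (k : ℕ) :
    ∀ f ∈ idealOne n K ^ k, E f - (k : MvPolynomial (Fin n × Fin n) K) * f ∈
      P ⊔ idealOne n K ^ (k + 1) := by
  induction k with
  | zero => intro f _; simpa using Ideal.mem_sup_right (h0 f)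
  | succ k ih =>
    intro f hf
    rw [pow_succ] at hf
    refine Submodule.mul_induction_on hf (fun a ha w hw => ?_) (fun x y hx hy => ?_)
    · have e : E (a * w) - ((k + 1 : ℕ) : MvPolynomial (Fin n × Fin n) K) * (a * w) =
          a * (E w - w) + w * (E a - (k : MvPolynomial (Fin n × Fin n) K) * a) := by
        rw [Derivation.leibniz]; push_cast; simp only [smul_eq_mul]; ring
      rw [e]
      refine add_mem ?_ ?_
      · have := Ideal.mul_mem_mul ha (h1 w hw)
        have := mul_sup_le_sup _ _ _ this
        rwa [← pow_add] at this
      · have := Ideal.mul_mem_mul hw (ih a ha)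
        have := mul_sup_le_sup _ _ _ this
        rwa [← pow_succ'] at this
    · have := add_mem hx hy
      rw [map_add]
      convert this using 1; ring

theorem euler_sup_pow {P : Ideal (MvPolynomial (Fin n × Fin n) K)}
    {E : Derivation K (MvPolynomial (Fin n × Fin n) K) (MvPolynomial (Fin n × Fin n) K)}
    (hEP : ∀ f ∈ P, E f ∈ P) (h0 : ∀ f, E f ∈ idealOne n K)
    (h1 : ∀ w ∈ idealOne n K, E w - w ∈ P ⊔ idealOne n K ^ 2) (k : ℕ) 
    (f : MvPolynomial (Fin n × Fin n) K) (hf : f ∈ P ⊔ idealOne n K ^ k) :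
    E f - (k : MvPolynomial (Fin n × Fin n) K) * f ∈ P ⊔ idealOne n K ^ (k + 1) := by
  obtain ⟨p, hp, g, hg, rfl⟩ := Submodule.mem_sup.1 hf
  have h3 := euler_pow h0 h1 k g hg
  have h4 : E p - (k : MvPolynomial (Fin n × Fin n) K) * p ∈ P :=
    sub_mem (hEP p hp) (Ideal.mul_mem_left _ _ hp)
  have h5 : E p - (k : MvPolynomial (Fin n × Fin n) K) * p ∈ P ⊔ idealOne n K ^ (k + 1) :=
    Ideal.mem_sup_left h4
  have := add_mem h5 h3
  rw [map_add]
  convert this using 1; ring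

variable [CharZero K]

/-- Let `m` be the ideal of the identity and `P` that of `A`. If `J ≤ P + m^k`, stability of `J`
gives `E f ∈ m(P + m^k) ≤ P + m^(k+1)`, while `E f` is congruent to `k f`; dividing by `k` in
characteristic zero raises the order by one. The step from order `0` to `1` cannot be divided and is
the hypothesis `J ≤ m`. -/
theorem le_vanIdeal_sup_pow {A : Subgroup (GL (Fin n) K)}
    {J : Ideal (MvPolynomial (Fin n × Fin n) K)} (hJ : J ≤ idealOne n K)
    (hD : ∀ x ∈ lieAlg (A : Set (GL (Fin n) K)), ∀ f ∈ J, lieDer x f ∈ J) (k : ℕ) :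
    J ≤ vanIdeal (A : Set (GL (Fin n) K)) ⊔ idealOne n K ^ k := by
  obtain ⟨E, hE1, hE2⟩ := exists_euler (A := A)
  set P := vanIdeal (A : Set (GL (Fin n) K)) with hP
  have hEP : ∀ f ∈ P, E f ∈ P := fun f hf =>
    Ideal.mul_le_right (hE1 P P (fun x hx f hf => lieDer_mem_vanIdeal hx hf) f hf)
  have hE0 : ∀ f, E f ∈ idealOne n K := fun f =>
    Ideal.mul_le_left (hE1 ⊤ ⊤ (fun _ _ _ _ => trivial) f trivial)
  induction k with
  | zero => simp
  | succ k ih =>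
    rcases Nat.eq_zero_or_pos k with rfl | hk
    · simpa using hJ.trans le_sup_right
    · intro f hf
      have h1 : E f ∈ P ⊔ idealOne n K ^ (k + 1) := by
        have := hE1 J (P ⊔ idealOne n K ^ k) (fun x hx f hf => ih (hD x hx f hf)) f hf
        have := mul_sup_le_sup _ _ _ this
        rwa [← pow_succ'] at this
      have h2 := euler_sup_pow hEP hE0 hE2 k f (ih hf)
      have h3 := Ideal.mul_mem_left _ (C (k : K)⁻¹) (sub_mem h1 h2)
      have h4 : C (k : K)⁻¹ * (k : MvPolynomial (Fin n × Fin n) K) = 1 := by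
        rw [← map_natCast (C (R := K)), ← map_mul, inv_mul_cancel₀ (by exact_mod_cast hk.ne'), map_one]
      rwa [sub_sub_cancel, ← mul_assoc, h4, one_mul] at h3

/-- An ideal at the identity that is stable under the Lie algebra of `A` agrees with the ideal
of `A` near the identity. -/
theorem exists_mul_mem_vanIdeal {A : Subgroup (GL (Fin n) K)}
    {J : Ideal (MvPolynomial (Fin n × Fin n) K)} (hJ : J ≤ idealOne n K)
    (hD : ∀ x ∈ lieAlg (A : Set (GL (Fin n) K)), ∀ f ∈ J, lieDer x f ∈ J) :
    ∃ q, evalMat (1 : Matrix (Fin n) (Fin n) K) q = 1 ∧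
      ∀ f ∈ J, q * f ∈ vanIdeal (A : Set (GL (Fin n) K)) := by
  set P := vanIdeal (A : Set (GL (Fin n) K)) with hP
  -- Krull's intersection theorem in the coordinate ring of `A`: an element in all powers of an
  -- ideal is killed by `1 - s` for some `s` in the ideal.
  have h1 : ∀ f ∈ J, ∃ s ∈ idealOne n K, (1 - s) * f ∈ P := by
    intro f hf
    let π := Ideal.Quotient.mk P
    have : π f ∈ ⨅ i : ℕ, ((idealOne n K).map π) ^ i •
        (⊤ : Submodule (MvPolynomial (Fin n × Fin n) K ⧸ P) (MvPolynomial (Fin n × Fin n) K ⧸ P)) := by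
      rw [Submodule.mem_iInf]
      intro i
      obtain ⟨p, hp, g, hg, hpg⟩ := Submodule.mem_sup.1 (le_vanIdeal_sup_pow hJ hD i hf)
      have : π f = π g := by
        rw [← hpg, map_add, Ideal.Quotient.eq_zero_iff_mem.2 hp, zero_add]
      rw [this, smul_eq_mul, Ideal.mul_top, ← Ideal.map_pow]
      exact Ideal.mem_map_of_mem _ hg
    obtain ⟨⟨r, hr⟩, hrf⟩ := (Ideal.mem_iInf_smul_pow_eq_bot_iff _ _).1 this
    obtain ⟨s, hs, rfl⟩ := (Ideal.mem_map_iff_of_surjective π Ideal.Quotient.mk_surjective).1 hr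
    refine ⟨s, hs, ?_⟩
    rw [← Ideal.Quotient.eq_zero_iff_mem, map_mul, map_sub, map_one, sub_mul, one_mul]
    exact sub_eq_zero.2 hrf.symm
  classical
  obtain ⟨S, hS⟩ := IsNoetherian.noetherian J
  have h2 : ∀ f : S, ∃ s ∈ idealOne n K, (1 - s) * (f : MvPolynomial (Fin n × Fin n) K) ∈ P :=
    fun f => h1 f (hS ▸ Submodule.subset_span f.2)
  choose s hs hsP using h2
  -- One multiplier for all of `J`: the product over a finite set of generators.
  refine ⟨∏ f : S, (1 - s f), ?_, ?_⟩
  · rw [map_prod]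
    exact Finset.prod_eq_one fun f _ => by simp [mem_idealOne.1 (hs f)]
  · intro f hf
    rw [← hS] at hf
    induction hf using Submodule.span_induction with
    | mem x hx =>
      rw [← Finset.mul_prod_erase _ _ (Finset.mem_univ (⟨x, hx⟩ : S)), mul_comm (1 - _), mul_assoc]
      exact Ideal.mul_mem_left _ _ (hsP ⟨x, hx⟩)
    | zero => simp
    | add x y _ _ hx hy => rw [mul_add]; exact add_mem hx hy
    | smul a x _ hx => rw [smul_eq_mul, mul_left_comm]; exact Ideal.mul_mem_left _ _ hx

-- The translates of `{q ≠ 0}` by elements `g` of `A` cover `A`, since the one attached to `g`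
-- contains `g`. By noetherianity finitely many suffice, and each lies, within `A`, in a single
-- coset `gM`.
omit [CharZero K] in
theorem relIndex_ne_zero_of_open {A M : Subgroup (GL (Fin n) K)}
    {q : MvPolynomial (Fin n × Fin n) K} (hq : evalMat (1 : Matrix (Fin n) (Fin n) K) q = 1)
    (h : ∀ x ∈ A, evalMat (x : Matrix (Fin n) (Fin n) K) q ≠ 0 → x ∈ M) : M.relIndex A ≠ 0 := by
  let Q : A → MvPolynomial (Fin n × Fin n) K := fun g =>
    evalMat (constMat (((g : GL (Fin n) K)⁻¹ : GL (Fin n) K) : Matrix (Fin n) (Fin n) K) * genMat n K) q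
  have hQ : ∀ (g : A) (x : GL (Fin n) K), evalMat (x : Matrix (Fin n) (Fin n) K) (Q g) =
      evalMat (((g : GL (Fin n) K)⁻¹ * x : GL (Fin n) K) : Matrix (Fin n) (Fin n) K) q := by
    intro g x
    simp only [Q]
    rw [evalMat_translate, ← Units.val_mul]
  obtain ⟨S, hS1, hS2⟩ := Submodule.fg_span_iff_fg_span_finset_subset (Set.range Q) |>.1
    (IsNoetherian.noetherian (Submodule.span (MvPolynomial (Fin n × Fin n) K) (Set.range Q)))
  have h1 : ∀ x : A, ∃ f : S, evalMat ((x : GL (Fin n) K) : Matrix (Fin n) (Fin n) K)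
      (f : MvPolynomial (Fin n × Fin n) K) ≠ 0 := by
    intro x
    by_contra! hx
    have h2 : Q x ∈ RingHom.ker (evalMat (K := K) ((x : GL (Fin n) K) : Matrix (Fin n) (Fin n) K)) := by
      have h3 : Submodule.span (MvPolynomial (Fin n × Fin n) K) (Set.range Q) ≤
          RingHom.ker (evalMat (K := K) ((x : GL (Fin n) K) : Matrix (Fin n) (Fin n) K)) := by
        rw [hS2, Submodule.span_le]
        exact fun f hf => hx ⟨f, hf⟩
      exact h3 (Submodule.subset_span ⟨x, rfl⟩)
    have h4 : evalMat ((x : GL (Fin n) K) : Matrix (Fin n) (Fin n) K) (Q x) = 0 := h2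
    rw [hQ, inv_mul_cancel, Units.val_one, hq] at h4
    exact one_ne_zero h4
  choose κ hκ using h1
  have h2 : ∀ f : S, ∃ g : A, Q g = f := fun f => hS1 f.2
  choose g hg using h2
  refine Subgroup.relIndex_ne_zero_of_map M A κ fun a b hab => ?_
  have key : ∀ x : A, ((g (κ x) : A) : GL (Fin n) K)⁻¹ * x ∈ M := by
    intro x
    refine h _ (A.mul_mem (A.inv_mem (g (κ x)).2) x.2) ?_
    rw [← hQ, hg]; exact hκ x
  have := M.mul_mem (M.inv_mem (key a)) (key b)
  rw [← hab] at this
  simpa [mul_assoc] using this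

-- A subgroup containing a neighbourhood of `1` is open, so its complement in `A` is closed. The
-- equations of the complement are `q(m⁻¹x) = 0` for all `m` in `M`: an element `x` of `M` violates
-- the one with `m = x`, as `q(1) = 1`.
omit [CharZero K] in
theorem eq_of_open {A M : Subgroup (GL (Fin n) K)} (hMA : M ≤ A)
    (hA : IsZariskiClosed K (A : Set (GL (Fin n) K))) (hM : IsZariskiClosed K (M : Set (GL (Fin n) K)))
    (hc : IsZariskiConnected A)
    {q : MvPolynomial (Fin n × Fin n) K} (hq : evalMat (1 : Matrix (Fin n) (Fin n) K) q = 1)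
    (h : ∀ x ∈ A, evalMat (x : Matrix (Fin n) (Fin n) K) q ≠ 0 → x ∈ M) : M = A := by
  obtain ⟨I, hI⟩ := hA
  have hB : IsZariskiClosed K ((A : Set (GL (Fin n) K)) \ M) := by
    refine ⟨I ∪ Set.range fun m : M =>
      evalMat (constMat (((m : GL (Fin n) K)⁻¹ : GL (Fin n) K) : Matrix (Fin n) (Fin n) K) * genMat n K) q, ?_⟩
    have hQ : ∀ (g : M) (x : GL (Fin n) K), evalMat (x : Matrix (Fin n) (Fin n) K)
        (evalMat (constMat (((g : GL (Fin n) K)⁻¹ : GL (Fin n) K) : Matrix (Fin n) (Fin n) K) * genMat n K) q) =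
        evalMat (((g : GL (Fin n) K)⁻¹ * x : GL (Fin n) K) : Matrix (Fin n) (Fin n) K) q := by
      intro g x
      rw [evalMat_translate, ← Units.val_mul]
    have hIx : ∀ x : GL (Fin n) K, x ∈ A ↔
        ∀ f ∈ I, evalMat (x : Matrix (Fin n) (Fin n) K) f = 0 := fun x => by
      rw [← SetLike.mem_coe, hI]; rfl
    ext x
    constructor
    · rintro ⟨hx, hxM⟩ f (hf | ⟨m, rfl⟩)
      · exact (hIx x).1 hx f hf
      · change evalMat (x : Matrix (Fin n) (Fin n) K) _ = 0
        rw [hQ]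
        by_contra hne
        have := h _ (A.mul_mem (A.inv_mem (hMA m.2)) hx) hne
        exact hxM (by simpa using M.mul_mem m.2 this)
    · intro hx
      refine ⟨(hIx x).2 fun f hf => hx f (Or.inl hf), fun hxM => ?_⟩
      have := hx _ (Or.inr ⟨⟨x, hxM⟩, rfl⟩)
      change evalMat (x : Matrix (Fin n) (Fin n) K) _ = 0 at this
      rw [hQ] at this
      simp [hq] at this
  rcases hc _ _ hM hB (by rw [Set.union_sdiff_cancel hMA]) (by simp) with h0 | h0
  · exact absurd h0 (Set.nonempty_iff_ne_empty.1 ⟨1, M.one_mem⟩)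
  · exact le_antisymm hMA (Set.sdiff_eq_empty.1 h0)

/-- If `J` is stable under the Lie algebra of `A`, its zero set in `A`, if contained in a
subgroup `M`, forces `M` to have finite index. -/
theorem relIndex_ne_zero_of_stable {A M : Subgroup (GL (Fin n) K)}
    {J : Ideal (MvPolynomial (Fin n × Fin n) K)} (hJ : J ≤ idealOne n K)
    (hD : ∀ x ∈ lieAlg (A : Set (GL (Fin n) K)), ∀ f ∈ J, lieDer x f ∈ J)
    (hM : ∀ x ∈ A, (∀ f ∈ J, evalMat (x : Matrix (Fin n) (Fin n) K) f = 0) → x ∈ M) :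
    M.relIndex A ≠ 0 := by
  obtain ⟨q, hq, hqJ⟩ := exists_mul_mem_vanIdeal hJ hD
  refine relIndex_ne_zero_of_open hq fun x hx hqx => hM x hx fun f hf => ?_
  have := hqJ f hf x hx
  rw [map_mul] at this
  exact (mul_eq_zero.1 this).resolve_left hqx

theorem eq_of_stable {A M : Subgroup (GL (Fin n) K)} (hMA : M ≤ A)
    (hA : IsZariskiClosed K (A : Set (GL (Fin n) K))) (hM' : IsZariskiClosed K (M : Set (GL (Fin n) K)))
    (hc : IsZariskiConnected A)
    {J : Ideal (MvPolynomial (Fin n × Fin n) K)} (hJ : J ≤ idealOne n K)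
    (hD : ∀ x ∈ lieAlg (A : Set (GL (Fin n) K)), ∀ f ∈ J, lieDer x f ∈ J)
    (hM : ∀ x ∈ A, (∀ f ∈ J, evalMat (x : Matrix (Fin n) (Fin n) K) f = 0) → x ∈ M) :
    M = A := by
  obtain ⟨q, hq, hqJ⟩ := exists_mul_mem_vanIdeal hJ hD
  refine eq_of_open hMA hA hM' hc hq fun x hx hqx => hM x hx fun f hf => ?_
  have := hqJ f hf x hx
  rw [map_mul] at this
  exact (mul_eq_zero.1 this).resolve_left hqx

end Open

end LinAlgGroup
end

noncomputable section

namespace LinAlgGroup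

/-! ### Nilpotent algebras normalized by the group, and the unipotent radical. -/

section Unipotent

variable {n : ℕ} {K : Type*} [Field K]

theorem mem_iff_of_isZariskiClosed {A : Set (GL (Fin n) K)} (hA : IsZariskiClosed K A)
    {g : GL (Fin n) K} :
    g ∈ A ↔ ∀ f ∈ vanIdeal A, evalMat (g : Matrix (Fin n) (Fin n) K) f = 0 := by
  refine ⟨fun hg f hf => hf g hg, fun h => ?_⟩
  obtain ⟨I, rfl⟩ := hA
  exact fun f hf => h f fun a ha => ha f hf

theorem isZariskiClosed_setOf (I : Set (MvPolynomial (Fin n × Fin n) K)) :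
    IsZariskiClosed K {g : GL (Fin n) K | ∀ f ∈ I, evalMat (g : Matrix (Fin n) (Fin n) K) f = 0} :=
  ⟨I, rfl⟩

theorem IsZariskiClosed.inter {A B : Set (GL (Fin n) K)} (hA : IsZariskiClosed K A)
    (hB : IsZariskiClosed K B) : IsZariskiClosed K (A ∩ B) := by
  obtain ⟨I, rfl⟩ := hA
  obtain ⟨J, rfl⟩ := hB
  refine ⟨I ∪ J, ?_⟩
  ext g
  exact ⟨fun h f hf => hf.elim (h.1 f) (h.2 f), fun h => ⟨fun f hf => h f (Or.inl hf),
    fun f hf => h f (Or.inr hf)⟩⟩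

theorem evalMat_linPart (φ : Module.Dual K (Matrix (Fin n) (Fin n) K))
    (g : Matrix (Fin n) (Fin n) K) : evalMat g (linPart φ) = φ (g - 1) := by
  conv_rhs => rw [Matrix.matrix_eq_sum_single (g - 1)]
  simp only [linPart, map_sum, map_mul, map_sub, evalMat_C, evalMat_X, Algebra.algebraMap_self,
    RingHom.id_apply]
  refine Finset.sum_congr rfl fun i _ => Finset.sum_congr rfl fun j _ => ?_
  rw [show Matrix.single i j ((g - 1) i j) = (g - 1) i j • Matrix.single i j (1 : K) by
    rw [Matrix.smul_single]; simp, map_smul, smul_eq_mul, mul_comm, Matrix.sub_apply]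

theorem isZariskiClosed_sub_one_mem (𝒜 : Submodule K (Matrix (Fin n) (Fin n) K)) :
    IsZariskiClosed K {g : GL (Fin n) K | (g : Matrix (Fin n) (Fin n) K) - 1 ∈ 𝒜} := by
  refine ⟨linPart '' (𝒜.dualAnnihilator : Set (Module.Dual K (Matrix (Fin n) (Fin n) K))), ?_⟩
  ext g
  have : (g : Matrix (Fin n) (Fin n) K) - 1 ∈ 𝒜 ↔ ∀ φ ∈ 𝒜.dualAnnihilator,
      evalMat (g : Matrix (Fin n) (Fin n) K) (linPart φ) = 0 := by
    conv_lhs => rw [← Subspace.dualAnnihilator_dualCoannihilator_eq (W := 𝒜),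
      Submodule.mem_dualCoannihilator]
    simp only [evalMat_linPart]
  rw [Set.mem_ofPred_eq, this]
  constructor
  · rintro h _ ⟨φ, hφ, rfl⟩; exact h φ hφ
  · intro h φ hφ; exact h _ ⟨φ, hφ, rfl⟩

/-- A polynomial path of matrices. -/
def pathMat (b : ℕ → Polynomial K) (a : Matrix (Fin n) (Fin n) K) (N : ℕ) :
    Matrix (Fin n) (Fin n) (Polynomial K) :=
  ∑ k ∈ Finset.range N, b k • (a ^ k).map Polynomial.C

/-- The value of a path. -/
def pathVal (b : ℕ → Polynomial K) (a : Matrix (Fin n) (Fin n) K) (N : ℕ) (t : K) :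
    Matrix (Fin n) (Fin n) K :=
  ∑ k ∈ Finset.range N, (b k).eval t • a ^ k

theorem pathMat_map_eval (b : ℕ → Polynomial K) (a : Matrix (Fin n) (Fin n) K) (N : ℕ) (t : K) :
    (pathMat b a N).map (Polynomial.aeval t) = pathVal b a N t := by
  ext i j
  simp [pathMat, pathVal, Matrix.sum_apply, Polynomial.eval_finsetSum]

theorem eval_evalMat_pathMat (b : ℕ → Polynomial K) (a : Matrix (Fin n) (Fin n) K) (N : ℕ)
    (t : K) (f : MvPolynomial (Fin n × Fin n) K) :
    (evalMat (pathMat b a N) f).eval t = evalMat (pathVal b a N t) f := by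
  have := evalMat_map (Polynomial.aeval t) (pathMat b a N) f
  rwa [pathMat_map_eval, Polynomial.coe_aeval_eq_eval] at this

/-- A subspace of nilpotent matrices closed under products and under conjugation by a group. -/
structure IsNilSubalgebra (H : Subgroup (GL (Fin n) K))
    (𝒜 : Submodule K (Matrix (Fin n) (Fin n) K)) : Prop where
  mul_mem : ∀ a ∈ 𝒜, ∀ b ∈ 𝒜, a * b ∈ 𝒜
  nilpotent : ∀ a ∈ 𝒜, IsNilpotent a
  conj_mem : ∀ g ∈ H, ∀ a ∈ 𝒜,
    (g : Matrix (Fin n) (Fin n) K) * a * (g⁻¹ : GL (Fin n) K) ∈ 𝒜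

variable {H : Subgroup (GL (Fin n) K)} {𝒜 : Submodule K (Matrix (Fin n) (Fin n) K)}

theorem IsNilSubalgebra.pow_mem (h : IsNilSubalgebra H 𝒜) {a : Matrix (Fin n) (Fin n) K}
    (ha : a ∈ 𝒜) {k : ℕ} (hk : k ≠ 0) : a ^ k ∈ 𝒜 := by
  induction k with
  | zero => exact absurd rfl hk
  | succ k ih =>
    rcases Nat.eq_zero_or_pos k with rfl | hk'
    · simpa using ha
    · rw [pow_succ]; exact h.mul_mem _ (ih hk'.ne') _ ha

theorem IsNilSubalgebra.pathVal_sub_one_mem (h : IsNilSubalgebra H 𝒜)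
    {a : Matrix (Fin n) (Fin n) K} (ha : a ∈ 𝒜) {b : ℕ → Polynomial K} (hb : b 0 = 1) {N : ℕ}
    (t : K) : pathVal b a (N + 1) t - 1 ∈ 𝒜 := by
  rw [pathVal, Finset.sum_range_succ', hb]
  simp only [Polynomial.eval_one, pow_zero, one_smul, add_sub_cancel_right]
  exact sum_mem fun k _ => 𝒜.smul_mem _ (h.pow_mem ha k.succ_ne_zero)

/-- The unipotent group attached to a nilpotent algebra of matrices. -/
def IsNilSubalgebra.group (h : IsNilSubalgebra H 𝒜) : Subgroup (GL (Fin n) K) where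
  carrier := {g | g ∈ H ∧ (g : Matrix (Fin n) (Fin n) K) - 1 ∈ 𝒜}
  one_mem' := ⟨H.one_mem, by simp⟩
  mul_mem' := by
    rintro x y ⟨hx, hx'⟩ ⟨hy, hy'⟩
    refine ⟨H.mul_mem hx hy, ?_⟩
    have := add_mem (add_mem (h.mul_mem _ hx' _ hy') hx') hy'
    convert this using 1
    rw [Units.val_mul]; noncomm_ring
  inv_mem' := by
    rintro x ⟨hx, hx'⟩
    refine ⟨H.inv_mem hx, ?_⟩
    set a := (x : Matrix (Fin n) (Fin n) K) - 1 with ha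
    set y := ((x⁻¹ : GL (Fin n) K) : Matrix (Fin n) (Fin n) K) with hy
    have hyx : y * (1 + a) = 1 := by
      rw [ha, add_sub_cancel, hy, ← Units.val_mul]; simp
    have key : y - 1 = -(y * a) := by
      rw [mul_add, mul_one] at hyx
      rw [← hyx]; noncomm_ring
    obtain ⟨N, hN⟩ := h.nilpotent a hx'
    -- From `y(1 + a) = 1` one gets `y a^k = a^k - y a^(k+1)`. Descending induction starts where
    -- `a^k = 0` and ends at `y a = 1 - y`.
    have hstep : ∀ k, 1 ≤ k → y * a ^ (k + 1) ∈ 𝒜 → y * a ^ k ∈ 𝒜 := by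
      intro k hk h1
      have e : y * a ^ k = a ^ k - y * a ^ (k + 1) := by
        have : (1 : Matrix (Fin n) (Fin n) K) * a ^ k = y * (1 + a) * a ^ k := by rw [hyx]
        rw [one_mul] at this
        nth_rewrite 2 [this]
        rw [pow_succ']; noncomm_ring
      rw [e]
      exact sub_mem (h.pow_mem hx' (by omega)) h1
    have hall : ∀ d k, 1 ≤ k → N ≤ k + d → y * a ^ k ∈ 𝒜 := by
      intro d
      induction d with
      | zero =>
        intro k _ hk
        rw [pow_eq_zero_of_le (by omega) hN, mul_zero]; exact 𝒜.zero_mem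
      | succ d ih =>
        intro k hk1 hk
        exact hstep k hk1 (ih (k + 1) (by omega) (by omega))
    rw [key]
    have := hall N 1 le_rfl (by omega)
    rw [pow_one] at this
    exact neg_mem this

variable [CharZero K]

/-- The binomial polynomials. -/
def binomPoly (K : Type*) [Field K] (k : ℕ) : Polynomial K :=
  Polynomial.C ((k.factorial : K)⁻¹) * descPochhammer K k

theorem binomPoly_eval (k m : ℕ) : (binomPoly K k).eval (m : K) = (m.choose k : K) := by
  rw [binomPoly, Polynomial.eval_mul, Polynomial.eval_C, descPochhammer_eval_eq_descFactorial,
    Nat.descFactorial_eq_factorial_mul_choose, Nat.cast_mul, ← mul_assoc,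
    inv_mul_cancel₀ (by exact_mod_cast k.factorial_ne_zero), one_mul]

theorem pathVal_binomPoly {a : Matrix (Fin n) (Fin n) K} {N : ℕ} (ha : a ^ N = 0) (m : ℕ) :
    pathVal (binomPoly K) a N m = (1 + a) ^ m := by
  rw [add_comm, (Commute.one_right a).add_pow]
  simp only [pathVal, binomPoly_eval, one_pow, mul_one]
  have h1 : ∀ M, N ≤ M → m + 1 ≤ M →
      ∑ k ∈ Finset.range N, (m.choose k : K) • a ^ k =
        ∑ k ∈ Finset.range M, (m.choose k : K) • a ^ k := by
    intro M hM _
    refine Finset.sum_subset (Finset.range_mono hM) fun k _ hk => ?_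
    rw [pow_eq_zero_of_le (by simpa using hk) ha, smul_zero]
  have h2 : ∀ M, N ≤ M → m + 1 ≤ M →
      ∑ k ∈ Finset.range (m + 1), (m.choose k : K) • a ^ k =
        ∑ k ∈ Finset.range M, (m.choose k : K) • a ^ k := by
    intro M _ hM
    refine Finset.sum_subset (Finset.range_mono hM) fun k _ hk => ?_
    rw [Nat.choose_eq_zero_of_lt (by simpa using hk)]; simp
  rw [h1 (max N (m + 1)) (le_max_left _ _) (le_max_right _ _),
    ← h2 (max N (m + 1)) (le_max_left _ _) (le_max_right _ _)]
  refine Finset.sum_congr rfl fun k _ => ?_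
  rw [← nsmul_eq_mul', Nat.cast_smul_eq_nsmul]

omit [CharZero K] in
theorem IsNilSubalgebra.exists_group_eq_path (h : IsNilSubalgebra H 𝒜)
    (hH : IsZariskiClosed K (H : Set (GL (Fin n) K))) {b : ℕ → Polynomial K} (hb : b 0 = 1) {N : ℕ}
    {a : Matrix (Fin n) (Fin n) K} (ha : a ∈ 𝒜)
    (hf : ∀ f ∈ vanIdeal (H : Set (GL (Fin n) K)), evalMat (pathMat b a (N + 1)) f = 0) (t : K) :
    ∃ g ∈ h.group, (g : Matrix (Fin n) (Fin n) K) = pathVal b a (N + 1) t := by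
  have h1 := h.pathVal_sub_one_mem ha hb (N := N) t
  have h2 : IsUnit (pathVal b a (N + 1) t) := by
    have := (h.nilpotent _ h1).isUnit_one_add
    rwa [add_sub_cancel] at this
  obtain ⟨g, hg⟩ := h2
  refine ⟨g, ⟨?_, by rwa [hg]⟩, hg⟩
  refine (mem_iff_of_isZariskiClosed hH).2 fun f hfI => ?_
  rw [hg, ← eval_evalMat_pathMat, hf f hfI, Polynomial.eval_zero]

/-- Each `u = 1 + a` is joined to `1` by the polynomial path `t ↦ ∑ (t choose k) a^k`. At natural
numbers this is `u^m`, so the equations of `H` hold along it at infinitely many points, hence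
everywhere. If `A` and `B` separated `1` from `u`, some `f` vanishing on `B` would be nonzero at `t
= 0` and some `f'` vanishing on `A` nonzero at `t = 1`, while `f f'` is zero along the path. -/
theorem IsNilSubalgebra.isZariskiConnected (h : IsNilSubalgebra H 𝒜)
    (hH : IsZariskiClosed K (H : Set (GL (Fin n) K))) : IsZariskiConnected h.group := by
  have key : ∀ A B : Set (GL (Fin n) K), IsZariskiClosed K A → IsZariskiClosed K B →
      A ∪ B = (h.group : Set (GL (Fin n) K)) → A ∩ B = ∅ → 1 ∈ A → B = ∅ := by
    intro A B hA hB hAB hdis h1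
    by_contra hne
    obtain ⟨u, hu⟩ := Set.nonempty_iff_ne_empty.2 hne
    have huU : u ∈ h.group := by
      rw [← SetLike.mem_coe, ← hAB]; exact Or.inr hu
    set a := (u : Matrix (Fin n) (Fin n) K) - 1 with ha
    obtain ⟨N, hN⟩ := h.nilpotent a huU.2
    have hN' : a ^ (N + 1) = 0 := by rw [pow_succ, hN, zero_mul]
    have hval : ∀ m : ℕ, pathVal (binomPoly K) a (N + 1) m =
        ((u ^ m : GL (Fin n) K) : Matrix (Fin n) (Fin n) K) := by
      intro m
      rw [pathVal_binomPoly hN', ha, add_sub_cancel, Units.val_pow_eq_pow_val]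
    have hpath := h.exists_group_eq_path hH (b := binomPoly K) (by simp [binomPoly]) (N := N)
      huU.2 (fun f hf => by
        refine Polynomial.eq_zero_of_infinite_isRoot _ ?_
        refine (Set.infinite_range_of_injective (Nat.cast_injective (R := K))).mono ?_
        rintro _ ⟨m, rfl⟩
        rw [Set.mem_ofPred_eq, Polynomial.IsRoot, eval_evalMat_pathMat, hval]
        exact hf _ (H.pow_mem huU.1 m))
    have h1B : (1 : GL (Fin n) K) ∉ B := fun hB' =>
      (Set.eq_empty_iff_forall_notMem.1 hdis) 1 ⟨h1, hB'⟩
    have huA : u ∉ A := fun hA' => (Set.eq_empty_iff_forall_notMem.1 hdis) u ⟨hA', hu⟩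
    rw [mem_iff_of_isZariskiClosed hB] at h1B
    rw [mem_iff_of_isZariskiClosed hA] at huA
    push Not at h1B huA
    obtain ⟨f, hf, hf1⟩ := h1B
    obtain ⟨f', hf', hf1'⟩ := huA
    have hp : evalMat (pathMat (binomPoly K) a (N + 1)) f ≠ 0 := by
      intro h0
      have := eval_evalMat_pathMat (binomPoly K) a (N + 1) ((0 : ℕ) : K) f
      rw [h0, hval, pow_zero, Polynomial.eval_zero] at this
      exact hf1 this.symm
    have hp' : evalMat (pathMat (binomPoly K) a (N + 1)) f' ≠ 0 := by
      intro h0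
      have := eval_evalMat_pathMat (binomPoly K) a (N + 1) ((1 : ℕ) : K) f'
      rw [h0, hval, pow_one, Polynomial.eval_zero] at this
      exact hf1' this.symm
    refine mul_ne_zero hp hp' (Polynomial.funext fun t => ?_)
    obtain ⟨g, hg, hgt⟩ := hpath t
    rw [Polynomial.eval_mul, eval_evalMat_pathMat, eval_evalMat_pathMat, ← hgt,
      Polynomial.eval_zero]
    have hgAB : g ∈ A ∪ B := by rw [hAB]; exact hg
    rcases hgAB with hg' | hg'
    · rw [hf' g hg', mul_zero]
    · rw [hf g hg', zero_mul]
  intro A B hA hB hAB hdis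
  have h1 : (1 : GL (Fin n) K) ∈ A ∪ B := by rw [hAB]; exact h.group.one_mem
  rcases h1 with h1 | h1
  · exact Or.inr (key A B hA hB hAB hdis h1)
  · exact Or.inl (key B A hB hA (by rw [Set.union_comm, hAB]) (by rw [Set.inter_comm, hdis]) h1)

theorem IsNilSubalgebra.group_eq_bot (h : IsNilSubalgebra H 𝒜)
    (hH : IsZariskiClosed K (H : Set (GL (Fin n) K))) (hr : HasTrivialUnipotentRadical H) :
    h.group = ⊥ := by
  refine hr h.group (fun g hg => hg.1) ⟨?_⟩ ?_ (h.isZariskiConnected hH)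
    fun u hu => h.nilpotent _ hu.2
  · intro u hu g
    refine ⟨H.mul_mem (H.mul_mem g.2 hu.1) (H.inv_mem g.2), ?_⟩
    have := h.conj_mem _ g.2 _ hu.2
    convert this using 1
    simp only [Subgroup.coe_subtype, Subgroup.coe_mul, Units.val_mul, mul_sub, sub_mul, mul_one,
      Subgroup.coe_inv]
    rw [← Units.val_mul (g : GL (Fin n) K) (g : GL (Fin n) K)⁻¹]; simp
  · exact IsZariskiClosed.inter hH (isZariskiClosed_sub_one_mem 𝒜)

/-- The exponential coefficients. -/
def expPoly (K : Type*) [Field K] (k : ℕ) : Polynomial K :=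
  Polynomial.C ((k.factorial : K)⁻¹) * Polynomial.X ^ k

theorem derivative_expPoly (k : ℕ) : (expPoly K (k + 1)).derivative = expPoly K k := by
  rw [expPoly, expPoly, Polynomial.derivative_C_mul, Polynomial.derivative_X_pow, ← mul_assoc,
    ← map_mul, Nat.factorial_succ, Nat.add_sub_cancel]
  congr 2
  have : ((k + 1 : ℕ) : K) ≠ 0 := by exact_mod_cast k.succ_ne_zero
  push_cast at this ⊢
  field_simp

/-- Along `exp(tx)` the derivative of `f` is `lieDer x f`, which again lies in the ideal of `H`; so
all derivatives vanish at `t = 0`, and in characteristic zero the polynomial is zero. The sum runs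
up to exponent `N` although `x^N = 0`: multiplication by `x` kills the top term, so the truncated
exponential satisfies its differential equation exactly. -/
theorem evalMat_pathMat_expPoly {x : Matrix (Fin n) (Fin n) K}
    (hx : x ∈ lieAlg (H : Set (GL (Fin n) K))) {N : ℕ} (hN : x ^ N = 0)
    {f : MvPolynomial (Fin n × Fin n) K} (hf : f ∈ vanIdeal (H : Set (GL (Fin n) K))) :
    evalMat (pathMat (expPoly K) x (N + 1)) f = 0 := by
  have hder : ∀ i j, (pathMat (expPoly K) x (N + 1) i j).derivative =
      (pathMat (expPoly K) x (N + 1) * x.map (algebraMap K (Polynomial K))) i j := by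
    intro i j
    have e1 : pathMat (expPoly K) x (N + 1) * x.map (algebraMap K (Polynomial K)) =
        ∑ k ∈ Finset.range N, expPoly K k • (x ^ (k + 1)).map Polynomial.C := by
      rw [pathMat, Finset.sum_mul, Finset.sum_range_succ]
      have : ∀ k, expPoly K k • (x ^ k).map Polynomial.C * x.map (algebraMap K (Polynomial K)) =
          expPoly K k • (x ^ (k + 1)).map Polynomial.C := by
        intro k
        rw [pow_succ, Matrix.map_mul, Matrix.smul_mul]; rfl
      simp only [this]
      rw [pow_succ x N, hN, zero_mul]
      simp
    rw [e1, pathMat, Matrix.sum_apply, Matrix.sum_apply, Polynomial.derivative_sum,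
      Finset.sum_range_succ']
    have e0 : (expPoly K 0).derivative = 0 := by simp [expPoly]
    simp only [Matrix.smul_apply, Matrix.map_apply, smul_eq_mul, Polynomial.derivative_mul,
      Polynomial.derivative_C, mul_zero, add_zero, derivative_expPoly, e0, zero_mul]
  have hder' : ∀ f, (evalMat (pathMat (expPoly K) x (N + 1)) f).derivative =
      evalMat (pathMat (expPoly K) x (N + 1)) (lieDer x f) := fun f =>
    derivation_evalMat (AlgHom.id K _) Polynomial.derivative' (pathMat (expPoly K) x (N + 1)) x
      hder f
  have hiter : ∀ k f, f ∈ vanIdeal (H : Set (GL (Fin n) K)) →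
      (Polynomial.derivative^[k] (evalMat (pathMat (expPoly K) x (N + 1)) f)).eval 0 = 0 := by
    intro k
    induction k with
    | zero =>
      intro f hf
      have h0 : pathVal (expPoly K) x (N + 1) 0 = 1 := by
        rw [pathVal, Finset.sum_range_succ']; simp [expPoly]
      rw [Function.iterate_zero, id, eval_evalMat_pathMat, h0]
      simpa using hf 1 H.one_mem
    | succ k ih =>
      intro f hf
      rw [Function.iterate_succ_apply, hder']
      exact ih _ (lieDer_mem_vanIdeal hx hf)
  ext k
  have := hiter k f hf
  rw [← Polynomial.coeff_zero_eq_eval_zero, Polynomial.coeff_iterate_derivative, zero_add,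
    Nat.descFactorial_self, nsmul_eq_mul] at this
  simpa [Nat.factorial_ne_zero] using this

/-- The path `exp(tx)` stays in the unipotent group attached to `𝒜`, which is trivial by
reductivity. So it is constantly `1`, and its coefficient at `t` is `x`. -/
theorem IsNilSubalgebra.eq_zero_of_mem_lieAlg (h : IsNilSubalgebra H 𝒜)
    (hH : IsZariskiClosed K (H : Set (GL (Fin n) K))) (hr : HasTrivialUnipotentRadical H)
    {x : Matrix (Fin n) (Fin n) K} (hx : x ∈ lieAlg (H : Set (GL (Fin n) K))) (hx' : x ∈ 𝒜) :
    x = 0 := by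
  obtain ⟨N, hN⟩ := h.nilpotent x hx'
  have hN2 : x ^ (N + 1) = 0 := by rw [pow_succ, hN, zero_mul]
  have hval : ∀ t, pathVal (expPoly K) x (N + 1 + 1) t = 1 := by
    intro t
    obtain ⟨g, hg, hgt⟩ := h.exists_group_eq_path hH (b := expPoly K) (by simp [expPoly])
      (N := N + 1) hx' (fun f hf => evalMat_pathMat_expPoly hx hN2 hf) t
    rw [h.group_eq_bot hH hr, Subgroup.mem_bot] at hg
    rw [← hgt, hg, Units.val_one]
  have hconst : ∀ i j, pathMat (expPoly K) x (N + 1 + 1) i j =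
      Polynomial.C ((1 : Matrix (Fin n) (Fin n) K) i j) := by
    intro i j
    refine Polynomial.funext fun t => ?_
    have := congrFun (congrFun (pathMat_map_eval (expPoly K) x (N + 1 + 1) t) i) j
    rw [hval] at this
    simpa [Polynomial.coe_aeval_eq_eval] using this
  ext i j
  have h1 := congrArg (fun p : Polynomial K => p.coeff 1) (hconst i j)
  simp only [pathMat, Matrix.sum_apply, Matrix.smul_apply, Matrix.map_apply, smul_eq_mul, expPoly,
    Polynomial.finsetSum_coeff, Polynomial.coeff_C] at h1
  rw [Finset.sum_eq_single 1] at h1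
  · simpa using h1
  · intro k _ hk
    rw [mul_assoc, Polynomial.coeff_C_mul, Polynomial.coeff_mul_C, Polynomial.coeff_X_pow]
    simp [hk.symm]
  · simp

end Unipotent

end LinAlgGroup
end

noncomputable section

namespace LinAlgGroup

/-! ### Jordan decomposition by spectral idempotents. -/

section Spectral

open Polynomial in
theorem aeval_eq_of_eval_eq {K A : Type*} [Field K] [Ring A] [Algebra K A] {s : A} {S : Finset K}
    (hs : aeval s (∏ c ∈ S, (X - C c)) = 0) {p q : K[X]}
    (h : ∀ c ∈ S, p.eval c = q.eval c) : aeval s p = aeval s q := by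
  have : (∏ c ∈ S, (X - C c)) ∣ p - q := by
    refine Finset.prod_dvd_of_coprime (fun a _ b _ hab =>
      pairwise_coprime_X_sub_C Function.injective_id hab) fun c hc => ?_
    rw [dvd_iff_isRoot, IsRoot, eval_sub, h c hc, sub_self]
  obtain ⟨r, hr⟩ := this
  rw [← sub_eq_zero, ← map_sub, hr, map_mul, hs, zero_mul]

-- Since `s` is a root of a product of distinct linear factors, polynomials in `s` depend only on
-- their values on `S`. The Lagrange basis polynomials, evaluated at `s`, are therefore the spectral
-- projections.
open Polynomial in
theorem exists_spectral_idempotents {K A : Type*} [Field K] [Ring A] [Algebra K A] {s : A}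
    {S : Finset K} (hs : aeval s (∏ c ∈ S, (X - C c)) = 0) :
    ∃ e : S → A, CompleteOrthogonalIdempotents e ∧ s = ∑ i : S, (i : K) • e i ∧
      ∀ i, e i ∈ Algebra.adjoin K {s} := by
  classical
  have hb : ∀ i ∈ S, ∀ c ∈ S, (Lagrange.basis S id i).eval c = if i = c then 1 else 0 := by
    intro i hi c hc
    split_ifs with h
    · rw [← h]; exact Lagrange.eval_basis_self (v := id) Function.injective_id.injOn hi
    · exact Lagrange.eval_basis_of_ne (v := id) h hc
  refine ⟨fun i => aeval s (Lagrange.basis S id i), ⟨⟨fun i => ?_, fun i j hij => ?_⟩, ?_⟩, ?_, ?_⟩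
  · rw [IsIdempotentElem, ← map_mul]
    refine aeval_eq_of_eval_eq hs fun c hc => ?_
    rw [eval_mul, hb i i.2 c hc]; split_ifs <;> simp
  · change aeval s _ * aeval s _ = 0
    rw [← map_mul, ← map_zero (aeval (R := K) s)]
    refine aeval_eq_of_eval_eq hs fun c hc => ?_
    rw [eval_mul, hb i i.2 c hc, hb j j.2 c hc]
    split_ifs with h1 h2
    · exact absurd (Subtype.ext (h1.trans h2.symm)) hij
    all_goals simp
  · change ∑ i : S, aeval s _ = 1
    rw [← map_sum, ← map_one (aeval (R := K) s)]
    refine aeval_eq_of_eval_eq hs fun c hc => ?_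
    rw [Finset.sum_coe_sort S (fun i => Lagrange.basis S id i), eval_finsetSum,
      Finset.sum_eq_single c]
    · rw [hb c hc c hc]; simp
    · intro b hb' hbc; rw [hb b hb' c hc, if_neg hbc]
    · exact fun h => absurd hc h
  · have h1 : (∑ i : S, (i : K) • aeval s (Lagrange.basis S id (i : K))) =
        aeval s (∑ i ∈ S, C i * Lagrange.basis S id i) := by
      rw [← Finset.sum_coe_sort S (fun i => C i * Lagrange.basis S id i), map_sum]
      refine Finset.sum_congr rfl fun i _ => ?_
      rw [map_mul, aeval_C, Algebra.smul_def]
    rw [h1]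
    conv_lhs => rw [← aeval_X (R := K) s]
    refine aeval_eq_of_eval_eq hs fun c hc => ?_
    rw [eval_finsetSum, Finset.sum_eq_single c]
    · rw [eval_mul, hb c hc c hc]; simp
    · intro b hb' hbc; rw [eval_mul, hb b hb' c hc, if_neg hbc, mul_zero]
    · exact fun h => absurd hc h
  · intro i
    exact aeval_mem_adjoin_singleton _ _

variable {n : ℕ} {K : Type*} [Field K]

theorem commute_of_mem_adjoin {A : Type*} [Ring A] [Algebra K A] {x y z : A}
    (hy : y ∈ Algebra.adjoin K {x}) (h : Commute x z) : Commute y z := by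
  induction hy using Algebra.adjoin_induction with
  | mem a ha => rw [Set.mem_singleton_iff.1 ha]; exact h
  | algebraMap r => exact Algebra.commute_algebraMap_left r z
  | add a b _ _ ha hb => exact ha.add_left hb
  | mul a b _ _ ha hb => exact ha.mul_left hb

open Polynomial in
/-- The spectral form of the Jordan decomposition. -/
theorem exists_jordan [IsAlgClosed K] [CharZero K] (x : Matrix (Fin n) (Fin n) K) :
    ∃ (S : Finset K) (e : S → Matrix (Fin n) (Fin n) K), CompleteOrthogonalIdempotents e ∧
      IsNilpotent (x - ∑ i : S, (i : K) • e i) ∧ ∀ i, e i ∈ Algebra.adjoin K {x} := by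
  classical
  let T := Matrix.toLinAlgEquiv' (R := K) (n := Fin n)
  obtain ⟨N, hN, s, hs, hnil, hss, hx⟩ := Module.End.exists_isNilpotent_isSemisimple (f := T x)
  have hsq := hss.minpoly_squarefree
  have hne : minpoly K s ≠ 0 := hsq.ne_zero
  have hint : IsIntegral K s := Algebra.IsIntegral.isIntegral s
  have hsep : (minpoly K s).Separable := PerfectField.separable_iff_squarefree.2 hsq
  have hprod : minpoly K s = ∏ c ∈ (minpoly K s).roots.toFinset, (X - C c) := by
    conv_lhs => rw [(IsAlgClosed.splits (minpoly K s)).eq_prod_roots_of_monic (minpoly.monic hint)]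
    rw [Finset.prod, Multiset.toFinset_val, (nodup_roots hsep).dedup]
  have h0 : aeval (T.symm s) (∏ c ∈ (minpoly K s).roots.toFinset, (X - C c)) = 0 := by
    rw [← hprod, ← AlgEquiv.coe_toAlgHom, aeval_algHom_apply, minpoly.aeval, map_zero]
  obtain ⟨e, he, hse, hmem⟩ := exists_spectral_idempotents h0
  refine ⟨_, e, he, ?_, fun i => ?_⟩
  · rw [← hse]
    have : x - T.symm s = T.symm N := by
      rw [← T.symm_apply_apply x, hx, map_add, add_sub_cancel_right]
    rw [this]; exact hnil.map T.symm
  · have h1 : T.symm s ∈ Algebra.adjoin K {x} := by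
      have : (Algebra.adjoin K {T x}).map (T.symm : _ →ₐ[K] _) = Algebra.adjoin K {x} := by
        rw [AlgHom.map_adjoin_singleton]; simp
      rw [← this]
      exact ⟨s, hs, rfl⟩
    exact Algebra.adjoin_le (Set.singleton_subset_iff.2 h1) (hmem i)

/-- The number `d` is the rank. Everything is read off from the splitting into range and kernel. -/
theorem exists_rank_of_idempotent {e : Matrix (Fin n) (Fin n) K} (he : IsIdempotentElem e) :
    ∃ d : ℕ, e.trace = d ∧ (d = 0 → e = 0) ∧ d ≤ n ∧ ∀ c : K, (c • e + (1 - e)).det = c ^ d := by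
  let T := Matrix.toLinAlgEquiv' (R := K) (n := Fin n)
  have hE : IsIdempotentElem (T e) := he.map T
  have hp := LinearMap.IsIdempotentElem.isProj_range (T e) hE
  refine ⟨Module.finrank K (LinearMap.range (T e)), ?_, ?_, ?_, ?_⟩
  · have := hp.trace
    rwa [show T e = Matrix.toLin' e from rfl, Matrix.trace_toLin'_eq] at this
  · intro h
    have h1 : LinearMap.range (T e) = ⊥ := Submodule.finrank_eq_zero.1 h
    rw [LinearMap.range_eq_bot] at h1
    exact (map_eq_zero_iff T T.injective).1 h1
  · have := Submodule.finrank_le (LinearMap.range (T e))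
    simpa using this
  · intro c
    let E := (LinearMap.range (T e)).prodEquivOfIsCompl (LinearMap.ker (T e)) hp.isCompl
    have h1 : T (c • e + (1 - e)) = E.conj ((c • LinearMap.id).prodMap LinearMap.id) := by
      have h2 : T e = E.conj (LinearMap.id.prodMap 0) := hp.eq_conj_prodMap
      rw [map_add, map_sub, map_smul, map_one]
      conv_lhs => rw [h2]
      have h3 : (1 : Module.End K (Fin n → K)) = E.conj LinearMap.id := by
        rw [LinearEquiv.conj_id]; rfl
      rw [h3, ← map_smul, ← map_sub, ← map_add]
      congr 1
      refine LinearMap.ext fun v => Prod.ext ?_ ?_ <;> simp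
    have h4 : (c • e + (1 - e)).det = LinearMap.det (T (c • e + (1 - e))) :=
      (LinearMap.det_toLin' _).symm
    rw [h4, h1, LinearEquiv.conj_apply, LinearMap.comp_assoc]
    erw [LinearMap.det_conj]
    rw [LinearMap.det_prodMap]
    simp

end Spectral

/-! ### Chevalley's replicas. -/

section Replica

variable {n : ℕ} {K : Type*} [Field K]

/-- In the terms `D^a p · D^b q` of the Leibniz formula one has `a + b = m`, so `i + j ≤ m + 1`
forces `a ≥ i` or `b ≥ j`. -/
theorem Derivation.iterate_mul_eq_zero {R A : Type*} [CommRing R] [CommRing A] [Algebra R A]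
    (D : Derivation R A A) (m : ℕ) : ∀ (i j : ℕ) (p q : A), i + j ≤ m + 1 → D^[i] p = 0 →
      D^[j] q = 0 → D^[m] (p * q) = 0 := by
  have hzero : ∀ k, D^[k] 0 = 0 := fun k => Function.iterate_fixed (map_zero D) k
  have hadd : ∀ k (a b : A), D^[k] (a + b) = D^[k] a + D^[k] b := fun k =>
    iterate_map_add D k
  induction m with
  | zero =>
    intro i j p q hij hp hq
    rcases Nat.eq_zero_or_pos i with rfl | hi
    · rw [Function.iterate_zero, id] at hp; simp [hp]
    · obtain rfl : j = 0 := by omega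
      rw [Function.iterate_zero, id] at hq; simp [hq]
  | succ m ih =>
    intro i j p q hij hp hq
    rcases i with _ | i
    · rw [Function.iterate_zero, id] at hp; rw [hp, zero_mul, hzero]
    rcases j with _ | j
    · rw [Function.iterate_zero, id] at hq; rw [hq, mul_zero, hzero]
    rw [Function.iterate_succ_apply, Derivation.leibniz, hadd, smul_eq_mul, smul_eq_mul,
      ih (i + 1) j p (D q) (by omega) hp hq, mul_comm q,
      ih i (j + 1) (D p) q (by omega) hp hq, add_zero]

theorem lieDer_entry (x y : Matrix (Fin n) (Fin n) K) (i j : Fin n) :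
    lieDer x ((genMat n K * constMat y) i j) = (genMat n K * constMat (x * y)) i j := by
  have : genMat n K * constMat (x * y) = genMat n K * constMat x * constMat y := by
    rw [constMat, Matrix.map_mul, Matrix.mul_assoc]; rfl
  rw [this, Matrix.mul_apply, map_sum, Matrix.mul_apply]
  refine Finset.sum_congr rfl fun k _ => ?_
  have h0 : lieDer x (constMat y k j) = 0 := by simp [constMat, lieDer]
  rw [Derivation.leibniz, h0, show genMat n K i k = MvPolynomial.X (i, k) from rfl, lieDer_X]
  simp [mul_comm]

theorem genMat_mul_constMat_smul (c : K) (y : Matrix (Fin n) (Fin n) K) (i j : Fin n) :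
    (genMat n K * constMat (c • y)) i j = c • (genMat n K * constMat y) i j := by
  simp only [constMat, Matrix.mul_apply, Finset.smul_sum, Matrix.map_apply, Matrix.smul_apply,
    smul_eq_mul, map_mul, MvPolynomial.smul_eq_C_mul]
  exact Finset.sum_congr rfl fun k _ => by ring

variable {S : Finset K} {e : S → Matrix (Fin n) (Fin n) K}

/-- The weight spaces of polynomials. -/
def weightSpace (s s' N : Matrix (Fin n) (Fin n) K) (φ : K →+ K) (c : K) :
    Submodule K (MvPolynomial (Fin n × Fin n) K) where
  carrier := {f | lieDer s f = c • f ∧ lieDer s' f = φ c • f ∧ ∃ k, (lieDer N)^[k] f = 0}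
  zero_mem' := by refine ⟨by simp, by simp, 0, rfl⟩
  add_mem' := by
    rintro f g ⟨h1, h2, k, hk⟩ ⟨h1', h2', k', hk'⟩
    refine ⟨by rw [map_add, h1, h1', smul_add], by rw [map_add, h2, h2', smul_add], k + k', ?_⟩
    rw [iterate_map_add, Function.iterate_add_apply _ k k' g, hk', add_comm k,
      Function.iterate_add_apply, hk, Function.iterate_fixed (map_zero _),
      Function.iterate_fixed (map_zero _), add_zero]
  smul_mem' := by
    rintro a f ⟨h1, h2, k, hk⟩
    refine ⟨by rw [Derivation.map_smul, h1, smul_comm],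
      by rw [Derivation.map_smul, h2, smul_comm], k, ?_⟩
    have : ∀ k, (lieDer N)^[k] (a • f) = a • (lieDer N)^[k] f := by
      intro k
      induction k with
      | zero => rfl
      | succ k ih => rw [Function.iterate_succ_apply', ih, Derivation.map_smul, Function.iterate_succ_apply']
    rw [this, hk, smul_zero]

theorem mul_mem_weightSpace {s s' N : Matrix (Fin n) (Fin n) K} {φ : K →+ K} {c d : K}
    {f g : MvPolynomial (Fin n × Fin n) K} (hf : f ∈ weightSpace s s' N φ c)
    (hg : g ∈ weightSpace s s' N φ d) : f * g ∈ weightSpace s s' N φ (c + d) := by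
  obtain ⟨h1, h2, k, hk⟩ := hf
  obtain ⟨h1', h2', k', hk'⟩ := hg
  refine ⟨?_, ?_, k + k', Derivation.iterate_mul_eq_zero _ _ k k' f g (by omega) hk hk'⟩
  · rw [Derivation.leibniz, h1, h1', smul_eq_mul, smul_eq_mul, mul_smul_comm, mul_smul_comm,
      mul_comm g f, ← add_smul, add_comm d]
  · rw [Derivation.leibniz, h2, h2', smul_eq_mul, smul_eq_mul, mul_smul_comm, mul_smul_comm,
      mul_comm g f, ← add_smul, map_add, add_comm (φ d)]

/-- The entries of `X e i`, with `X` the generic matrix, are weight vectors and generate the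
polynomial ring. Weights add under multiplication, so additivity of `φ` is all that is needed. -/
theorem iSup_weightSpace (he : CompleteOrthogonalIdempotents e) (φ : K →+ K)
    {N : Matrix (Fin n) (Fin n) K} (hN : IsNilpotent N) :
    ⨆ c, weightSpace (∑ i : S, (i : K) • e i) (∑ i : S, φ i • e i) N φ c = ⊤ := by
  have hmul : ∀ (a : S → K) (i : S), (∑ j, a j • e j) * e i = a i • e i := by
    intro a i
    rw [Finset.sum_mul, Finset.sum_eq_single i]
    · rw [smul_mul_assoc, (he.idem i).eq]
    · intro j _ hj; rw [smul_mul_assoc, he.ortho hj, smul_zero]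
    · simp
  have hent : ∀ (i : S) (k l : Fin n), (genMat n K * constMat (e i)) k l ∈
      weightSpace (∑ i : S, (i : K) • e i) (∑ i : S, φ i • e i) N φ i := by
    intro i k l
    refine ⟨?_, ?_, ?_⟩
    · rw [lieDer_entry, hmul (fun j => (j : K)), genMat_mul_constMat_smul]
    · rw [lieDer_entry, hmul (fun j => φ j), genMat_mul_constMat_smul]
    · obtain ⟨m, hm⟩ := hN
      have : ∀ m, (lieDer N)^[m] ((genMat n K * constMat (e i)) k l) =
          (genMat n K * constMat (N ^ m * e i)) k l := by
        intro m
        induction m with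
        | zero => simp
        | succ m ih => rw [Function.iterate_succ_apply', ih, lieDer_entry, pow_succ', mul_assoc]
      exact ⟨m, by rw [this, hm, zero_mul]; simp [constMat]⟩
  rw [eq_top_iff]
  rintro f -
  induction f using MvPolynomial.induction_on with
  | C a =>
    refine Submodule.mem_iSup_of_mem 0 ⟨?_, ?_, 1, ?_⟩ <;> simp [lieDer]
  | add p q hp hq => exact add_mem hp hq
  | mul_X p ij hp =>
    have hX : (MvPolynomial.X ij : MvPolynomial (Fin n × Fin n) K) =
        ∑ i, (genMat n K * constMat (e i)) ij.1 ij.2 := by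
      have h1 : ∑ i, genMat n K * constMat (e i) = genMat n K := by
        rw [← Finset.mul_sum]
        have : ∑ i, constMat (e i) = constMat (∑ i, e i) :=
          (map_sum (MvPolynomial.C (R := K) (σ := Fin n × Fin n)).mapMatrix e Finset.univ).symm
        rw [this, he.complete, constMat, Matrix.map_one _ (map_zero _) (map_one _), mul_one]
      have h2 := congrFun (congrFun h1 ij.1) ij.2
      rw [Matrix.sum_apply] at h2
      rw [h2]; rfl
    rw [hX, Finset.mul_sum]
    refine sum_mem fun i _ => ?_
    refine Submodule.iSup_induction _ (motive := fun p => p * _ ∈ _) hp (fun c p hp => ?_) ?_ ?_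
    · exact Submodule.mem_iSup_of_mem _ (mul_mem_weightSpace hp (hent i _ _))
    · simp
    · intro p q hp hq; rw [add_mul]; exact add_mem hp hq

/-- An invariant subspace contains the generalized eigencomponents of its elements. -/
theorem mem_of_sum_mem {V : Type*} [AddCommGroup V] [Module K V] (g : Module.End K V)
    (I : Submodule K V) (hI : ∀ v ∈ I, g v ∈ I) (v : K → V) (T : Finset K)
    (hv : ∀ c, v c ∈ g.maxGenEigenspace c) (hsum : ∑ c ∈ T, v c ∈ I) : ∀ c ∈ T, v c ∈ I := by
  let g' : Module.End K (V ⧸ I) := I.mapQ I g hI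
  have hind := Module.End.independent_maxGenEigenspace g'
  rw [iSupIndep_iff_finsetSum_eq_zero_imp_eq_zero] at hind
  have hcomp : ∀ (c : K) (k : ℕ) (w : V), ((g' - algebraMap K _ c) ^ k) (I.mkQ w) =
      I.mkQ (((g - algebraMap K _ c) ^ k) w) := by
    intro c k
    induction k with
    | zero => intro w; rfl
    | succ k ih =>
      intro w
      rw [pow_succ, pow_succ, Module.End.mul_apply, Module.End.mul_apply, ← ih]
      congr 1
  have hmem : ∀ c, I.mkQ (v c) ∈ g'.maxGenEigenspace c := by
    intro c
    obtain ⟨k, hk⟩ := (Module.End.mem_maxGenEigenspace _ _ _).1 (hv c)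
    refine (Module.End.mem_maxGenEigenspace _ _ _).2 ⟨k, ?_⟩
    have := hcomp c k (v c)
    rw [Algebra.algebraMap_eq_smul_one, Algebra.algebraMap_eq_smul_one, hk, map_zero] at this
    exact this
  intro c hc
  have := hind T (fun c => I.mkQ (v c)) (fun c _ => hmem c)
    (by rw [← map_sum, Submodule.mkQ_apply, Submodule.Quotient.mk_eq_zero]; exact hsum) c hc
  rwa [Submodule.mkQ_apply, Submodule.Quotient.mk_eq_zero] at this

theorem lieDer_iterate_comm {a b : Matrix (Fin n) (Fin n) K} (h : Commute a b)
    (f : MvPolynomial (Fin n × Fin n) K) : lieDer a (lieDer b f) = lieDer b (lieDer a f) := by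
  have h1 : ⁅a, b⁆ = 0 := by rw [Ring.lie_def, h.eq, sub_self]
  have h2 := lieDer_lie a b
  rw [h1, lieDer_zero] at h2
  have h3 := congrArg (fun D : Derivation K _ _ => D f) h2
  simp only [Derivation.commutator_apply, Derivation.zero_apply] at h3
  exact (sub_eq_zero.1 h3.symm)

/-- The Lie algebra of a group contains the replicas of its elements. -/
theorem replica_mem_lieAlg {H : Subgroup (GL (Fin n) K)} {x : Matrix (Fin n) (Fin n) K}
    (hx : x ∈ lieAlg (H : Set (GL (Fin n) K))) (he : CompleteOrthogonalIdempotents e)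
    (hnil : IsNilpotent (x - ∑ i : S, (i : K) • e i)) (hadj : ∀ i, e i ∈ Algebra.adjoin K {x})
    (φ : K →+ K) : ∑ i : S, φ i • e i ∈ lieAlg (H : Set (GL (Fin n) K)) := by
  refine mem_lieAlg.2 fun f hf => ?_
  set s := ∑ i : S, (i : K) • e i with hs
  set s' := ∑ i : S, φ i • e i with hs'
  set N := x - s with hN
  have hxe : ∀ a : S → K, Commute x (∑ i, a i • e i) := fun a =>
    Commute.sum_right _ _ _ fun i _ =>
      ((commute_of_mem_adjoin (hadj i) (Commute.refl x)).symm.smul_right _)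
  have hee : ∀ a b : S → K, Commute (∑ i, a i • e i) (∑ i, b i • e i) := fun a b =>
    Commute.sum_left _ _ _ fun i _ => Commute.sum_right _ _ _ fun j _ =>
      ((commute_of_mem_adjoin (hadj i)
        (commute_of_mem_adjoin (hadj j) (Commute.refl x)).symm).smul_left _).smul_right _
  have hsN : Commute s N := (hxe fun i => (i : K)).symm.sub_right (Commute.refl s)
  have hsN' : Commute s' N := (hxe fun i => φ i).symm.sub_right (hee (fun i => φ i) fun i => (i : K))
  have hf' : f ∈ ⨆ c, weightSpace s s' N φ c := by rw [iSup_weightSpace he φ hnil]; trivial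
  obtain ⟨v, hv, hvf⟩ := (Submodule.mem_iSup_iff_exists_finsupp _ _).1 hf'
  have hD : lieDer x = lieDer s + lieDer N := by rw [← lieDer_add, hN, add_sub_cancel]
  -- The weight component `v c` is a generalized eigenvector of `lieDer x`, which is `lieDer s` plus
  -- the commuting operator `lieDer N`, nilpotent on `v c`.
  have hgen : ∀ c, v c ∈ Module.End.maxGenEigenspace
      ((lieDer x : Derivation K _ _) : Module.End K (MvPolynomial (Fin n × Fin n) K)) c := by
    intro c
    obtain ⟨h1, h2, k, hk⟩ := hv c
    refine (Module.End.mem_maxGenEigenspace _ _ _).2 ⟨k, ?_⟩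
    have : ∀ k, ((((lieDer x : Derivation K _ _) :
        Module.End K (MvPolynomial (Fin n × Fin n) K)) - c • 1) ^ k) (v c) =
        (lieDer N)^[k] (v c) := by
      intro k
      have hcomm : ∀ k, lieDer s ((lieDer N)^[k] (v c)) = c • (lieDer N)^[k] (v c) := by
        intro k
        induction k with
        | zero => exact h1
        | succ k ih =>
          rw [Function.iterate_succ_apply', lieDer_iterate_comm hsN, ih, Derivation.map_smul]
      induction k with
      | zero => rfl
      | succ k ih =>
        rw [pow_succ', Function.iterate_succ_apply']
        rw [Module.End.mul_apply, ih]
        have hact : ∀ w, (((lieDer x : Derivation K _ _) :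
            Module.End K (MvPolynomial (Fin n × Fin n) K)) - c • 1) w = lieDer x w - c • w :=
          fun _ => rfl
        rw [hact, hD, Derivation.add_apply, hcomm, add_sub_cancel_left]
    have h3 := this k
    rw [hk] at h3
    exact h3
  -- The ideal of `H` is stable under `lieDer x`, so it contains every weight component of `f`. On
  -- each of these `lieDer s'` is multiplication by `φ c`, so `lieDer s' f` stays in the ideal.
  have hmem := mem_of_sum_mem
    ((lieDer x : Derivation K _ _) : Module.End K (MvPolynomial (Fin n × Fin n) K))
    ((vanIdeal (H : Set (GL (Fin n) K))).restrictScalars K)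
    (fun f hf => lieDer_mem_vanIdeal hx hf) v v.support hgen
    (by change ∑ c ∈ v.support, v c ∈ vanIdeal (H : Set (GL (Fin n) K)); rw [show
      ∑ c ∈ v.support, v c = f from hvf]; exact hf)
  have h1 : lieDer s' f = ∑ c ∈ v.support, φ c • v c := by
    rw [← hvf, Finsupp.sum, map_sum]
    exact Finset.sum_congr rfl fun c _ => (hv c).2.1
  rw [h1, map_sum]
  refine Finset.sum_eq_zero fun c hc => ?_
  have h2 : v c ∈ vanIdeal (H : Set (GL (Fin n) K)) := hmem c hc
  rw [map_smul]
  have := h2 1 H.one_mem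
  rw [Units.val_one] at this
  rw [this, smul_zero]

end Replica

end LinAlgGroup
end

noncomputable section

namespace LinAlgGroup

/-! ### Nondegeneracy of the trace form. -/

section TraceForm

variable {n : ℕ} {K : Type*} [Field K] [CharZero K] {H : Subgroup (GL (Fin n) K)}

omit [CharZero K] in
theorem trace_mul_eq_zero_of_isNilpotent {a b : Matrix (Fin n) (Fin n) K} (ha : IsNilpotent a)
    (h : Commute a b) : (a * b).trace = 0 :=
  (Matrix.isNilpotent_trace_of_isNilpotent (h.isNilpotent_mul_right ha)).eq_zero

/-- Cartan's criterion. Let `c j` be the eigenvalues of `x` with multiplicities `d j`, and `φ : K →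
ℚ` a `ℚ`-linear form. Pairing `x` with its replica under `φ` gives `∑ d j φ(c j) c j = 0`, and a
second application of `φ` gives `∑ d j φ(c j)² = 0` over `ℚ`. So `φ(c j) = 0` for all `φ`, and all
eigenvalues vanish. -/
theorem isNilpotent_of_trace_eq_zero [IsAlgClosed K] {x : Matrix (Fin n) (Fin n) K}
    (hx : x ∈ lieAlg (H : Set (GL (Fin n) K)))
    (h : ∀ y ∈ lieAlg (H : Set (GL (Fin n) K)), (x * y).trace = 0) : IsNilpotent x := by
  obtain ⟨S, e, he, hnil, hadj⟩ := exists_jordan x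
  have hex : ∀ i, Commute x (e i) := fun i => (commute_of_mem_adjoin (hadj i) (Commute.refl x)).symm
  have hmul : ∀ i, (∑ j : S, (j : K) • e j) * e i = (i : K) • e i := by
    intro i
    rw [Finset.sum_mul, Finset.sum_eq_single i]
    · rw [smul_mul_assoc, (he.idem i).eq]
    · intro j _ hj; rw [smul_mul_assoc, he.ortho hj, smul_zero]
    · simp
  have htr : ∀ i : S, (x * e i).trace = (i : K) * (e i).trace := by
    intro i
    have h1 : x * e i = (x - ∑ j : S, (j : K) • e j) * e i + (i : K) • e i := by
      rw [sub_mul, hmul, sub_add_cancel]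
    have h2 : Commute (∑ j : S, (j : K) • e j) (e i) := by
      rw [Commute, SemiconjBy, hmul, Finset.mul_sum, Finset.sum_eq_single i]
      · rw [mul_smul_comm, (he.idem i).eq]
      · intro j _ hj; rw [mul_smul_comm, he.ortho hj.symm, smul_zero]
      · simp
    rw [h1, Matrix.trace_add, trace_mul_eq_zero_of_isNilpotent hnil ((hex i).sub_left h2), zero_add,
      Matrix.trace_smul, smul_eq_mul]
  have hzero : ∀ i : S, (i : K) • e i = 0 := by
    intro i
    by_cases hei : e i = 0
    · rw [hei, smul_zero]
    have hφ : ∀ φ : Module.Dual ℚ K, φ i = 0 := by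
      intro φ
      have h1 := h _ (replica_mem_lieAlg hx he hnil hadj
        ((algebraMap ℚ K : ℚ →+* K).toAddMonoidHom.comp φ.toAddMonoidHom))
      choose d hd using fun j => exists_rank_of_idempotent (he.idem j)
      rw [Finset.mul_sum, Matrix.trace_sum] at h1
      have h2 : ∑ j : S, (φ j) • ((d j : ℚ) • (j : K)) = 0 := by
        rw [← h1]
        refine Finset.sum_congr rfl fun j _ => ?_
        rw [mul_smul_comm, Matrix.trace_smul, htr, (hd j).1]
        simp only [Algebra.smul_def]
        change _ = algebraMap ℚ K (φ j) * _
        rw [map_natCast]; ring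
      have h3 := congrArg φ h2
      rw [map_sum, map_zero] at h3
      have h4 : ∑ j : S, (d j : ℚ) * φ j ^ 2 = 0 := by
        rw [← h3]
        refine Finset.sum_congr rfl fun j _ => ?_
        rw [map_smul, map_smul, smul_eq_mul, smul_eq_mul]; ring
      have h5 := (Finset.sum_eq_zero_iff_of_nonneg (fun j _ => by positivity)).1 h4 i
        (Finset.mem_univ i)
      have h6 : (d i : ℚ) ≠ 0 := by
        intro h0; exact hei ((hd i).2.1 (by exact_mod_cast h0))
      simpa [h6] using h5
    rw [(Module.forall_dual_apply_eq_zero_iff ℚ (i : K)).1 hφ, zero_smul]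
  have : ∑ i : S, (i : K) • e i = 0 := Finset.sum_eq_zero fun i _ => hzero i
  rwa [this, sub_zero] at hnil

/-- The radical of the trace form. -/
def traceRad (H : Subgroup (GL (Fin n) K)) : Submodule K (Matrix (Fin n) (Fin n) K) where
  carrier := {x | x ∈ lieAlg (H : Set (GL (Fin n) K)) ∧
    ∀ y ∈ lieAlg (H : Set (GL (Fin n) K)), (x * y).trace = 0}
  zero_mem' := ⟨zero_mem _, by simp⟩
  add_mem' := by
    rintro a b ⟨ha, ha'⟩ ⟨hb, hb'⟩
    refine ⟨add_mem ha hb, fun y hy => ?_⟩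
    rw [add_mul, Matrix.trace_add, ha' y hy, hb' y hy, add_zero]
  smul_mem' := by
    rintro c a ⟨ha, ha'⟩
    refine ⟨Submodule.smul_mem _ _ ha, fun y hy => ?_⟩
    rw [smul_mul_assoc, Matrix.trace_smul, ha' y hy, smul_zero]

omit [CharZero K] in
theorem conj_inv_mem_lieAlg {x : Matrix (Fin n) (Fin n) K}
    (hx : x ∈ lieAlg (H : Set (GL (Fin n) K))) {g : GL (Fin n) K} (hg : g ∈ H) :
    ((g⁻¹ : GL (Fin n) K) : Matrix (Fin n) (Fin n) K) * x * g ∈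
      lieAlg (H : Set (GL (Fin n) K)) := by
  simpa using conj_mem_lieAlg hx (H.inv_mem hg)

omit [CharZero K] in
theorem conj_mem_traceRad {x : Matrix (Fin n) (Fin n) K} (hx : x ∈ traceRad H)
    {g : GL (Fin n) K} (hg : g ∈ H) :
    (g : Matrix (Fin n) (Fin n) K) * x * (g⁻¹ : GL (Fin n) K) ∈ traceRad H := by
  refine ⟨conj_mem_lieAlg hx.1 hg, fun y hy => ?_⟩
  rw [Matrix.mul_assoc, Matrix.mul_assoc, Matrix.trace_mul_comm, Matrix.mul_assoc, Matrix.mul_assoc,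
    ← Matrix.mul_assoc _ y]
  exact hx.2 _ (conj_inv_mem_lieAlg hy hg)

omit [CharZero K] in
theorem lie_mem_traceRad {x y : Matrix (Fin n) (Fin n) K} (hx : x ∈ traceRad H)
    (hy : y ∈ lieAlg (H : Set (GL (Fin n) K))) : ⁅x, y⁆ ∈ traceRad H := by
  refine ⟨lie_mem_lieAlg hx.1 hy, fun z hz => ?_⟩
  have h1 := hx.2 _ (lie_mem_lieAlg hy hz)
  rw [Ring.lie_def, mul_sub, Matrix.trace_sub] at h1
  rw [Ring.lie_def, sub_mul, Matrix.trace_sub, Matrix.mul_assoc, Matrix.mul_assoc,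
    Matrix.trace_mul_comm y, Matrix.mul_assoc]
  exact h1

/-- The descending filtration attached to a space of matrices. -/
def nilFlag (𝔯 : Submodule K (Matrix (Fin n) (Fin n) K)) : ℕ → Submodule K (Fin n → K)
  | 0 => ⊤
  | k + 1 => Submodule.span K {w | ∃ x ∈ 𝔯, ∃ v ∈ nilFlag 𝔯 k, w = x *ᵥ v}

omit [CharZero K] in
theorem mulVec_mem_nilFlag {𝔯 : Submodule K (Matrix (Fin n) (Fin n) K)}
    {x : Matrix (Fin n) (Fin n) K} (hx : x ∈ 𝔯) {k : ℕ} {v : Fin n → K} (hv : v ∈ nilFlag 𝔯 k) :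
    x *ᵥ v ∈ nilFlag 𝔯 (k + 1) :=
  Submodule.subset_span ⟨x, hx, v, hv, rfl⟩

omit [CharZero K] in
theorem nilFlag_antitone (𝔯 : Submodule K (Matrix (Fin n) (Fin n) K)) : Antitone (nilFlag 𝔯) := by
  refine antitone_nat_of_succ_le fun k => ?_
  induction k with
  | zero => exact le_top
  | succ k ih =>
    refine Submodule.span_le.2 ?_
    rintro _ ⟨x, hx, v, hv, rfl⟩
    exact mulVec_mem_nilFlag hx (ih hv)

attribute [local instance] LieRing.ofAssociativeRing LieAlgebra.ofAssociativeAlgebra in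
omit [CharZero K] in
/-- Engel's theorem for matrices. -/
theorem exists_nilFlag_eq_bot {𝔯 : Submodule K (Matrix (Fin n) (Fin n) K)}
    (hlie : ∀ x ∈ 𝔯, ∀ y ∈ 𝔯, x * y - y * x ∈ 𝔯) (hnil : ∀ x ∈ 𝔯, IsNilpotent x) :
    ∃ k, nilFlag 𝔯 k = ⊥ := by
  let T := Matrix.toLinAlgEquiv' (R := K) (n := Fin n)
  let L : LieSubalgebra K (Module.End K (Fin n → K)) :=
    { 𝔯.map T.toLinearMap with
      lie_mem' := by
        rintro _ _ ⟨x, hx, rfl⟩ ⟨y, hy, rfl⟩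
        refine ⟨x * y - y * x, hlie x hx y hy, ?_⟩
        simp [Ring.lie_def] }
  have hL : LieModule.IsNilpotent L (Fin n → K) := by
    rw [LieModule.isNilpotent_iff_forall' (R := K)]
    rintro ⟨_, x, hx, rfl⟩
    exact (hnil x hx).map T
  obtain ⟨k, hk⟩ := (LieModule.isNilpotent_iff K L (Fin n → K)).1 hL
  refine ⟨k, ?_⟩
  have hle : ∀ k, nilFlag 𝔯 k ≤ (LieModule.lowerCentralSeries K L (Fin n → K) k).toSubmodule := by
    intro k
    induction k with
    | zero => simp
    | succ k ih =>
      refine Submodule.span_le.2 ?_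
      rintro _ ⟨x, hx, v, hv, rfl⟩
      rw [LieModule.lowerCentralSeries_succ]
      exact LieSubmodule.lie_mem_lie (LieSubmodule.mem_top (⟨T x, x, hx, rfl⟩ : L)) (ih hv)
  have := hle k
  rw [hk] at this
  exact le_bot_iff.1 this

/-- The radical is an ideal of nilpotent matrices, so by Engel's theorem it moves each step of a
finite flag into the next. The group normalizes the radical and preserves the flag. All matrices
with this shifting property form a nilpotent algebra normalized by `H`; it contains the radical, and
it meets the Lie algebra in zero. -/
theorem traceRad_eq_bot [IsAlgClosed K] (hH : IsZariskiClosed K (H : Set (GL (Fin n) K)))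
    (hr : HasTrivialUnipotentRadical H) : traceRad H = ⊥ := by
  obtain ⟨N, hN⟩ := exists_nilFlag_eq_bot (𝔯 := traceRad H)
    (fun x hx y hy => lie_mem_traceRad hx hy.1)
    (fun x hx => isNilpotent_of_trace_eq_zero hx.1 hx.2)
  set V := nilFlag (traceRad H) with hV
  have hconj : ∀ g ∈ H, ∀ k, ∀ v ∈ V k, (g : Matrix (Fin n) (Fin n) K) *ᵥ v ∈ V k := by
    intro g hg k
    induction k with
    | zero => intro v _; trivial
    | succ k ih =>
      intro v hv
      refine Submodule.span_induction (p := fun v _ => (g : Matrix (Fin n) (Fin n) K) *ᵥ v ∈ V (k + 1))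
        ?_ ?_ ?_ ?_ hv
      · rintro _ ⟨x, hx, v, hv, rfl⟩
        have h1 := mulVec_mem_nilFlag (conj_mem_traceRad hx hg) (ih v hv)
        rwa [Matrix.mulVec_mulVec, Matrix.mul_assoc, ← Units.val_mul, inv_mul_cancel, Units.val_one,
          Matrix.mul_one, ← Matrix.mulVec_mulVec] at h1
      · simp
      · intro v w _ _ hv hw; rw [Matrix.mulVec_add]; exact add_mem hv hw
      · intro c v _ hv; rw [Matrix.mulVec_smul]; exact Submodule.smul_mem _ _ hv
  let 𝒜 : Submodule K (Matrix (Fin n) (Fin n) K) :=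
    { carrier := {a | ∀ k, ∀ v ∈ V k, a *ᵥ v ∈ V (k + 1)}
      zero_mem' := fun k v _ => by simp
      add_mem' := fun ha hb k v hv => by rw [Matrix.add_mulVec]; exact add_mem (ha k v hv) (hb k v hv)
      smul_mem' := fun c a ha k v hv => by
        rw [Matrix.smul_mulVec]; exact Submodule.smul_mem _ _ (ha k v hv) }
  have hA : IsNilSubalgebra H 𝒜 := by
    refine ⟨fun a ha b hb k v hv => ?_, fun a ha => ⟨N, ?_⟩, fun g hg a ha k v hv => ?_⟩
    · rw [← Matrix.mulVec_mulVec]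
      exact nilFlag_antitone _ (Nat.le_succ _) (ha _ _ (hb k v hv))
    · have h1 : ∀ k v, (a ^ k) *ᵥ v ∈ V k := by
        intro k
        induction k with
        | zero => intro v; trivial
        | succ k ih =>
          intro v; rw [pow_succ', ← Matrix.mulVec_mulVec]; exact ha k _ (ih v)
      refine Matrix.ext_of_mulVec_single fun i => ?_
      have := h1 N (Pi.single i 1)
      rw [hN, Submodule.mem_bot] at this
      rw [this, Matrix.zero_mulVec]
    · rw [← Matrix.mulVec_mulVec, ← Matrix.mulVec_mulVec]
      exact hconj g hg _ _ (ha k _ (hconj g⁻¹ (H.inv_mem hg) k v hv))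
  rw [eq_bot_iff]
  intro x hx
  exact hA.eq_zero_of_mem_lieAlg hH hr hx.1 fun k v hv => mulVec_mem_nilFlag hx hv

end TraceForm

/-! ### The centre of the Lie algebra and its complement. -/

section Center

variable {n : ℕ} {K : Type*} [Field K]

/-- The elements of the Lie algebra that commute with the group. -/
def lieCenter (H : Subgroup (GL (Fin n) K)) : Submodule K (Matrix (Fin n) (Fin n) K) where
  carrier := {x | x ∈ lieAlg (H : Set (GL (Fin n) K)) ∧
    ∀ g ∈ H, Commute x (g : Matrix (Fin n) (Fin n) K)}
  zero_mem' := ⟨zero_mem _, fun _ _ => Commute.zero_left _⟩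
  add_mem' := fun ha hb => ⟨add_mem ha.1 hb.1, fun g hg => (ha.2 g hg).add_left (hb.2 g hg)⟩
  smul_mem' := fun c _ ha =>
    ⟨Submodule.smul_mem _ _ ha.1, fun g hg => (ha.2 g hg).smul_left c⟩

/-- The entries of `xX - Xx`, with `X` the generic matrix, vanish on `H`; differentiating them at
the identity along `y` gives `xy = yx`. -/
theorem lieAlg_commute {H : Subgroup (GL (Fin n) K)} {x y : Matrix (Fin n) (Fin n) K}
    (hy : y ∈ lieAlg (H : Set (GL (Fin n) K)))
    (hx : ∀ g ∈ H, Commute x (g : Matrix (Fin n) (Fin n) K)) : Commute x y := by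
  have hpoly : ∀ i j, evalMat (1 : Matrix (Fin n) (Fin n) K) (lieDer y
      ((constMat x * genMat n K) i j - (genMat n K * constMat x) i j)) = 0 := by
    intro i j
    refine mem_lieAlg.1 hy _ fun g hg => ?_
    have h1 := map_mul_evalMat (evalMat (g : Matrix (Fin n) (Fin n) K)) (constMat x) (genMat n K)
    have h2 := map_mul_evalMat (evalMat (g : Matrix (Fin n) (Fin n) K)) (genMat n K) (constMat x)
    rw [constMat_map_evalMat, genMat_map_evalMat] at h1 h2
    replace h1 := congrFun (congrFun h1 i) j
    replace h2 := congrFun (congrFun h2 i) j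
    rw [Matrix.map_apply] at h1 h2
    rw [map_sub, h1, h2, (hx g hg).eq, sub_self]
  ext i j
  have h := hpoly i j
  have e1 : lieDer y ((constMat x * genMat n K) i j) =
      (constMat x * (genMat n K * constMat y)) i j := by
    rw [Matrix.mul_apply, map_sum, Matrix.mul_apply]
    refine Finset.sum_congr rfl fun k _ => ?_
    rw [Derivation.leibniz, show genMat n K k j = MvPolynomial.X (k, j) from rfl, lieDer_X]
    simp [constMat, lieDer]
  rw [map_sub, e1, lieDer_entry, map_sub] at h
  have h1 := map_mul_evalMat (evalMat (1 : Matrix (Fin n) (Fin n) K)) (constMat x)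
    (genMat n K * constMat y)
  have h2 := map_mul_evalMat (evalMat (1 : Matrix (Fin n) (Fin n) K)) (genMat n K) (constMat (y * x))
  rw [map_mul_evalMat _ (genMat n K), constMat_map_evalMat, genMat_map_evalMat, constMat_map_evalMat,
    Matrix.one_mul] at h1
  rw [constMat_map_evalMat, genMat_map_evalMat, Matrix.one_mul] at h2
  replace h1 := congrFun (congrFun h1 i) j
  replace h2 := congrFun (congrFun h2 i) j
  rw [Matrix.map_apply] at h1 h2
  rw [h1, h2] at h
  exact sub_eq_zero.1 h

variable [CharZero K] [IsAlgClosed K] {H : Subgroup (GL (Fin n) K)}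

/-- The nilpotent part `N` is in the Lie algebra, by the replica for the identity map, and commutes
with `H`. Hence `N·K[N]` is a nilpotent algebra normalized by `H`, and it contains `N`, which must
vanish. -/
theorem lieCenter_semisimple (hH : IsZariskiClosed K (H : Set (GL (Fin n) K)))
    (hr : HasTrivialUnipotentRadical H) {x : Matrix (Fin n) (Fin n) K} (hx : x ∈ lieCenter H) :
    ∃ (S : Finset K) (e : S → Matrix (Fin n) (Fin n) K), CompleteOrthogonalIdempotents e ∧
      x = ∑ i : S, (i : K) • e i ∧ ∀ i, e i ∈ Algebra.adjoin K {x} := by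
  obtain ⟨S, e, he, hnil, hadj⟩ := exists_jordan x
  refine ⟨S, e, he, ?_, hadj⟩
  set N := x - ∑ i : S, (i : K) • e i with hN
  have hNmem : N ∈ lieAlg (H : Set (GL (Fin n) K)) :=
    sub_mem hx.1 (replica_mem_lieAlg hx.1 he hnil hadj (AddMonoidHom.id K))
  have hNcomm : ∀ g ∈ H, Commute N (g : Matrix (Fin n) (Fin n) K) := fun g hg =>
    (hx.2 g hg).sub_left (Commute.sum_left _ _ _ fun i _ =>
      (commute_of_mem_adjoin (hadj i) (hx.2 g hg)).smul_left _)
  let 𝒜 : Submodule K (Matrix (Fin n) (Fin n) K) :=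
    LinearMap.range ((LinearMap.mulLeft K N) ∘ₗ (Polynomial.aeval (R := K) N).toLinearMap)
  have hmem : ∀ p : Polynomial K, N * Polynomial.aeval N p ∈ 𝒜 := fun p => ⟨p, rfl⟩
  have hA : IsNilSubalgebra H 𝒜 := by
    refine ⟨?_, ?_, ?_⟩
    · rintro _ ⟨p, rfl⟩ _ ⟨q, rfl⟩
      have := hmem (p * Polynomial.X * q)
      rw [map_mul, map_mul, Polynomial.aeval_X] at this
      simpa [mul_assoc] using this
    · rintro _ ⟨p, rfl⟩
      refine Commute.isNilpotent_mul_right ?_ hnil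
      exact (commute_of_mem_adjoin (Polynomial.aeval_mem_adjoin_singleton K N) (Commute.refl N)).symm
    · rintro g hg _ ⟨p, rfl⟩
      have h1 : Commute (N * Polynomial.aeval N p) (g : Matrix (Fin n) (Fin n) K) :=
        (hNcomm g hg).mul_left
          (commute_of_mem_adjoin (Polynomial.aeval_mem_adjoin_singleton K N) (hNcomm g hg))
      change (g : Matrix (Fin n) (Fin n) K) * (N * Polynomial.aeval N p) * _ ∈ 𝒜
      rw [← h1.eq, Matrix.mul_assoc, ← Units.val_mul, mul_inv_cancel, Units.val_one, Matrix.mul_one]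
      exact hmem p
  have h0 : N = 0 := hA.eq_zero_of_mem_lieAlg hH hr hNmem (by simpa using hmem 1)
  exact sub_eq_zero.1 h0

/-- A family of orthogonal idempotents that diagonalizes a finite set of commuting matrices. -/
theorem exists_simultaneous_idempotents {K : Type*} [Field K] (T : Finset (Matrix (Fin n) (Fin n) K))
    (hcomm : ∀ x ∈ T, ∀ y ∈ T, Commute x y)
    (hT : ∀ x ∈ T, ∃ (S : Finset K) (e : S → Matrix (Fin n) (Fin n) K),
      CompleteOrthogonalIdempotents e ∧ x = ∑ i : S, (i : K) • e i ∧
        ∀ i, e i ∈ Algebra.adjoin K {x}) :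
    ∃ (r : ℕ) (π : Fin r → Matrix (Fin n) (Fin n) K), CompleteOrthogonalIdempotents π ∧
      (∀ x ∈ T, x ∈ Submodule.span K (Set.range π)) ∧
      ∀ y, (∀ x ∈ T, Commute x y) → ∀ i, Commute (π i) y := by
  classical
  induction T using Finset.induction_on with
  | empty =>
    refine ⟨1, fun _ => 1, ⟨⟨fun _ => IsIdempotentElem.one, fun i j h => ?_⟩, by simp⟩, by simp,
      fun y _ _ => Commute.one_left y⟩
    exact absurd (Subsingleton.elim i j) h
  | insert x T hxT ih =>
    obtain ⟨r, π, hπ, hspan, hπc⟩ := ih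
      (fun a ha b hb => hcomm a (Finset.mem_insert_of_mem ha) b (Finset.mem_insert_of_mem hb))
      (fun a ha => hT a (Finset.mem_insert_of_mem ha))
    obtain ⟨S, e, he, hx, hadj⟩ := hT x (Finset.mem_insert_self x T)
    have hπx : ∀ i, Commute (π i) x := hπc x fun a ha =>
      hcomm a (Finset.mem_insert_of_mem ha) x (Finset.mem_insert_self x T)
    have hπe : ∀ i j, Commute (π i) (e j) := fun i j =>
      (commute_of_mem_adjoin (hadj j) (hπx i).symm).symm
    let E := Fintype.equivFin (Fin r × S)
    have hsplit : ∀ i : Fin r, π i = ∑ j, π i * e j := fun i => by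
      rw [← Finset.mul_sum, he.complete, mul_one]
    have hsplit' : ∀ j : S, e j = ∑ i, π i * e j := fun j => by
      rw [← Finset.sum_mul, hπ.complete, one_mul]
    have hmem : ∀ p : Fin r × S, π p.1 * e p.2 ∈ Submodule.span K
        (Set.range fun k => π (E.symm k).1 * e (E.symm k).2) := fun p =>
      Submodule.subset_span ⟨E p, by simp⟩
    refine ⟨_, fun k => π (E.symm k).1 * e (E.symm k).2, ⟨⟨fun k => ?_, fun k l hkl => ?_⟩, ?_⟩,
      ?_, ?_⟩
    · exact (hπ.idem _).mul_of_commute (hπe _ _) (he.idem _)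
    · change π _ * e _ * (π _ * e _) = 0
      rw [(hπe (E.symm l).1 (E.symm k).2).symm.mul_mul_mul_comm]
      by_cases h : (E.symm k).1 = (E.symm l).1
      · have h2 : (E.symm k).2 ≠ (E.symm l).2 := fun h2 =>
          hkl (E.symm.injective (Prod.ext h h2))
        rw [he.ortho h2, mul_zero]
      · rw [hπ.ortho h, zero_mul]
    · rw [E.symm.sum_comp (fun p => π p.1 * e p.2), Fintype.sum_prod_type]
      simp only [← hsplit]
      exact hπ.complete
    · intro y hy
      rcases Finset.mem_insert.1 hy with rfl | hy
      · rw [hx]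
        refine sum_mem fun j _ => Submodule.smul_mem _ _ ?_
        rw [hsplit' j]
        exact sum_mem fun i _ => hmem (i, j)
      · refine Submodule.span_le.2 ?_ (hspan y hy)
        rintro _ ⟨i, rfl⟩
        rw [SetLike.mem_coe, hsplit i]
        exact sum_mem fun j _ => hmem (i, j)
    · intro y hy k
      exact (hπc y (fun a ha => hy a (Finset.mem_insert_of_mem ha)) _).mul_left
        (commute_of_mem_adjoin (hadj _) (hy x (Finset.mem_insert_self x T)))

/-- A complete family of nonzero orthogonal idempotents, commuting with the group, that
diagonalizes the centre of the Lie algebra. -/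
structure IsCentralDecomposition (H : Subgroup (GL (Fin n) K)) {ι : Type} [Fintype ι]
    (π : ι → Matrix (Fin n) (Fin n) K) : Prop where
  coi : CompleteOrthogonalIdempotents π
  ne_zero : ∀ i, π i ≠ 0
  commute : ∀ g ∈ H, ∀ i, Commute (π i) (g : Matrix (Fin n) (Fin n) K)
  exists_eq : ∀ x ∈ lieCenter H, ∃ c : ι → K, x = ∑ i, c i • π i

theorem exists_centralDecomposition (hH : IsZariskiClosed K (H : Set (GL (Fin n) K)))
    (hr : HasTrivialUnipotentRadical H) :
    ∃ (ι : Type) (_ : Fintype ι) (π : ι → Matrix (Fin n) (Fin n) K), IsCentralDecomposition H π := by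
  classical
  obtain ⟨T, hT⟩ := IsNoetherian.noetherian (lieCenter H)
  have hTmem : ∀ x ∈ T, x ∈ lieCenter H := fun x hx => hT ▸ Submodule.subset_span hx
  obtain ⟨r, π, hπ, hspan, hcomm⟩ := exists_simultaneous_idempotents T
    (fun x hx y hy => lieAlg_commute (hTmem y hy).1 (hTmem x hx).2)
    (fun x hx => lieCenter_semisimple hH hr (hTmem x hx))
  refine ⟨{i // π i ≠ 0}, inferInstance, fun i => π i, ⟨⟨fun i => hπ.idem i, fun i j hij =>
    hπ.ortho fun h => hij (Subtype.ext h)⟩, ?_⟩, fun i => i.2, fun g hg i =>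
    hcomm _ (fun x hx => (hTmem x hx).2 g hg) i, ?_⟩
  · rw [← hπ.complete]
    exact (Finset.sum_subtype (Finset.univ.filter (π · ≠ 0)) (by simp) π).symm.trans
      (Finset.sum_filter_ne_zero _)
  · intro x hx
    have h1 : x ∈ Submodule.span K (Set.range fun i : {i // π i ≠ 0} => π i) := by
      have h2 : Submodule.span K (Set.range π) ≤
          Submodule.span K (Set.range fun i : {i // π i ≠ 0} => π i) := by
        refine Submodule.span_le.2 ?_
        rintro _ ⟨i, rfl⟩
        by_cases hi : π i = 0
        · rw [hi]; exact zero_mem _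
        · exact Submodule.subset_span ⟨⟨i, hi⟩, rfl⟩
      rw [← hT] at hx
      exact Submodule.span_le.2 (fun y hy => h2 (hspan y hy)) hx
    obtain ⟨c, hc⟩ := (Submodule.mem_span_range_iff_exists_fun K).1 h1
    exact ⟨c, hc.symm⟩

/-- The span of all `g y g⁻¹ - y`. -/
def lieDerived (H : Subgroup (GL (Fin n) K)) : Submodule K (Matrix (Fin n) (Fin n) K) :=
  Submodule.span K {x | ∃ g ∈ H, ∃ y ∈ lieAlg (H : Set (GL (Fin n) K)),
    x = (g : Matrix (Fin n) (Fin n) K) * y * (g⁻¹ : GL (Fin n) K) - y}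

omit [CharZero K] [IsAlgClosed K] in
theorem trace_mul_lieDerived {e x : Matrix (Fin n) (Fin n) K}
    (he : ∀ g ∈ H, Commute e (g : Matrix (Fin n) (Fin n) K)) (hx : x ∈ lieDerived H) :
    (e * x).trace = 0 := by
  induction hx using Submodule.span_induction with
  | mem x hx =>
    obtain ⟨g, hg, y, _, rfl⟩ := hx
    rw [mul_sub, Matrix.trace_sub, sub_eq_zero, ← Matrix.mul_assoc, ← Matrix.mul_assoc,
      (he g hg).eq, Matrix.mul_assoc, Matrix.mul_assoc, Matrix.trace_mul_comm, Matrix.mul_assoc,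
      Matrix.mul_assoc, ← Units.val_mul, inv_mul_cancel, Units.val_one, Matrix.mul_one]
  | zero => simp
  | add x y _ _ hx hy => rw [mul_add, Matrix.trace_add, hx, hy, add_zero]
  | smul c x _ hx => rw [mul_smul_comm, Matrix.trace_smul, hx, smul_zero]

/-- The orthogonal of the `gyg⁻¹ - y` for the trace form consists of elements fixed by conjugation
up to the radical, which is zero, hence of central ones. A central `∑ c i π i` that also lies in
`lieDerived` is zero, because every trace against `π i` vanishes and `π i` has nonzero trace. So the
two spaces are complementary. -/
theorem lieAlg_eq_add (hH : IsZariskiClosed K (H : Set (GL (Fin n) K)))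
    (hr : HasTrivialUnipotentRadical H) {ι : Type} [Fintype ι] {π : ι → Matrix (Fin n) (Fin n) K}
    (hπ : IsCentralDecomposition H π)
    {x : Matrix (Fin n) (Fin n) K} (hx : x ∈ lieAlg (H : Set (GL (Fin n) K))) :
    ∃ z ∈ lieCenter H, ∃ d ∈ lieDerived H, x = z + d := by
  set L := lieAlg (H : Set (GL (Fin n) K)) with hL
  let B : LinearMap.BilinForm K L := LinearMap.mk₂ K
    (fun x y => ((x : Matrix (Fin n) (Fin n) K) * y).trace)
    (by intro a b c; simp [add_mul]) (by intro a b c; simp)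
    (by intro a b c; simp [mul_add]) (by intro a b c; simp)
  have hBr : B.IsRefl := fun a b h => by
    change ((b : Matrix (Fin n) (Fin n) K) * a).trace = 0
    rw [Matrix.trace_mul_comm]; exact h
  let W : Submodule K L := (lieDerived H).comap L.subtype
  have horth : ∀ y ∈ B.orthogonal W, (y : Matrix (Fin n) (Fin n) K) ∈ lieCenter H := by
    intro y hy
    refine ⟨y.2, fun g hg => ?_⟩
    have h1 : ((g⁻¹ : GL (Fin n) K) : Matrix (Fin n) (Fin n) K) * y * g - y ∈ traceRad H := by
      refine ⟨sub_mem (conj_inv_mem_lieAlg y.2 hg) y.2, fun w hw => ?_⟩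
      have hdm : (g : Matrix (Fin n) (Fin n) K) * w * (g⁻¹ : GL (Fin n) K) - w ∈ L :=
        sub_mem (conj_mem_lieAlg hw hg) hw
      have h2 : (((g : Matrix (Fin n) (Fin n) K) * w * (g⁻¹ : GL (Fin n) K) - w) *
          (y : Matrix (Fin n) (Fin n) K)).trace = 0 :=
        hy ⟨_, hdm⟩ (show _ ∈ lieDerived H from Submodule.subset_span ⟨g, hg, w, hw, rfl⟩)
      rw [sub_mul, Matrix.trace_sub, sub_eq_zero] at h2
      rw [sub_mul, Matrix.trace_sub, sub_eq_zero, Matrix.trace_mul_comm (y : Matrix (Fin n) (Fin n) K),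
        ← h2, Matrix.mul_assoc, Matrix.mul_assoc, Matrix.mul_assoc, Matrix.trace_mul_comm,
        Matrix.mul_assoc, Matrix.mul_assoc, Matrix.trace_mul_comm, ← Matrix.mul_assoc]
      simp only [Matrix.mul_assoc]
    rw [traceRad_eq_bot hH hr, Submodule.mem_bot, sub_eq_zero] at h1
    have h3 := congrArg (fun m => (g : Matrix (Fin n) (Fin n) K) * m) h1
    simp only [← Matrix.mul_assoc] at h3
    rw [← Units.val_mul, mul_inv_cancel, Units.val_one, Matrix.one_mul] at h3
    exact h3
  have hdis : Disjoint W (B.orthogonal W) := by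
    rw [Submodule.disjoint_def]
    intro y hyW hyo
    obtain ⟨c, hc⟩ := hπ.exists_eq _ (horth y hyo)
    have hc0 : ∀ i, c i = 0 := by
      intro i
      have h1 := trace_mul_lieDerived (fun g hg => hπ.commute g hg i) hyW
      change (π i * (y : Matrix (Fin n) (Fin n) K)).trace = 0 at h1
      rw [hc, Finset.mul_sum, Finset.sum_eq_single i] at h1
      · obtain ⟨d, hd, hd0, -⟩ := exists_rank_of_idempotent (hπ.coi.idem i)
        rw [mul_smul_comm, (hπ.coi.idem i).eq, Matrix.trace_smul, hd, smul_eq_mul] at h1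
        refine (mul_eq_zero.1 h1).resolve_right fun h => hπ.ne_zero i (hd0 ?_)
        exact_mod_cast h
      · intro j _ hj; rw [mul_smul_comm, hπ.coi.ortho hj.symm, smul_zero]
      · simp
    ext1
    rw [hc]; simp [hc0]
  have hcompl := (LinearMap.BilinForm.isCompl_orthogonal_iff_disjoint hBr).2 hdis
  have hxt : (⟨x, hx⟩ : L) ∈ W ⊔ B.orthogonal W := by rw [hcompl.sup_eq_top]; trivial
  obtain ⟨d, hd, z, hz, hdz⟩ := Submodule.mem_sup.1 hxt
  refine ⟨z, horth z hz, d, hd, ?_⟩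
  have := congrArg Subtype.val hdz
  rw [← show (d : Matrix (Fin n) (Fin n) K) + z = x from this, add_comm]

end Center

end LinAlgGroup
end

noncomputable section

namespace LinAlgGroup

open MvPolynomial

/-! ### First order computations over the dual numbers. -/

section Dual

variable {n : ℕ} {K : Type*} [Field K]

/-- The matrix `1 + ε x` over the dual numbers. -/
def dualMat (x : Matrix (Fin n) (Fin n) K) : Matrix (Fin n) (Fin n) (DualNumber K) :=
  1 + x.map TrivSqZeroExt.inr

theorem map_inl_mul_map_inr (x y : Matrix (Fin n) (Fin n) K) :
    (x.map TrivSqZeroExt.inl : Matrix (Fin n) (Fin n) (DualNumber K)) * y.map TrivSqZeroExt.inr =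
      (x * y).map TrivSqZeroExt.inr := by
  ext i j
  · simp [Matrix.mul_apply, TrivSqZeroExt.fst_sum]
  · simp [Matrix.mul_apply, TrivSqZeroExt.snd_sum, mul_comm]

theorem map_inr_mul_map_inl (x y : Matrix (Fin n) (Fin n) K) :
    (x.map TrivSqZeroExt.inr : Matrix (Fin n) (Fin n) (DualNumber K)) * y.map TrivSqZeroExt.inl =
      (x * y).map TrivSqZeroExt.inr := by
  ext i j
  · simp [Matrix.mul_apply, TrivSqZeroExt.fst_sum]
  · simp [Matrix.mul_apply, TrivSqZeroExt.snd_sum, mul_comm]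

theorem map_inr_mul_map_inr (x y : Matrix (Fin n) (Fin n) K) :
    (x.map TrivSqZeroExt.inr : Matrix (Fin n) (Fin n) (DualNumber K)) * y.map TrivSqZeroExt.inr =
      0 := by
  ext i j <;> simp [Matrix.mul_apply]

theorem map_inr_add (x y : Matrix (Fin n) (Fin n) K) :
    ((x + y).map TrivSqZeroExt.inr : Matrix (Fin n) (Fin n) (DualNumber K)) =
      x.map TrivSqZeroExt.inr + y.map TrivSqZeroExt.inr := by
  ext i j <;> simp

theorem dualMat_mul (x y : Matrix (Fin n) (Fin n) K) :
    dualMat x * dualMat y = dualMat (x + y) := by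
  simp only [dualMat, add_mul, mul_add, one_mul, mul_one, map_inr_mul_map_inr, map_inr_add]
  abel

theorem dualMat_zero : dualMat (0 : Matrix (Fin n) (Fin n) K) = 1 := by
  ext i j <;> simp [dualMat]

theorem dualMat_pow (x : Matrix (Fin n) (Fin n) K) (N : ℕ) :
    dualMat x ^ N = dualMat ((N : K) • x) := by
  induction N with
  | zero => simp [dualMat_zero]
  | succ N ih => rw [pow_succ, ih, dualMat_mul]; push_cast; rw [add_smul, one_smul]

theorem conj_dualMat {g h : Matrix (Fin n) (Fin n) K} (hgh : g * h = 1)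
    (x : Matrix (Fin n) (Fin n) K) :
    (g.map TrivSqZeroExt.inl : Matrix (Fin n) (Fin n) (DualNumber K)) * dualMat x *
      h.map TrivSqZeroExt.inl = dualMat (g * x * h) := by
  have h1 : (g.map TrivSqZeroExt.inl : Matrix (Fin n) (Fin n) (DualNumber K)) *
      h.map TrivSqZeroExt.inl = 1 := by
    have := Matrix.map_mul (L := g) (M := h) (f := TrivSqZeroExt.inlHom K K)
    rw [hgh, Matrix.map_one _ (map_zero _) (map_one _)] at this
    exact this.symm
  rw [dualMat, mul_add, add_mul, mul_one, h1, map_inl_mul_map_inr, map_inr_mul_map_inl, dualMat]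

theorem evalMat_mul_dualMat (g x : Matrix (Fin n) (Fin n) K) (f : MvPolynomial (Fin n × Fin n) K) :
    evalMat (S := DualNumber K) (g.map TrivSqZeroExt.inl * dualMat x) f =
      TrivSqZeroExt.inl (evalMat g f) + TrivSqZeroExt.inr (evalMat g (lieDer x f)) := by
  rw [dualMat, mul_add, mul_one, map_inl_mul_map_inr, evalMat_dual]

theorem evalMat_dualMat (x : Matrix (Fin n) (Fin n) K) (f : MvPolynomial (Fin n × Fin n) K) :
    evalMat (dualMat x) f =
      TrivSqZeroExt.inl (evalMat 1 f) + TrivSqZeroExt.inr (evalMat 1 (lieDer x f)) := by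
  rw [← evalMat_mul_dualMat, Matrix.map_one _ (TrivSqZeroExt.inl_zero _) (TrivSqZeroExt.inl_one _),
    one_mul]

theorem evalMat_dualMat_eq_zero {A : Subgroup (GL (Fin n) K)} {x : Matrix (Fin n) (Fin n) K}
    (hx : x ∈ lieAlg (A : Set (GL (Fin n) K))) {f : MvPolynomial (Fin n × Fin n) K}
    (hf : f ∈ vanIdeal (A : Set (GL (Fin n) K))) : evalMat (dualMat x) f = 0 := by
  have h1 : evalMat (1 : Matrix (Fin n) (Fin n) K) f = 0 := by simpa using hf 1 A.one_mem
  rw [evalMat_dualMat, h1, mem_lieAlg.1 hx f hf]; simp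

theorem mem_lieAlg_of_dualMat {A : Set (GL (Fin n) K)} {x : Matrix (Fin n) (Fin n) K}
    (h : ∀ f ∈ vanIdeal A, evalMat (dualMat x) f = 0) : x ∈ lieAlg A := by
  refine mem_lieAlg.2 fun f hf => ?_
  have := congrArg TrivSqZeroExt.snd (h f hf)
  rw [evalMat_dualMat] at this
  simpa using this

theorem det_dualMat (x : Matrix (Fin n) (Fin n) K) :
    (dualMat x).det = 1 + TrivSqZeroExt.inr x.trace := by
  have h1 : dualMat x = 1 + (DualNumber.eps : DualNumber K) • x.map TrivSqZeroExt.inl := by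
    ext i j <;> simp [dualMat]
  have h2 : (DualNumber.eps : DualNumber K) ^ 2 = 0 := by rw [sq, DualNumber.eps_mul_eps]
  rw [h1, Matrix.det_one_add_smul, h2, mul_zero, add_zero]
  congr 1
  ext <;> simp [Matrix.trace, TrivSqZeroExt.fst_sum, TrivSqZeroExt.snd_sum]

theorem one_add_inr_pow (t : K) (m : ℕ) :
    (1 + TrivSqZeroExt.inr t : DualNumber K) ^ m = 1 + TrivSqZeroExt.inr ((m : K) * t) := by
  induction m with
  | zero => simp
  | succ m ih => rw [pow_succ, ih]; ext <;> simp; ring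

end Dual

/-! ### Determinants on the blocks of a family of idempotents. -/

section Block

variable {n : ℕ} {K : Type*} [Field K] {ι : Type} [Fintype ι]
  {S T : Type*} [CommRing S] [Algebra K S] [CommRing T] [Algebra K T]

/-- The determinant on the image of an idempotent. -/
def blockDet (e : Matrix (Fin n) (Fin n) K) (a : Matrix (Fin n) (Fin n) S) : S :=
  (e.map (algebraMap K S) * a + (1 - e.map (algebraMap K S))).det

theorem map_algebraMap_map (φ : S →ₐ[K] T) (e : Matrix (Fin n) (Fin n) K) :
    (e.map (algebraMap K S)).map φ = e.map (algebraMap K T) := by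
  ext i j; simp

theorem map_blockDet (φ : S →ₐ[K] T) (e : Matrix (Fin n) (Fin n) K)
    (a : Matrix (Fin n) (Fin n) S) : φ (blockDet e a) = blockDet e (a.map φ) := by
  rw [blockDet, AlgHom.map_det, AlgHom.mapMatrix_apply, Matrix.map_add _ (map_add φ),
    Matrix.map_sub _ (map_sub φ), map_mul_evalMat, map_algebraMap_map,
    Matrix.map_one _ (map_zero φ) (map_one φ), blockDet]

theorem map_algebraMap_mul (e f : Matrix (Fin n) (Fin n) K) :
    e.map (algebraMap K S) * f.map (algebraMap K S) = (e * f).map (algebraMap K S) :=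
  (Matrix.map_mul (f := algebraMap K S)).symm

theorem blockDet_mul {e : Matrix (Fin n) (Fin n) K} (he : IsIdempotentElem e)
    {a : Matrix (Fin n) (Fin n) S} (ha : Commute (e.map (algebraMap K S)) a)
    (b : Matrix (Fin n) (Fin n) S) : blockDet e (a * b) = blockDet e a * blockDet e b := by
  have he' : e.map (algebraMap K S) * e.map (algebraMap K S) = e.map (algebraMap K S) := by
    rw [map_algebraMap_mul, he.eq]
  rw [blockDet, blockDet, blockDet, ← Matrix.det_mul]
  congr 1
  set e' := e.map (algebraMap K S)
  have h1 : e' * a * e' = e' * a := by rw [ha.eq, Matrix.mul_assoc, he']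
  have : (e' * a + (1 - e')) * (e' * b + (1 - e')) = e' * a * e' * b + (e' * a - e' * a * e') +
      (e' * b - e' * e' * b) + (1 - e' - (e' - e' * e')) := by noncomm_ring
  rw [this, h1, he', sub_self, sub_self, sub_self, sub_zero, add_zero, add_zero, Matrix.mul_assoc]

theorem blockDet_one (e : Matrix (Fin n) (Fin n) K) :
    blockDet e (1 : Matrix (Fin n) (Fin n) S) = 1 := by
  simp [blockDet]

/-- The block scalar matrix of powers of block determinants. -/
def blockMap (π : ι → Matrix (Fin n) (Fin n) K) (m : ι → ℕ) (a : Matrix (Fin n) (Fin n) S) :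
    Matrix (Fin n) (Fin n) S :=
  ∑ i, blockDet (π i) a ^ m i • (π i).map (algebraMap K S)

theorem map_blockMap (φ : S →ₐ[K] T) (π : ι → Matrix (Fin n) (Fin n) K) (m : ι → ℕ)
    (a : Matrix (Fin n) (Fin n) S) : (blockMap π m a).map φ = blockMap π m (a.map φ) := by
  ext i j
  simp only [blockMap, Matrix.map_apply, Matrix.sum_apply, Matrix.smul_apply, map_sum, smul_eq_mul,
    map_mul, map_pow, map_blockDet, AlgHom.commutes]

theorem sum_smul_mul_sum_smul {π : ι → Matrix (Fin n) (Fin n) K}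
    (hπ : OrthogonalIdempotents π) (c d : ι → S) :
    (∑ i, c i • (π i).map (algebraMap K S)) * ∑ i, d i • (π i).map (algebraMap K S) =
      ∑ i, (c i * d i) • (π i).map (algebraMap K S) := by
  classical
  rw [Finset.sum_mul]
  refine Finset.sum_congr rfl fun i _ => ?_
  rw [Finset.mul_sum, Finset.sum_eq_single i]
  · rw [smul_mul_smul_comm, map_algebraMap_mul, (hπ.idem i).eq]
  · intro j _ hj
    rw [smul_mul_smul_comm, map_algebraMap_mul, hπ.ortho hj.symm, Matrix.map_zero _ (map_zero _),
      smul_zero]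
  · simp

theorem sum_map_algebraMap {π : ι → Matrix (Fin n) (Fin n) K} (hπ : CompleteOrthogonalIdempotents π) :
    ∑ i, (π i).map (algebraMap K S) = 1 := by
  have h : (∑ i, π i).map (algebraMap K S) = ∑ i, (π i).map (algebraMap K S) := by
    ext i j; simp [Matrix.sum_apply]
  rw [← h, hπ.complete, Matrix.map_one _ (map_zero _) (map_one _)]

theorem blockMap_mul {π : ι → Matrix (Fin n) (Fin n) K} (hπ : OrthogonalIdempotents π) (m : ι → ℕ)
    {a : Matrix (Fin n) (Fin n) S} (ha : ∀ i, Commute ((π i).map (algebraMap K S)) a)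
    (b : Matrix (Fin n) (Fin n) S) : blockMap π m (a * b) = blockMap π m a * blockMap π m b := by
  rw [blockMap, blockMap, blockMap, sum_smul_mul_sum_smul hπ]
  simp only [blockDet_mul (hπ.idem _) (ha _), mul_pow]

theorem blockMap_one {π : ι → Matrix (Fin n) (Fin n) K} (hπ : CompleteOrthogonalIdempotents π)
    (m : ι → ℕ) : blockMap π m (1 : Matrix (Fin n) (Fin n) S) = 1 := by
  simp only [blockMap, blockDet_one, one_pow, one_smul, sum_map_algebraMap hπ]

theorem map_algebraMap_self (a : Matrix (Fin n) (Fin n) K) : a.map (algebraMap K K) = a := rfl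

theorem map_algebraMap_dual (a : Matrix (Fin n) (Fin n) K) :
    a.map (algebraMap K (DualNumber K)) = a.map TrivSqZeroExt.inl := rfl

theorem map_inl_blockMap (π : ι → Matrix (Fin n) (Fin n) K) (m : ι → ℕ)
    (a : Matrix (Fin n) (Fin n) K) :
    (blockMap π m a).map (TrivSqZeroExt.inl : K → DualNumber K) =
      blockMap π m (a.map TrivSqZeroExt.inl) :=
  map_blockMap (Algebra.ofId K (DualNumber K)) π m a

/-- The differential of `blockMap`. -/
def blockTrace (π : ι → Matrix (Fin n) (Fin n) K) (m : ι → ℕ) (x : Matrix (Fin n) (Fin n) K) :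
    Matrix (Fin n) (Fin n) K :=
  ∑ i, ((m i : K) * (π i * x).trace) • π i

theorem blockMap_dualMat {π : ι → Matrix (Fin n) (Fin n) K} (hπ : CompleteOrthogonalIdempotents π)
    (m : ι → ℕ) (x : Matrix (Fin n) (Fin n) K) :
    blockMap π m (dualMat x) = dualMat (blockTrace π m x) := by
  have h1 : ∀ i, blockDet (π i) (dualMat x) = 1 + TrivSqZeroExt.inr (π i * x).trace := by
    intro i
    rw [← det_dualMat, blockDet, map_algebraMap_dual, dualMat, mul_add, mul_one,
      map_inl_mul_map_inr, dualMat]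
    congr 1; abel
  rw [blockMap]
  simp only [h1, one_add_inr_pow, add_smul, one_smul, Finset.sum_add_distrib]
  rw [dualMat, sum_map_algebraMap (S := DualNumber K) hπ]
  refine congrArg (1 + ·) ?_
  ext i j <;> simp [blockTrace, Matrix.sum_apply, TrivSqZeroExt.fst_sum, TrivSqZeroExt.snd_sum,
    TrivSqZeroExt.algebraMap_eq_inl]

theorem evalMat_blockMap_genMat (π : ι → Matrix (Fin n) (Fin n) K) (m : ι → ℕ)
    (a : Matrix (Fin n) (Fin n) S) (f : MvPolynomial (Fin n × Fin n) K) :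
    evalMat a (evalMat (blockMap π m (genMat n K)) f) = evalMat (blockMap π m a) f := by
  rw [evalMat_map, map_blockMap, genMat_map_evalMat]

/-- The block scalar matrices. -/
def torusHom {π : ι → Matrix (Fin n) (Fin n) K} (hπ : CompleteOrthogonalIdempotents π) :
    (ι → Kˣ) →* GL (Fin n) K :=
  MonoidHom.toHomUnits
    { toFun := fun c => ∑ i, (c i : K) • π i
      map_one' := by simpa using hπ.complete
      map_mul' := fun c d => by
        simpa [map_algebraMap_self] using (sum_smul_mul_sum_smul (S := K) hπ.toOrthogonalIdempotents
          (fun i => (c i : K)) (fun i => (d i : K))).symm }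

theorem coe_torusHom {π : ι → Matrix (Fin n) (Fin n) K} (hπ : CompleteOrthogonalIdempotents π)
    (c : ι → Kˣ) : (torusHom hπ c : Matrix (Fin n) (Fin n) K) = ∑ i, (c i : K) • π i := rfl

theorem mul_torusHom {π : ι → Matrix (Fin n) (Fin n) K} (hπ : CompleteOrthogonalIdempotents π)
    (c : ι → Kˣ) (i : ι) : π i * (torusHom hπ c : Matrix (Fin n) (Fin n) K) = (c i : K) • π i := by
  classical
  rw [coe_torusHom, Finset.mul_sum, Finset.sum_eq_single i]
  · rw [mul_smul_comm, (hπ.idem i).eq]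
  · intro j _ hj; rw [mul_smul_comm, hπ.ortho hj.symm, smul_zero]
  · simp

end Block

/-! ### The homomorphism of a reductive group to its block scalar matrices. -/

section Datum

variable {n : ℕ} {K : Type*} [Field K] {H : Subgroup (GL (Fin n) K)} {ι : Type} [Fintype ι]
  {π : ι → Matrix (Fin n) (Fin n) K} {m : ι → ℕ} {N : ℕ}

/-- A central decomposition with exponents that make the block determinants into an `N`-th power
map on the block scalar matrices. -/
structure IsCentralDatum (H : Subgroup (GL (Fin n) K)) (π : ι → Matrix (Fin n) (Fin n) K)
    (m : ι → ℕ) (N : ℕ) : Prop extends IsCentralDecomposition H π where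
  pos : 0 < N
  trace : ∀ i, (m i : K) * (π i).trace = N
  det_pow : ∀ i (c : K), (c • π i + (1 - π i)).det ^ m i = c ^ N

theorem exists_centralDatum [CharZero K] [IsAlgClosed K]
    (hH : IsZariskiClosed K (H : Set (GL (Fin n) K))) (hr : HasTrivialUnipotentRadical H) :
    ∃ (ι : Type) (_ : Fintype ι) (π : ι → Matrix (Fin n) (Fin n) K) (m : ι → ℕ) (N : ℕ),
      IsCentralDatum H π m N := by
  obtain ⟨ι, _, π, hπ⟩ := exists_centralDecomposition hH hr
  choose d hd hd0 hdn hdet using fun i => exists_rank_of_idempotent (hπ.coi.idem i)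
  have hdvd : ∀ i, n.factorial / d i * d i = n.factorial := fun i =>
    Nat.div_mul_cancel (Nat.dvd_factorial
      (Nat.pos_of_ne_zero fun h => hπ.ne_zero i (hd0 i h)) (hdn i))
  -- Each block rank is between `1` and `n`, so `N = n!` is a common multiple of the ranks. The
  -- exponent of a block is `N` divided by its rank.
  refine ⟨ι, inferInstance, π, fun i => n.factorial / d i, n.factorial, hπ, n.factorial_pos,
    fun i => ?_, fun i c => ?_⟩
  · rw [hd]; exact_mod_cast hdvd i
  · rw [hdet, ← pow_mul, mul_comm, hdvd]

namespace IsCentralDatum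

variable (h : IsCentralDatum H π m N)

include h

theorem blockTrace_sum (c : ι → K) : blockTrace π m (∑ i, c i • π i) = (N : K) • ∑ i, c i • π i := by
  classical
  rw [blockTrace, Finset.smul_sum]
  refine Finset.sum_congr rfl fun i _ => ?_
  rw [Finset.mul_sum, Finset.sum_eq_single i]
  · rw [mul_smul_comm, (h.coi.idem i).eq, Matrix.trace_smul, ← h.trace i, smul_smul, smul_eq_mul]
    congr 1; ring
  · intro j _ hj; rw [mul_smul_comm, h.coi.ortho hj.symm, smul_zero]
  · simp

theorem trace_mul_sum (c : ι → K) (i : ι) : (π i * ∑ j, c j • π j).trace = c i * (π i).trace := by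
  classical
  rw [Finset.mul_sum, Finset.sum_eq_single i]
  · rw [mul_smul_comm, (h.coi.idem i).eq, Matrix.trace_smul, smul_eq_mul]
  · intro j _ hj; rw [mul_smul_comm, h.coi.ortho hj.symm, smul_zero]
  · simp

theorem trace_ne_zero [CharZero K] (i : ι) : (π i).trace ≠ 0 := by
  intro h0
  have := h.trace i
  rw [h0, mul_zero] at this
  exact h.pos.ne (by exact_mod_cast this)

theorem commute_map_inl {g : GL (Fin n) K} (hg : g ∈ H) (i : ι) :
    Commute ((π i).map (algebraMap K (DualNumber K)))
      ((g : Matrix (Fin n) (Fin n) K).map TrivSqZeroExt.inl) := by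
  rw [← map_algebraMap_dual]
  rw [Commute, SemiconjBy, map_algebraMap_mul, map_algebraMap_mul, (h.commute g hg i).eq]

omit h in
/-- The homomorphism given by `blockMap`. -/
def blockHom (h : IsCentralDatum H π m N) : H →* GL (Fin n) K :=
  MonoidHom.toHomUnits
    { toFun := fun g => blockMap π m ((g : GL (Fin n) K) : Matrix (Fin n) (Fin n) K)
      map_one' := blockMap_one h.coi m
      map_mul' := fun a _ => blockMap_mul h.coi.toOrthogonalIdempotents m
        (fun i => h.commute a a.2 i) _ }

theorem coe_blockHom (g : H) : (h.blockHom g : Matrix (Fin n) (Fin n) K) =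
    blockMap π m ((g : GL (Fin n) K) : Matrix (Fin n) (Fin n) K) := rfl

variable [CharZero K] [IsAlgClosed K]

/-- The differential kills `lieDerived` and multiplies the centre by `N`. -/
theorem blockTrace_mem (hH : IsZariskiClosed K (H : Set (GL (Fin n) K)))
    (hr : HasTrivialUnipotentRadical H) {x : Matrix (Fin n) (Fin n) K}
    (hx : x ∈ lieAlg (H : Set (GL (Fin n) K))) :
    blockTrace π m x ∈ lieAlg (H : Set (GL (Fin n) K)) := by
  obtain ⟨z, hz, d, hd, rfl⟩ := lieAlg_eq_add hH hr h.toIsCentralDecomposition hx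
  obtain ⟨c, hc⟩ := h.exists_eq z hz
  have h1 : blockTrace π m (z + d) = blockTrace π m z := by
    refine Finset.sum_congr rfl fun i _ => ?_
    rw [mul_add, Matrix.trace_add, trace_mul_lieDerived (fun g hg => h.commute g hg i) hd, add_zero]
  rw [h1, hc, h.blockTrace_sum, ← hc]
  exact Submodule.smul_mem _ _ hz.1

omit h [CharZero K] [IsAlgClosed K] in
theorem derivation_mem_span {R : Type*} [CommRing R] [Algebra K R] (D : Derivation K R R) {s : Set R}
    (hs : ∀ f ∈ s, D f ∈ Ideal.span s) {f : R} (hf : f ∈ Ideal.span s) : D f ∈ Ideal.span s := by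
  induction hf using Submodule.span_induction with
  | mem x hx => exact hs x hx
  | zero => simp
  | add x y _ _ hx hy => rw [map_add]; exact add_mem hx hy
  | smul a x hx h =>
    rw [smul_eq_mul, Derivation.leibniz]
    exact add_mem (Ideal.mul_mem_left _ _ h) (Ideal.mul_mem_right _ _ hx)

/-- The preimage of `H` under the homomorphism is a closed subgroup of `H`. Its equations are stable
under the Lie algebra, since the differential `blockTrace` preserves the Lie algebra, so the
preimage contains a neighbourhood of `1`; connectedness makes it all of `H`. -/
theorem blockHom_mem (hH : IsZariskiClosed K (H : Set (GL (Fin n) K)))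
    (hc : IsZariskiConnected H) (hr : HasTrivialUnipotentRadical H) (g : H) :
    h.blockHom g ∈ H := by
  let Δ := blockMap π m (genMat n K)
  let s : Set (MvPolynomial (Fin n × Fin n) K) :=
    {f | f ∈ vanIdeal (H : Set (GL (Fin n) K)) ∨ ∃ f' ∈ vanIdeal (H : Set (GL (Fin n) K)), f = evalMat Δ f'}
  have hvan : ∀ f ∈ vanIdeal (H : Set (GL (Fin n) K)), f ∈ Ideal.span s := fun f hf =>
    Ideal.subset_span (Or.inl hf)
  have hmem : ∀ x ∈ H, (∀ f ∈ Ideal.span s, evalMat (x : Matrix (Fin n) (Fin n) K) f = 0) →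
      x ∈ (H.comap h.blockHom).map H.subtype := by
    intro x hx hxf
    refine ⟨⟨x, hx⟩, (mem_iff_of_isZariskiClosed hH).2 fun f hf => ?_, rfl⟩
    rw [coe_blockHom, ← evalMat_blockMap_genMat]
    exact hxf _ (Ideal.subset_span (Or.inr ⟨f, hf, rfl⟩))
  have hle : (H.comap h.blockHom).map H.subtype ≤ H := by
    rintro _ ⟨x, -, rfl⟩; exact x.2
  have hzero : ∀ x ∈ (H.comap h.blockHom).map H.subtype, ∀ f ∈ s,
      evalMat (x : Matrix (Fin n) (Fin n) K) f = 0 := by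
    rintro _ ⟨x, hx, rfl⟩ f (hf | ⟨f, hf, rfl⟩)
    · exact hf x x.2
    · rw [evalMat_blockMap_genMat]
      have h1 := hf (h.blockHom x) hx
      rwa [coe_blockHom] at h1
  have hspan : ∀ x : GL (Fin n) K, (∀ f ∈ s, evalMat (x : Matrix (Fin n) (Fin n) K) f = 0) →
      ∀ f ∈ Ideal.span s, evalMat (x : Matrix (Fin n) (Fin n) K) f = 0 := by
    intro x hx f hf
    induction hf using Submodule.span_induction with
    | mem f hf => exact hx f hf
    | zero => exact map_zero _
    | add f g _ _ hf hg => rw [map_add, hf, hg, add_zero]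
    | smul a f _ hf => rw [smul_eq_mul, map_mul, hf, mul_zero]
  have hclosed : IsZariskiClosed K (((H.comap h.blockHom).map H.subtype :
      Subgroup (GL (Fin n) K)) : Set (GL (Fin n) K)) := by
    convert isZariskiClosed_setOf s using 1
    ext x
    refine ⟨fun hx f hf => hzero x hx f hf, fun hx => hmem x ?_ (hspan x hx)⟩
    exact (mem_iff_of_isZariskiClosed hH).2 fun f hf => hx f (Or.inl hf)
  have key : (H.comap h.blockHom).map H.subtype = H := by
    refine eq_of_stable hle hH hclosed hc (J := Ideal.span s) ?_ ?_ hmem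
    · refine Ideal.span_le.2 fun f hf => ?_
      have := hzero 1 (one_mem _) f hf
      exact this
    · intro x hx f hf
      refine derivation_mem_span (lieDer x) ?_ hf
      rintro f (hf | ⟨f, hf, rfl⟩)
      · exact hvan _ (lieDer_mem_vanIdeal hx hf)
      · have h2 : evalMat Δ (lieDer (blockTrace π m x) f) ∈ Ideal.span s :=
          Ideal.subset_span (Or.inr ⟨_, lieDer_mem_vanIdeal (h.blockTrace_mem hH hr hx) hf, rfl⟩)
        -- The chain rule for `Δ` is established only at points of `H`, where `Δ` is multiplicative.
        -- The error lies in the ideal of `H`, which is why `s` includes that ideal.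
        rw [← sub_add_cancel (lieDer x (evalMat Δ f)) (evalMat Δ (lieDer (blockTrace π m x) f))]
        refine add_mem (hvan _ fun g hg => ?_) h2
        rw [map_sub, evalMat_blockMap_genMat, sub_eq_zero]
        have h3 := evalMat_mul_dualMat (g : Matrix (Fin n) (Fin n) K) x (evalMat Δ f)
        rw [evalMat_blockMap_genMat, blockMap_mul h.coi.toOrthogonalIdempotents m
          (fun i => h.commute_map_inl hg i), blockMap_dualMat h.coi, ← map_inl_blockMap,
          evalMat_mul_dualMat] at h3
        have h4 := congrArg TrivSqZeroExt.snd h3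
        simpa using h4.symm
  obtain ⟨x, hx, hxg⟩ := key.ge g.2
  rwa [show x = g from Subtype.ext hxg] at hx

omit h in
/-- The kernel of `blockHom`, as a subgroup of the general linear group. -/
def blockKer (h : IsCentralDatum H π m N) : Subgroup (GL (Fin n) K) :=
  h.blockHom.ker.map H.subtype

omit [CharZero K] [IsAlgClosed K] in
theorem mem_blockKer {g : GL (Fin n) K} :
    g ∈ h.blockKer ↔ g ∈ H ∧ blockMap π m (g : Matrix (Fin n) (Fin n) K) = 1 := by
  constructor
  · rintro ⟨x, hx, rfl⟩
    exact ⟨x.2, congrArg Units.val (MonoidHom.mem_ker.1 hx)⟩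
  · rintro ⟨hg, h1⟩
    exact ⟨⟨g, hg⟩, MonoidHom.mem_ker.2 (Units.ext h1), rfl⟩

omit [CharZero K] [IsAlgClosed K] in
theorem blockKer_le : h.blockKer ≤ H := fun _ hg => (h.mem_blockKer.1 hg).1

-- The entries of `Δ - 1` vanish on the kernel; differentiating them gives `blockTrace π m x = 0`,
-- and the trace against `π i` isolates one block.
omit [IsAlgClosed K] in
theorem trace_eq_zero_of_mem_lieAlg_blockKer {x : Matrix (Fin n) (Fin n) K}
    (hx : x ∈ lieAlg (h.blockKer : Set (GL (Fin n) K))) (i : ι) : (π i * x).trace = 0 := by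
  have h1 : dualMat (blockTrace π m x) = 1 := by
    rw [← blockMap_dualMat h.coi]
    refine Matrix.ext fun k l => ?_
    have h2 : blockMap π m (genMat n K) k l - C ((1 : Matrix (Fin n) (Fin n) K) k l) ∈
        vanIdeal (h.blockKer : Set (GL (Fin n) K)) := by
      intro g hg
      have h3 := map_blockMap (evalMat (g : Matrix (Fin n) (Fin n) K)) π m (genMat n K)
      rw [genMat_map_evalMat, (h.mem_blockKer.1 hg).2] at h3
      have h4 := congrFun (congrFun h3 k) l
      rw [Matrix.map_apply] at h4
      rw [map_sub, h4, evalMat_C]; simp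
    have h3 := evalMat_dualMat_eq_zero hx h2
    have h4 := map_blockMap (evalMat (dualMat x)) π m (genMat n K)
    rw [genMat_map_evalMat] at h4
    rw [map_sub, sub_eq_zero, evalMat_C] at h3
    rw [← h4, Matrix.map_apply, h3]
    by_cases hkl : k = l
    · subst hkl; rw [Matrix.one_apply_eq, Matrix.one_apply_eq, map_one]
    · rw [Matrix.one_apply_ne hkl, Matrix.one_apply_ne hkl, map_zero]
  have h2 : blockTrace π m x = 0 := by
    ext k l
    have := congrArg TrivSqZeroExt.snd (congrFun (congrFun h1 k) l)
    by_cases hkl : k = l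
    · subst hkl; simpa [dualMat, Matrix.one_apply_eq] using this
    · simpa [dualMat, Matrix.one_apply_ne hkl] using this
  have h3 := h.trace_mul_sum (fun i => (m i : K) * (π i * x).trace) i
  rw [show ∑ j, ((m j : K) * (π j * x).trace) • π j = 0 from h2, mul_zero, Matrix.trace_zero,
    mul_assoc, mul_comm, mul_assoc, mul_comm (π i).trace, h.trace] at h3
  refine (mul_eq_zero.1 h3.symm).resolve_right ?_
  exact_mod_cast h.pos.ne'

/-- Only the central component contributes to the block traces, and it is determined by them. -/
theorem mem_lieDerived (hH : IsZariskiClosed K (H : Set (GL (Fin n) K)))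
    (hr : HasTrivialUnipotentRadical H) {x : Matrix (Fin n) (Fin n) K}
    (hx : x ∈ lieAlg (H : Set (GL (Fin n) K))) (htr : ∀ i, (π i * x).trace = 0) :
    x ∈ lieDerived H := by
  obtain ⟨z, hz, d, hd, rfl⟩ := lieAlg_eq_add hH hr h.toIsCentralDecomposition hx
  obtain ⟨c, hc⟩ := h.exists_eq z hz
  have h0 : z = 0 := by
    rw [hc]
    refine Finset.sum_eq_zero fun i _ => ?_
    have h1 := htr i
    rw [mul_add, Matrix.trace_add, trace_mul_lieDerived (fun g hg => h.commute g hg i) hd, add_zero,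
      hc, h.trace_mul_sum] at h1
    rw [(mul_eq_zero.1 h1).resolve_right (h.trace_ne_zero i), zero_smul]
  rwa [h0, zero_add]

end IsCentralDatum

end Datum

/-! ### Zariski closure and the Lie algebra of the commutator subgroup. -/

section Closure

variable {n : ℕ} {K : Type*} [Field K]

/-- A polynomial in the entries of `P(a) * a⁻¹` is a polynomial in the entries of `a`, up to a power
of the determinant. -/
theorem exists_det_pow_mul (P : Matrix (Fin n) (Fin n) (MvPolynomial (Fin n × Fin n) K))
    (f : MvPolynomial (Fin n × Fin n) K) :
    ∃ (N : ℕ) (F : MvPolynomial (Fin n × Fin n) K), ∀ (S : Type _) [CommRing S] [Algebra K S]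
      (a b : Matrix (Fin n) (Fin n) S), a * b = 1 →
        evalMat a F = a.det ^ N * evalMat (P.map (evalMat a) * b) f := by
  induction f using MvPolynomial.induction_on with
  | C c => exact ⟨0, C c, fun S _ _ a b _ => by simp⟩
  | add p q hp hq =>
    obtain ⟨N, F, hF⟩ := hp
    obtain ⟨M, G, hG⟩ := hq
    refine ⟨N + M, F * (genMat n K).det ^ M + G * (genMat n K).det ^ N, fun S _ _ a b hab => ?_⟩
    rw [map_add, map_mul, map_mul, hF S a b hab, hG S a b hab, map_pow, map_pow, AlgHom.map_det,
      AlgHom.mapMatrix_apply, genMat_map_evalMat, map_add]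
    ring
  | mul_X p ij hp =>
    obtain ⟨N, F, hF⟩ := hp
    refine ⟨N + 1, F * (P * (genMat n K).adjugate) ij.1 ij.2, fun S _ _ a b hab => ?_⟩
    have h1 : (P * (genMat n K).adjugate).map (evalMat a) = P.map (evalMat a) * a.adjugate := by
      rw [map_mul_evalMat, ← AlgHom.mapMatrix_apply _ (genMat n K).adjugate, AlgHom.map_adjugate,
        AlgHom.mapMatrix_apply, genMat_map_evalMat]
    have h2 : a.adjugate = a.det • b := by
      calc a.adjugate = a.adjugate * (a * b) := by rw [hab, mul_one]
        _ = a.det • b := by rw [← mul_assoc, Matrix.adjugate_mul, smul_mul_assoc, one_mul]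
    have h3 := congrFun (congrFun h1 ij.1) ij.2
    rw [Matrix.map_apply, h2, mul_smul_comm, Matrix.smul_apply, smul_eq_mul] at h3
    rw [map_mul, hF S a b hab, map_mul, evalMat_X, h3]
    ring

/-- The Zariski closure of a subgroup. -/
def zariskiClosure (D : Subgroup (GL (Fin n) K)) : Subgroup (GL (Fin n) K) where
  carrier := {g | ∀ f ∈ vanIdeal (D : Set (GL (Fin n) K)),
    evalMat (g : Matrix (Fin n) (Fin n) K) f = 0}
  one_mem' f hf := hf 1 D.one_mem
  mul_mem' := by
    intro a b ha hb f hf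
    have h1 : ∀ d ∈ D, evalMat ((d : Matrix (Fin n) (Fin n) K) * (b : Matrix (Fin n) (Fin n) K)) f = 0 := by
      intro d hd
      rw [← evalMat_translate]
      refine hb _ fun e he => ?_
      rw [evalMat_translate, ← Units.val_mul]
      exact hf _ (D.mul_mem hd he)
    have h2 : ∀ c : Matrix (Fin n) (Fin n) K,
        evalMat c (evalMat (genMat n K * constMat (b : Matrix (Fin n) (Fin n) K)) f) =
          evalMat (c * (b : Matrix (Fin n) (Fin n) K)) f := by
      intro c
      rw [evalMat_map, map_mul_evalMat, constMat_map_evalMat, genMat_map_evalMat]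
    rw [Units.val_mul, ← h2]
    exact ha _ fun d hd => by rw [h2]; exact h1 d hd
  inv_mem' := by
    intro a ha f hf
    obtain ⟨N, F, hF⟩ := exists_det_pow_mul 1 f
    have h1 : ∀ c : GL (Fin n) K, evalMat (c : Matrix (Fin n) (Fin n) K) F =
        (c : Matrix (Fin n) (Fin n) K).det ^ N *
          evalMat ((c⁻¹ : GL (Fin n) K) : Matrix (Fin n) (Fin n) K) f := by
      intro c
      rw [hF K _ ((c⁻¹ : GL (Fin n) K) : Matrix (Fin n) (Fin n) K) (by rw [← Units.val_mul]; simp),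
        Matrix.map_one _ (map_zero _) (map_one _), one_mul]
    have h2 := ha F fun d hd => by rw [h1, hf _ (D.inv_mem hd), mul_zero]
    rw [h1] at h2
    exact (mul_eq_zero.1 h2).resolve_left (pow_ne_zero _ ((Matrix.isUnit_iff_isUnit_det _).1 a.isUnit).ne_zero)

theorem zariskiClosure_le {D A : Subgroup (GL (Fin n) K)} (hDA : D ≤ A)
    (hA : IsZariskiClosed K (A : Set (GL (Fin n) K))) : zariskiClosure D ≤ A := fun _ hg =>
  (mem_iff_of_isZariskiClosed hA).2 fun f hf => hg f (vanIdeal_anti hDA hf)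

/-- The map `c ↦ g c g⁻¹ c⁻¹` sends `H` to `[H,H]` and has differential `y ↦ g y g⁻¹ - y` at the
identity. The inverse introduces a power of the determinant as denominator; it is cleared to get a
polynomial and is a unit at `1 + εy`. -/
theorem lieDerived_le (H : Subgroup (GL (Fin n) K)) :
    lieDerived H ≤ lieAlg ((⁅H, H⁆ : Subgroup (GL (Fin n) K)) : Set (GL (Fin n) K)) := by
  refine Submodule.span_le.2 ?_
  rintro _ ⟨g, hg, y, hy, rfl⟩
  refine mem_lieAlg_of_dualMat fun f hf => ?_
  have hgg : (g : Matrix (Fin n) (Fin n) K) * ((g⁻¹ : GL (Fin n) K) : Matrix (Fin n) (Fin n) K) = 1 := by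
    rw [← Units.val_mul]; simp
  let P : Matrix (Fin n) (Fin n) (MvPolynomial (Fin n × Fin n) K) :=
    constMat (g : Matrix (Fin n) (Fin n) K) * genMat n K *
      constMat ((g⁻¹ : GL (Fin n) K) : Matrix (Fin n) (Fin n) K)
  obtain ⟨N, F, hF⟩ := exists_det_pow_mul P f
  have hFH : F ∈ vanIdeal (H : Set (GL (Fin n) K)) := by
    intro c hc
    rw [hF K _ ((c⁻¹ : GL (Fin n) K) : Matrix (Fin n) (Fin n) K) (by rw [← Units.val_mul]; simp),
      map_mul_evalMat, map_mul_evalMat, constMat_map_evalMat, constMat_map_evalMat,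
      genMat_map_evalMat, ← Units.val_mul, ← Units.val_mul, ← Units.val_mul]
    have h0 := hf _ (Subgroup.commutator_mem_commutator hg hc)
    rw [commutatorElement_def] at h0
    rw [h0, mul_zero]
  have h1 := evalMat_dualMat_eq_zero hy hFH
  have hconst : ∀ c : Matrix (Fin n) (Fin n) K,
      (constMat c).map (evalMat (dualMat y)) = c.map TrivSqZeroExt.inl := by
    intro c; ext i j <;> simp [constMat] <;> rfl
  rw [hF (DualNumber K) (dualMat y) (dualMat (-y)) (by rw [dualMat_mul, add_neg_cancel, dualMat_zero]),
    map_mul_evalMat, map_mul_evalMat, genMat_map_evalMat, hconst, hconst, conj_dualMat hgg,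
    dualMat_mul, ← sub_eq_add_neg] at h1
  have hu : IsUnit ((dualMat y).det ^ N) := by
    refine IsUnit.pow _ ?_
    refine IsUnit.of_mul_eq_one (dualMat (-y)).det ?_
    rw [← Matrix.det_mul, dualMat_mul, add_neg_cancel, dualMat_zero, Matrix.det_one]
  exact (hu.mul_right_eq_zero).1 h1

end Closure

/-! ### Three finiteness statements over the algebraically closed field. -/

section Finiteness

variable {n : ℕ} {K : Type*} [Field K] {H : Subgroup (GL (Fin n) K)} {ι : Type} [Fintype ι]
  {π : ι → Matrix (Fin n) (Fin n) K} {m : ι → ℕ} {N : ℕ} [CharZero K] [IsAlgClosed K]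

namespace IsCentralDatum

variable (h : IsCentralDatum H π m N)

include h

/-- Block traces vanish on the Lie algebra of the kernel, so it lies in `lieDerived` and thus in the
Lie algebra of `[H,H]`. The ideal of `[H,H]` is then stable under it. -/
theorem relIndex_zariskiClosure_ne_zero (hH : IsZariskiClosed K (H : Set (GL (Fin n) K)))
    (hr : HasTrivialUnipotentRadical H) : (zariskiClosure ⁅H, H⁆).relIndex h.blockKer ≠ 0 := by
  refine relIndex_ne_zero_of_stable (J := vanIdeal ((⁅H, H⁆ : Subgroup (GL (Fin n) K)) : Set (GL (Fin n) K)))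
    (fun f hf => hf 1 (one_mem _)) (fun x hx f hf => lieDer_mem_vanIdeal (lieDerived_le H ?_) hf)
    (fun x _ hx => hx)
  exact h.mem_lieDerived hH hr (lieAlg_mono h.blockKer_le hx)
    (h.trace_eq_zero_of_mem_lieAlg_blockKer hx)

-- The `N`-th power map has differential `N` at the identity. If `x` is tangent to the block scalars
-- whose `N`-th power is in `H`, then `N x`, hence `x`, is tangent to `H`.
omit [IsAlgClosed K] in
theorem relIndex_torus_ne_zero (hH : IsZariskiClosed K (H : Set (GL (Fin n) K))) :
    (H.comap (torusHom h.coi)).relIndex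
      (H.comap ((torusHom h.coi).comp (powMonoidHom N))) ≠ 0 := by
  rw [Subgroup.relIndex_comap]
  refine relIndex_ne_zero_of_stable (J := vanIdeal (H : Set (GL (Fin n) K)))
    (fun f hf => hf 1 (one_mem _)) (fun x hx f hf => lieDer_mem_vanIdeal ?_ hf)
    (fun x _ hx => (mem_iff_of_isZariskiClosed hH).2 hx)
  have hN : (N : K) ≠ 0 := by exact_mod_cast h.pos.ne'
  rw [← inv_smul_smul₀ hN x]
  refine Submodule.smul_mem _ _ (mem_lieAlg_of_dualMat fun f hf => ?_)
  have hmap : ∀ (S : Type _) [CommRing S] [Algebra K S] (a : Matrix (Fin n) (Fin n) S),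
      evalMat a (evalMat (genMat n K ^ N) f) = evalMat (a ^ N) f := by
    intro S _ _ a
    rw [evalMat_map, ← AlgHom.mapMatrix_apply, map_pow, AlgHom.mapMatrix_apply, genMat_map_evalMat]
  rw [← dualMat_pow, ← hmap]
  refine evalMat_dualMat_eq_zero hx ?_
  rintro _ ⟨c, hc, rfl⟩
  rw [hmap, ← Units.val_pow_eq_pow_val, ← map_pow]
  exact hf _ hc

-- An element of the Lie algebra is central with all block traces zero, hence zero. The maximal
-- ideal of the identity is then trivially stable, and the trivial subgroup has finite index.
omit [IsAlgClosed K] in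
theorem finite_blockKer_inf_centralizer :
    Finite (h.blockKer ⊓ Subgroup.centralizer (H : Set (GL (Fin n) K)) :
      Subgroup (GL (Fin n) K)) := by
  set A := h.blockKer ⊓ Subgroup.centralizer (H : Set (GL (Fin n) K)) with hA
  have hlie : ∀ x ∈ lieAlg (A : Set (GL (Fin n) K)), x = 0 := by
    intro x hx
    have hxk : x ∈ lieAlg (h.blockKer : Set (GL (Fin n) K)) := lieAlg_mono (fun g hg => hg.1) hx
    have hxz : x ∈ lieCenter H := by
      refine ⟨lieAlg_mono h.blockKer_le hxk, fun g hg => (lieAlg_commute hx fun a ha => ?_).symm⟩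
      have := Subgroup.mem_centralizer_iff.1 ha.2 g hg
      exact congrArg Units.val this
    obtain ⟨c, hc⟩ := h.exists_eq x hxz
    rw [hc]
    refine Finset.sum_eq_zero fun i _ => ?_
    have h1 := h.trace_eq_zero_of_mem_lieAlg_blockKer hxk i
    rw [hc, h.trace_mul_sum] at h1
    rw [(mul_eq_zero.1 h1).resolve_right (h.trace_ne_zero i), zero_smul]
  have h1 : (⊥ : Subgroup (GL (Fin n) K)).relIndex A ≠ 0 := by
    refine relIndex_ne_zero_of_stable (J := idealOne n K) le_rfl (fun x hx f hf => ?_)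
      (fun x _ hx => ?_)
    · rw [hlie x hx, lieDer_zero]; simp
    · refine Subgroup.mem_bot.2 (Units.ext (Matrix.ext fun i j => ?_))
      have := hx (X (i, j) - C ((1 : Matrix (Fin n) (Fin n) K) i j)) (by simp [mem_idealOne])
      simpa [sub_eq_zero] using this
  rw [Subgroup.relIndex_bot_left] at h1
  exact Nat.finite_of_card_ne_zero h1

end IsCentralDatum

end Finiteness

end LinAlgGroup
end

noncomputable section

/-! ### Finiteness of the group of `m`-th power classes of a local field. -/

section LocalField

/-- In characteristic zero the `m`-th power map has nonzero derivative at `1`, so it is open there.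
-/
theorem exists_pos_ball_subset_pow {E : Type*} [NontriviallyNormedField E] [CompleteSpace E]
    [CharZero E] {m : ℕ} (hm : m ≠ 0) : ∃ r > 0, ∀ y : E, ‖y - 1‖ < r → ∃ x, x ^ m = y := by
  have h1 : HasStrictDerivAt (fun x : E => x ^ m) ((m : E) * 1 ^ (m - 1)) 1 :=
    hasStrictDerivAt_pow m 1
  have h2 := h1.map_nhds_eq (by simpa using hm)
  have h3 : Set.range (fun x : E => x ^ m) ∈ nhds ((1 : E) ^ m) := by
    rw [← h2]; exact Filter.range_mem_map
  rw [one_pow] at h3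
  obtain ⟨r, hr, h⟩ := Metric.mem_nhds_iff.1 h3
  exact ⟨r, hr, fun y hy => h (by rwa [Metric.mem_ball, dist_eq_norm])⟩

/-- Multiplication by powers of `w^m` brings every unit into the compact annulus `1 ≤ ‖y‖ ≤ ‖w^m‖`.
A ball about `y` of radius proportional to `‖y‖` lies in one class modulo `m`-th powers, and
finitely many such balls cover the annulus. -/
theorem index_range_pow_ne_zero_of_properSpace {E : Type*} [NontriviallyNormedField E]
    [ProperSpace E] [CharZero E] {m : ℕ} (hm : m ≠ 0) :
    (powMonoidHom m : Eˣ →* Eˣ).range.index ≠ 0 := by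
  obtain ⟨r, hr, hpow⟩ := exists_pos_ball_subset_pow (E := E) hm
  obtain ⟨w, hw⟩ := NormedField.exists_one_lt_norm E
  have hw0 : w ≠ 0 := by rintro rfl; simp at hw; linarith
  have hwm : 1 < ‖w ^ m‖ := by rw [norm_pow]; exact one_lt_pow₀ hw hm
  let A : Set E := {y | 1 ≤ ‖y‖} ∩ Metric.closedBall 0 ‖w ^ m‖
  have hA : IsCompact A :=
    (isCompact_closedBall _ _).inter_left (isClosed_le continuous_const continuous_norm)
  have hcov : A ⊆ ⋃ y : Eˣ, Metric.ball (y : E) (r * ‖(y : E)‖) := by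
    intro y hy
    have hy0 : y ≠ 0 := by
      rintro rfl; have := hy.1; simp at this; linarith
    refine Set.mem_iUnion.2 ⟨Units.mk0 y hy0, Metric.mem_ball_self ?_⟩
    exact mul_pos hr (norm_pos_iff.2 hy0)
  obtain ⟨t, ht⟩ := hA.elim_finite_subcover _ (fun _ => Metric.isOpen_ball) hcov
  have hfin : Finite (Eˣ ⧸ (powMonoidHom m : Eˣ →* Eˣ).range) := by
    refine Finite.of_surjective (fun y : t => ((y : Eˣ) : Eˣ ⧸ (powMonoidHom m : Eˣ →* Eˣ).range)) ?_
    intro q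
    obtain ⟨x, rfl⟩ := QuotientGroup.mk_surjective q
    obtain ⟨k, hk1, hk2⟩ := exists_mem_Ico_zpow (norm_pos_iff.2 x.ne_zero) hwm
    let W : Eˣ := Units.mk0 w hw0
    have hW : (W : E) = w := rfl
    have hpos : 0 < ‖w ^ m‖ ^ k := zpow_pos (by linarith) k
    have hz : ((x * (W ^ k)⁻¹ ^ m : Eˣ) : E) ∈ A := by
      have hn : ‖((x * (W ^ k)⁻¹ ^ m : Eˣ) : E)‖ = ‖(x : E)‖ / ‖w ^ m‖ ^ k := by
        rw [Units.val_mul, norm_mul, Units.val_pow_eq_pow_val, Units.val_inv_eq_inv_val,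
          Units.val_zpow_eq_zpow_val, hW, div_eq_mul_inv]
        congr 1
        rw [norm_pow, norm_inv, norm_zpow, norm_pow, inv_pow, ← zpow_natCast, ← zpow_natCast,
          ← _root_.zpow_mul, ← _root_.zpow_mul, mul_comm]
      refine ⟨?_, ?_⟩
      · rw [Set.mem_ofPred_eq, hn, le_div_iff₀ hpos, one_mul]; exact hk1
      · rw [mem_closedBall_zero_iff, hn, div_le_iff₀ hpos, ← zpow_one_add₀ (by linarith), add_comm]
        exact hk2.le
    obtain ⟨y, hyt, hy⟩ := Set.mem_iUnion₂.1 (ht hz)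
    refine ⟨⟨y, hyt⟩, QuotientGroup.eq.2 ?_⟩
    rw [Metric.mem_ball, dist_eq_norm] at hy
    have hyn : 0 < ‖(y : E)‖ := norm_pos_iff.2 y.ne_zero
    obtain ⟨u, hu⟩ := hpow ((y : E)⁻¹ * ((x * (W ^ k)⁻¹ ^ m : Eˣ) : E)) (by
      rw [show (y : E)⁻¹ * ((x * (W ^ k)⁻¹ ^ m : Eˣ) : E) - 1 =
        (y : E)⁻¹ * (((x * (W ^ k)⁻¹ ^ m : Eˣ) : E) - y) by
          rw [mul_sub, inv_mul_cancel₀ y.ne_zero], norm_mul, norm_inv, inv_mul_lt_iff₀ hyn, mul_comm _ r]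
      exact hy)
    have hu0 : u ≠ 0 := by
      rintro rfl
      rw [zero_pow hm] at hu
      exact mul_ne_zero (inv_ne_zero y.ne_zero) (Units.ne_zero _) hu.symm
    refine ⟨Units.mk0 u hu0 * W ^ k, ?_⟩
    have h1 : Units.mk0 u hu0 ^ m = y⁻¹ * (x * (W ^ k)⁻¹ ^ m) := by
      ext
      rw [Units.val_pow_eq_pow_val, Units.val_mk0, hu, Units.val_mul y⁻¹, Units.val_inv_eq_inv_val]
    rw [powMonoidHom_apply, mul_pow, h1, inv_pow]
    simp [mul_assoc]
  rw [Subgroup.index]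
  exact Nat.card_pos.ne'

theorem index_range_pow_ne_zero (p : ℕ) [Fact p.Prime] (E : Type*) [Field E] [Algebra ℚ_[p] E]
    [FiniteDimensional ℚ_[p] E] {m : ℕ} (hm : m ≠ 0) :
    (powMonoidHom m : Eˣ →* Eˣ).range.index ≠ 0 := by
  let _ : NontriviallyNormedField E := spectralNorm.nontriviallyNormedField ℚ_[p] E
  let _ : NormedSpace ℚ_[p] E := spectralNorm.normedSpace ℚ_[p] E
  have : ProperSpace E := FiniteDimensional.proper ℚ_[p] E
  have : CharZero E := charZero_of_injective_algebraMap (algebraMap ℚ_[p] E).injective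
  exact index_range_pow_ne_zero_of_properSpace hm

end LocalField

end

noncomputable section

theorem Subgroup.exists_mul_eq_of_mem_sup {Γ : Type*} [Group Γ] {A B : Subgroup Γ}
    (h : ∀ a ∈ A, ∀ b ∈ B, a * b = b * a) {g : Γ} (hg : g ∈ A ⊔ B) :
    ∃ a ∈ A, ∃ b ∈ B, a * b = g := by
  let C : Subgroup Γ :=
    { carrier := {g | ∃ a ∈ A, ∃ b ∈ B, a * b = g}
      one_mem' := ⟨1, A.one_mem, 1, B.one_mem, one_mul 1⟩
      mul_mem' := by
        rintro _ _ ⟨a, ha, b, hb, rfl⟩ ⟨a', ha', b', hb', rfl⟩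
        refine ⟨a * a', A.mul_mem ha ha', b * b', B.mul_mem hb hb', ?_⟩
        rw [mul_assoc, ← mul_assoc a', h a' ha' b hb, mul_assoc, mul_assoc]
      inv_mem' := by
        rintro _ ⟨a, ha, b, hb, rfl⟩
        refine ⟨a⁻¹, A.inv_mem ha, b⁻¹, B.inv_mem hb, ?_⟩
        rw [h _ (A.inv_mem ha) _ (B.inv_mem hb), _root_.mul_inv_rev] }
  have hAB : A ⊔ B ≤ C :=
    sup_le (fun a ha => ⟨a, ha, 1, B.one_mem, mul_one a⟩) fun b hb => ⟨1, A.one_mem, b, hb, one_mul b⟩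
  exact hAB hg

namespace LinAlgGroup

open MvPolynomial

/-! ### The Galois action on matrix groups. -/

section Galois

variable {n : ℕ} {F K : Type*} [Field F] [Field K] [Algebra F K]

theorem IsZariskiClosed.extend {A : Set (GL (Fin n) K)} (hA : IsZariskiClosed F A) :
    IsZariskiClosed K A := by
  obtain ⟨I, rfl⟩ := hA
  refine ⟨MvPolynomial.map (algebraMap F K) '' I, ?_⟩
  ext g
  simp only [Set.mem_ofPred_eq, Set.forall_mem_image, MvPolynomial.aeval_map_algebraMap]

/-- The action of an automorphism on the general linear group. -/
def galMap (τ : K ≃ₐ[F] K) : GL (Fin n) K →* GL (Fin n) K :=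
  Matrix.GeneralLinearGroup.map (τ : K →+* K)

theorem coe_galMap (τ : K ≃ₐ[F] K) (g : GL (Fin n) K) :
    (galMap τ g : Matrix (Fin n) (Fin n) K) = (g : Matrix (Fin n) (Fin n) K).map τ := rfl

theorem galMap_apply (τ : K ≃ₐ[F] K) (g : GL (Fin n) K) (i j : Fin n) :
    (galMap τ g : Matrix (Fin n) (Fin n) K) i j = τ ((g : Matrix (Fin n) (Fin n) K) i j) := rfl

theorem galMap_galMap_symm (τ : K ≃ₐ[F] K) (g : GL (Fin n) K) : galMap τ (galMap τ.symm g) = g := by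
  ext i j; simp [galMap_apply]

theorem galMap_map (τ : K ≃ₐ[F] K) (g : GL (Fin n) F) :
    galMap τ (Matrix.GeneralLinearGroup.map (algebraMap F K) g) =
      Matrix.GeneralLinearGroup.map (algebraMap F K) g := by
  ext i j; simp [galMap_apply]

theorem galMap_mem {H : Subgroup (GL (Fin n) K)} (hH : IsZariskiClosed F (H : Set (GL (Fin n) K)))
    (τ : K ≃ₐ[F] K) {g : GL (Fin n) K} (hg : g ∈ H) : galMap τ g ∈ H := by
  obtain ⟨I, hI⟩ := hH
  have hg' : g ∈ (H : Set (GL (Fin n) K)) := hg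
  change galMap τ g ∈ (H : Set (GL (Fin n) K))
  rw [hI] at hg' ⊢
  intro f hf
  have h1 := congrArg τ (hg' f hf)
  rw [map_zero] at h1
  rw [← h1]
  have := MvPolynomial.comp_aeval_apply (R := F)
    (fun ij : Fin n × Fin n => (g : Matrix (Fin n) (Fin n) K) ij.1 ij.2) (τ : K →ₐ[F] K) f
  exact this.symm

theorem map_evalMat_equiv (τ : K ≃ₐ[F] K) (g : Matrix (Fin n) (Fin n) K)
    (f : MvPolynomial (Fin n × Fin n) K) :
    evalMat (g.map τ) (MvPolynomial.map (τ : K →+* K) f) = τ (evalMat g f) := by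
  induction f using MvPolynomial.induction_on with
  | C a => simp
  | add p q hp hq => simp only [map_add, hp, hq]
  | mul_X p ij hp => simp only [map_mul, hp, MvPolynomial.map_X, evalMat_X, Matrix.map_apply]

theorem galMap_mem_zariskiClosure {D : Subgroup (GL (Fin n) K)}
    (hD : ∀ (τ : K ≃ₐ[F] K), ∀ d ∈ D, galMap τ d ∈ D) (τ : K ≃ₐ[F] K) {g : GL (Fin n) K}
    (hg : g ∈ zariskiClosure D) : galMap τ g ∈ zariskiClosure D := by
  intro f hf
  have h1 : MvPolynomial.map (τ.symm : K →+* K) f ∈ vanIdeal (D : Set (GL (Fin n) K)) := by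
    intro d hd
    have h2 := map_evalMat_equiv τ.symm ((galMap τ d : GL (Fin n) K) : Matrix (Fin n) (Fin n) K) f
    rw [hf _ (hD τ d hd), map_zero] at h2
    rw [← h2]
    congr 2
    ext i j; simp [galMap_apply]
  have h2 := map_evalMat_equiv τ (g : Matrix (Fin n) (Fin n) K) (MvPolynomial.map (τ.symm : K →+* K) f)
  rw [hg _ h1, map_zero, MvPolynomial.map_map] at h2
  rw [← h2, coe_galMap]
  congr 2
  have : (τ : K →+* K).comp (τ.symm : K →+* K) = RingHom.id K := by
    ext x; simp
  rw [this, MvPolynomial.map_id]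

theorem galMap_mem_commutator {H : Subgroup (GL (Fin n) K)}
    (hH : IsZariskiClosed F (H : Set (GL (Fin n) K))) (τ : K ≃ₐ[F] K) {g : GL (Fin n) K}
    (hg : g ∈ ⁅H, H⁆) : galMap τ g ∈ ⁅H, H⁆ := by
  have h1 : H.map (galMap τ) ≤ H := by
    rintro _ ⟨x, hx, rfl⟩; exact galMap_mem hH τ hx
  have h2 : ⁅H, H⁆.map (galMap τ) ≤ ⁅H, H⁆ := by
    rw [Subgroup.map_commutator]; exact Subgroup.commutator_mono h1 h1
  exact h2 ⟨g, hg, rfl⟩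

theorem exists_map_eq_of_fixed [IsGalois F K] {w : GL (Fin n) K}
    (hw : ∀ τ : K ≃ₐ[F] K, galMap τ w = w) :
    ∃ w₀ : GL (Fin n) F, Matrix.GeneralLinearGroup.map (algebraMap F K) w₀ = w := by
  have key : ∀ w : GL (Fin n) K, (∀ τ : K ≃ₐ[F] K, galMap τ w = w) →
      ∃ a : Matrix (Fin n) (Fin n) F, a.map (algebraMap F K) = w := by
    intro w hw
    have h1 : ∀ i j, ∃ x : F, algebraMap F K x = (w : Matrix (Fin n) (Fin n) K) i j := by
      intro i j
      refine (InfiniteGalois.mem_range_algebraMap_iff_fixed _).2 fun τ => ?_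
      have := congrArg (fun g : GL (Fin n) K => (g : Matrix (Fin n) (Fin n) K) i j) (hw τ)
      exact this
    choose a ha using h1
    exact ⟨a, by ext i j; exact ha i j⟩
  obtain ⟨a, ha⟩ := key w hw
  obtain ⟨b, hb⟩ := key w⁻¹ fun τ => by rw [map_inv, hw]
  have hinj : Function.Injective fun x : Matrix (Fin n) (Fin n) F => x.map (algebraMap F K) :=
    Matrix.map_injective (algebraMap F K).injective
  refine ⟨⟨a, b, hinj ?_, hinj ?_⟩, Units.ext ha⟩
  · simp only [Matrix.map_mul, ha, hb]
    rw [← Units.val_mul]; simp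
  · simp only [Matrix.map_mul, ha, hb]
    rw [← Units.val_mul]; simp

theorem det_mem_intermediateField {E : IntermediateField F K} {a : Matrix (Fin n) (Fin n) K}
    (h : ∀ i j, a i j ∈ E) : a.det ∈ E := by
  let a' : Matrix (Fin n) (Fin n) E := fun i j => ⟨a i j, h i j⟩
  have : a.det = E.val a'.det := by
    rw [AlgHom.map_det]; rfl
  rw [this]; exact a'.det.2

end Galois

/-! ### Rational points: the centre and `G` generate a subgroup of finite index. -/

section Points

variable {n : ℕ} {F K : Type*} [Field F] [Field K] [Algebra F K]
  {H G : Subgroup (GL (Fin n) K)} {ι : Type} [Fintype ι]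
  {π : ι → Matrix (Fin n) (Fin n) K} {m : ι → ℕ} {N : ℕ}

/-- The inclusion of the points over the small field. -/
def pointsHom (H : Subgroup (GL (Fin n) K)) : points F H →* GL (Fin n) K :=
  (Matrix.GeneralLinearGroup.map (algebraMap F K)).comp (points F H).subtype

theorem pointsHom_mem (h : points F H) : pointsHom H h ∈ H := h.2

theorem pointsHom_injective : Function.Injective (pointsHom (F := F) H) := by
  intro a b hab
  refine Subtype.ext (Units.ext (Matrix.ext fun i j => (algebraMap F K).injective ?_))
  exact congrArg (fun g : GL (Fin n) K => (g : Matrix (Fin n) (Fin n) K) i j) hab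

theorem pointsHom_apply (h : points F H) (i j : Fin n) :
    (pointsHom H h : Matrix (Fin n) (Fin n) K) i j =
      algebraMap F K (((h : GL (Fin n) F) : Matrix (Fin n) (Fin n) F) i j) := rfl

namespace IsCentralDatum

/-- The block scalar matrices with coefficients in a subfield. -/
def subTorusHom (h : IsCentralDatum H π m N) (E : IntermediateField F K) :
    (ι → Eˣ) →* GL (Fin n) K :=
  (torusHom h.coi).comp
    (MonoidHom.compLeft (Units.map (algebraMap E K : E →* K)) ι)

variable (h : IsCentralDatum H π m N) {E : IntermediateField F K} (hE : ∀ i a b, π i a b ∈ E)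

include h

theorem coe_subTorusHom (c : ι → Eˣ) : (h.subTorusHom E c : Matrix (Fin n) (Fin n) K) =
    ∑ i, ((c i : E) : K) • π i := rfl

theorem blockKer_commute_torus {g : GL (Fin n) K} (hg : g ∈ H) (c : ι → Kˣ) :
    torusHom h.coi c * g = g * torusHom h.coi c := by
  refine Units.ext ?_
  rw [Units.val_mul, Units.val_mul, coe_torusHom, Finset.sum_mul, Finset.mul_sum]
  refine Finset.sum_congr rfl fun i _ => ?_
  rw [smul_mul_assoc, mul_smul_comm, (h.commute g hg i).eq]

theorem blockDet_torusHom_pow (c : ι → Kˣ) (i : ι) :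
    blockDet (π i) (torusHom h.coi c : Matrix (Fin n) (Fin n) K) ^ m i = (c i : K) ^ N := by
  rw [blockDet, map_algebraMap_self, mul_torusHom, h.det_pow]

omit h in
/-- The elements of the group that are block scalar over a subfield. -/
def subCenter (h : IsCentralDatum H π m N) (E : IntermediateField F K) : Subgroup (GL (Fin n) K) :=
  (H.comap (h.subTorusHom E)).map (h.subTorusHom E)

theorem subCenter_le : h.subCenter E ≤ H := by
  rintro _ ⟨c, hc, rfl⟩; exact hc

theorem subCenter_commute {a g : GL (Fin n) K} (ha : a ∈ h.subCenter E) (hg : g ∈ H) :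
    a * g = g * a := by
  obtain ⟨c, -, rfl⟩ := ha
  exact h.blockKer_commute_torus hg _

include hE

theorem subCenter_entry_mem {a : GL (Fin n) K} (ha : a ∈ h.subCenter E) (i j : Fin n) :
    (a : Matrix (Fin n) (Fin n) K) i j ∈ E := by
  obtain ⟨c, -, rfl⟩ := ha
  rw [coe_subTorusHom, Matrix.sum_apply]
  exact sum_mem fun k _ => mul_mem (c k : E).2 (hE k i j)

omit [Fintype ι] h in
theorem blockDet_mem (g : points F H) (i : ι) :
    blockDet (π i) (pointsHom H g : Matrix (Fin n) (Fin n) K) ∈ E := by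
  refine det_mem_intermediateField fun a b => ?_
  rw [map_algebraMap_self, Matrix.add_apply, Matrix.sub_apply, Matrix.mul_apply]
  refine add_mem (sum_mem fun k _ => mul_mem (hE i a k) ?_) (sub_mem ?_ (hE i a b))
  · rw [pointsHom_apply]; exact E.algebraMap_mem _
  · rw [Matrix.one_apply]; split_ifs
    · exact one_mem _
    · exact zero_mem _

omit h hE in
/-- The characters given by powers of the block determinants. -/
def blockChar (h : IsCentralDatum H π m N) (hE : ∀ i a b, π i a b ∈ E) (i : ι) :
    points F H →* Eˣ :=
  MonoidHom.toHomUnits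
    { toFun := fun g => (⟨blockDet (π i) (pointsHom H g : Matrix (Fin n) (Fin n) K),
        blockDet_mem hE g i⟩ : E) ^ m i
      map_one' := Subtype.ext <| by
        change blockDet (π i) (pointsHom H (1 : points F H) : Matrix (Fin n) (Fin n) K) ^ m i = 1
        rw [map_one, Units.val_one, blockDet_one, one_pow]
      map_mul' := fun a b => Subtype.ext <| by
        change blockDet (π i) (pointsHom H (a * b) : Matrix (Fin n) (Fin n) K) ^ m i =
          blockDet (π i) (pointsHom H a : Matrix (Fin n) (Fin n) K) ^ m i *
            blockDet (π i) (pointsHom H b : Matrix (Fin n) (Fin n) K) ^ m i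
        rw [map_mul, Units.val_mul, blockDet_mul (h.coi.idem i) (h.commute _ (pointsHom_mem a) i), mul_pow] }

theorem coe_blockChar (i : ι) (g : points F H) : ((h.blockChar hE i g : E) : K) =
    blockDet (π i) (pointsHom H g : Matrix (Fin n) (Fin n) K) ^ m i := rfl

omit hE in
theorem commutator_le_blockKer : ⁅H, H⁆ ≤ h.blockKer := by
  have hcomm : ∀ x y : H, h.blockHom x * h.blockHom y = h.blockHom y * h.blockHom x := by
    intro x y
    refine Units.ext ?_
    rw [Units.val_mul, Units.val_mul, coe_blockHom, coe_blockHom, blockMap, blockMap,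
      sum_smul_mul_sum_smul h.coi.toOrthogonalIdempotents,
      sum_smul_mul_sum_smul h.coi.toOrthogonalIdempotents]
    simp only [mul_comm]
  have hker : ∀ x y : H, x * y * x⁻¹ * y⁻¹ ∈ h.blockHom.ker := by
    intro x y
    rw [MonoidHom.mem_ker, map_mul, map_mul, map_mul, map_inv, map_inv, hcomm,
      mul_inv_cancel_right, mul_inv_cancel]
  refine Subgroup.commutator_le.2 fun a ha b hb => ?_
  exact Subgroup.mem_map_of_mem H.subtype (hker ⟨a, ha⟩ ⟨b, hb⟩)

omit hE in
theorem isZariskiClosed_blockKer (hH : IsZariskiClosed K (H : Set (GL (Fin n) K))) :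
    IsZariskiClosed K (h.blockKer : Set (GL (Fin n) K)) := by
  have h1 := hH.inter (isZariskiClosed_setOf (Set.range fun q : Fin n × Fin n =>
    blockMap π m (genMat n K) q.1 q.2 - C ((1 : Matrix (Fin n) (Fin n) K) q.1 q.2)))
  convert h1 using 1
  ext g
  rw [SetLike.mem_coe, h.mem_blockKer]
  refine and_congr Iff.rfl ?_
  have h2 := map_blockMap (evalMat (g : Matrix (Fin n) (Fin n) K)) π m (genMat n K)
  rw [genMat_map_evalMat] at h2
  rw [← h2, Set.mem_ofPred_eq, Set.forall_mem_range]
  simp only [map_sub, evalMat_C, sub_eq_zero, Prod.forall]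
  exact Matrix.ext_iff.symm

-- Write a point as `a b` with `a` in `subCenter` and `b` in the kernel; the class of `b` modulo the
-- closure of `[H,H]` takes finitely many values.
omit hE in
theorem relIndex_sup_ne_zero [CharZero K] [IsAlgClosed K]
    (hH : IsZariskiClosed K (H : Set (GL (Fin n) K))) (hr : HasTrivialUnipotentRadical H) :
    ((h.subCenter E ⊔ zariskiClosure ⁅H, H⁆).comap (pointsHom (F := F) H)).relIndex
      ((h.subCenter E ⊔ h.blockKer).comap (pointsHom H)) ≠ 0 := by
  set M := zariskiClosure ⁅H, H⁆
  have hM := h.relIndex_zariskiClosure_ne_zero hH hr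
  have hfin : Finite (h.blockKer ⧸ M.subgroupOf h.blockKer) := Nat.finite_of_card_ne_zero hM
  have hex : ∀ g : (h.subCenter E ⊔ h.blockKer).comap (pointsHom (F := F) H),
      ∃ a ∈ h.subCenter E, ∃ b : h.blockKer, a * (b : GL (Fin n) K) = pointsHom H (g : points F H) := by
    intro g
    obtain ⟨a, ha, b, hb, hab⟩ := Subgroup.exists_mul_eq_of_mem_sup
      (fun a ha b hb => h.subCenter_commute ha (h.blockKer_le hb)) g.2
    exact ⟨a, ha, ⟨b, hb⟩, hab⟩
  choose a ha b hab using hex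
  refine Subgroup.relIndex_ne_zero_of_map _ _
    (fun g => (b g : h.blockKer ⧸ M.subgroupOf h.blockKer)) fun g g' hgg => ?_
  have h1 : ((b g : GL (Fin n) K))⁻¹ * b g' ∈ M := by
    have h0 := QuotientGroup.eq.1 hgg
    exact h0
  have h2 : (a g)⁻¹ * a g' ∈ h.subCenter E := mul_mem (inv_mem (ha g)) (ha g')
  have h3 : (pointsHom H (g : points F H))⁻¹ * pointsHom H (g' : points F H) =
      ((a g)⁻¹ * a g') * ((b g : GL (Fin n) K)⁻¹ * b g') := by
    rw [← hab g, ← hab g', _root_.mul_inv_rev, mul_assoc, ← mul_assoc (a g)⁻¹ (a g'),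
      ← mul_assoc (b g : GL (Fin n) K)⁻¹,
      ← h.subCenter_commute h2 (inv_mem (h.blockKer_le (b g).2)), mul_assoc]
  rw [Subgroup.mem_comap, map_mul, map_inv, h3]
  exact Subgroup.mul_mem_sup h2 h1

/-- On a subgroup of finite index the block characters are `N`-th powers `c i ^ N` in `Eˣ`. The
block scalar matrix of `c` need not lie in `H`, but its `N`-th power is the image of `g` and does;
so `c` has finitely many classes modulo those that give elements of `H`. For two points in one class
the quotient of the block scalars is an element `z` of `H` with the same image as `g⁻¹g'`, whence
`g⁻¹g'` is `z` times an element of the kernel. -/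
theorem index_sup_ne_zero [CharZero K] [IsAlgClosed K]
    (hH : IsZariskiClosed K (H : Set (GL (Fin n) K))) (hc : IsZariskiConnected H)
    (hr : HasTrivialUnipotentRadical H)
    (hidx : ∀ m ≠ 0, (powMonoidHom m : Eˣ →* Eˣ).range.index ≠ 0) :
    ((h.subCenter E ⊔ h.blockKer).comap (pointsHom (F := F) H)).index ≠ 0 := by
  let Γ1 : Subgroup (points F H) := ⨅ i, (powMonoidHom N : Eˣ →* Eˣ).range.comap (h.blockChar hE i)
  have hΓ1 : Γ1.index ≠ 0 := Subgroup.index_iInf_ne_zero fun i => by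
    rw [Subgroup.index_comap]
    exact fun h0 => hidx N h.pos.ne' (Subgroup.index_eq_zero_of_relIndex_eq_zero h0)
  have hex : ∀ g : Γ1, ∃ c : ι → Eˣ, ∀ i, c i ^ N = h.blockChar hE i g := fun g => by
    choose c hc using fun i => (Subgroup.mem_iInf.1 g.2 i : _ ∈ (powMonoidHom N : Eˣ →* Eˣ).range)
    exact ⟨c, hc⟩
  choose c hcN using hex
  let T := (H.comap ((torusHom h.coi).comp (powMonoidHom N)))
  let T₁ := H.comap (torusHom h.coi)
  have hfin : Finite (T ⧸ T₁.subgroupOf T) := Nat.finite_of_card_ne_zero (h.relIndex_torus_ne_zero hH)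
  let ĉ : Γ1 → ι → Kˣ := fun g i => Units.map (algebraMap E K : E →* K) (c g i)
  have hsub : ∀ d : ι → Eˣ, h.subTorusHom E d =
      torusHom h.coi fun i => Units.map (algebraMap E K : E →* K) (d i) := fun d => rfl
  have hĉ : ∀ g i, (ĉ g i : K) ^ N =
      blockDet (π i) (pointsHom H (g : points F H) : Matrix (Fin n) (Fin n) K) ^ m i := by
    intro g i
    rw [← h.coe_blockChar hE, ← hcN]
    rfl
  have hT : ∀ g, ĉ g ∈ T := by
    intro g
    have h1 := h.blockHom_mem hH hc hr ⟨pointsHom H (g : points F H), pointsHom_mem (g : points F H)⟩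
    have h2 : torusHom h.coi (powMonoidHom N (ĉ g)) =
        h.blockHom ⟨pointsHom H (g : points F H), pointsHom_mem (g : points F H)⟩ := by
      refine Units.ext ?_
      rw [coe_torusHom, coe_blockHom, blockMap]
      refine Finset.sum_congr rfl fun i _ => ?_
      rw [← hĉ]; rfl
    change torusHom h.coi (powMonoidHom N (ĉ g)) ∈ H
    rw [h2]; exact h1
  have hrel : ((h.subCenter E ⊔ h.blockKer).comap (pointsHom (F := F) H)).relIndex Γ1 ≠ 0 := by
    refine Subgroup.relIndex_ne_zero_of_map _ _
      (fun g => ((⟨ĉ g, hT g⟩ : T) : T ⧸ T₁.subgroupOf T)) fun g g' hgg => ?_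
    have h1 : torusHom h.coi ((ĉ g)⁻¹ * ĉ g') ∈ H := QuotientGroup.eq.1 hgg
    have h2 : h.subTorusHom E ((c g)⁻¹ * c g') = torusHom h.coi ((ĉ g)⁻¹ * ĉ g') := by
      rw [hsub]; rfl
    set z := h.subTorusHom E ((c g)⁻¹ * c g') with hz
    have hzE : z ∈ h.subCenter E := ⟨_, show _ ∈ H by rw [← hz, h2]; exact h1, rfl⟩
    set x := (pointsHom H (g : points F H))⁻¹ * pointsHom H (g' : points F H) with hx
    have hxH : x ∈ H := mul_mem (inv_mem (pointsHom_mem _)) (pointsHom_mem _)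
    have hzx : z⁻¹ * x ∈ h.blockKer := by
      have hzH := h.subCenter_le hzE
      have hzm : z⁻¹ * x ∈ H := mul_mem (inv_mem hzH) hxH
      have h3 : h.blockHom ⟨z, hzH⟩ = h.blockHom ⟨x, hxH⟩ := by
        have e1 : (⟨x, hxH⟩ : H) = (⟨pointsHom H (g : points F H), pointsHom_mem (g : points F H)⟩ : H)⁻¹ *
          ⟨pointsHom H (g' : points F H), pointsHom_mem (g' : points F H)⟩ := rfl
        have e2 : ∀ g : Γ1, h.blockHom ⟨pointsHom H (g : points F H), pointsHom_mem (g : points F H)⟩ =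
            torusHom h.coi (ĉ g ^ N) := by
          intro g
          refine Units.ext ?_
          rw [coe_torusHom, coe_blockHom, blockMap]
          refine Finset.sum_congr rfl fun i _ => ?_
          rw [← hĉ]; rfl
        rw [e1, map_mul, map_inv, e2, e2, ← map_inv, ← map_mul, ← inv_pow, ← mul_pow]
        refine Units.ext ?_
        rw [coe_torusHom, coe_blockHom, blockMap]
        refine Finset.sum_congr rfl fun i _ => ?_
        change blockDet (π i) (z : Matrix (Fin n) (Fin n) K) ^ m i • _ = _
        rw [h2, h.blockDet_torusHom_pow]; rfl
      refine ⟨⟨z⁻¹ * x, hzm⟩, ?_, rfl⟩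
      have e3 : (⟨z⁻¹ * x, hzm⟩ : H) = (⟨z, hzH⟩ : H)⁻¹ * ⟨x, hxH⟩ := rfl
      change h.blockHom _ = 1
      rw [e3, map_mul, map_inv, h3, inv_mul_cancel]
    rw [Subgroup.mem_comap, map_mul, map_inv, ← hx, ← mul_inv_cancel_left z x]
    exact Subgroup.mul_mem_sup hzE hzx
  have := Subgroup.relIndex_ne_zero_trans hrel (by rwa [Subgroup.relIndex_top_right])
  rwa [Subgroup.relIndex_top_right] at this

/-- With `g = a b`, the cocycle `τ ↦ a⁻¹τ(a)` has values in the kernel intersected with the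
centralizer, a finite group. Equal cocycles for `g` and `g'` make `a⁻¹a'` Galois invariant, hence a
central `F`-point, and the remaining factor `b⁻¹b'` lies in the closure of `[H,H]`, inside `G`. -/
theorem relIndex_center_ne_zero [CharZero K] [IsAlgClosed K] [IsGalois F K] [FiniteDimensional F E]
    (hH : IsZariskiClosed F (H : Set (GL (Fin n) K)))
    (hG : IsZariskiClosed F (G : Set (GL (Fin n) K))) (hD : ⁅H, H⁆ ≤ G) :
    (Subgroup.center (points F H) ⊔ G.comap (pointsHom H)).relIndex
      ((h.subCenter E ⊔ zariskiClosure ⁅H, H⁆).comap (pointsHom H)) ≠ 0 := by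
  set M := zariskiClosure ⁅H, H⁆ with hM
  have hblockclosed : M ≤ h.blockKer :=
    zariskiClosure_le h.commutator_le_blockKer (h.isZariskiClosed_blockKer hH.extend)
  have hMG : M ≤ G := zariskiClosure_le hD hG.extend
  have hex : ∀ g : (h.subCenter E ⊔ M).comap (pointsHom (F := F) H),
      ∃ a ∈ h.subCenter E, ∃ b ∈ M, a * b = pointsHom H (g : points F H) := fun g =>
    Subgroup.exists_mul_eq_of_mem_sup
      (fun a ha b hb => h.subCenter_commute ha (h.blockKer_le (hblockclosed hb))) g.2
  choose a ha b hb hab using hex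
  -- Restriction to `E`. As `a g` has entries in `E`, its conjugate by `τ` depends only on `r τ`,
  -- and there are finitely many embeddings of `E`.
  let r : (K ≃ₐ[F] K) → (E →ₐ[F] K) := fun τ => (τ : K →ₐ[F] K).comp E.val
  have hr : ∀ τ τ' : K ≃ₐ[F] K, r τ = r τ' → ∀ g, galMap τ (a g) = galMap τ' (a g) := by
    intro τ τ' hττ g
    ext i j
    exact DFunLike.congr_fun hττ ⟨_, h.subCenter_entry_mem hE (ha g) i j⟩
  have hfin := h.finite_blockKer_inf_centralizer
  set Ξ := h.blockKer ⊓ Subgroup.centralizer (H : Set (GL (Fin n) K))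
  have hcent : ∀ (τ : K ≃ₐ[F] K) g, (a g)⁻¹ * galMap τ (a g) ∈ Ξ := by
    intro τ g
    have hτc : ∀ x ∈ H, x * galMap τ (a g) = galMap τ (a g) * x := by
      intro x hx
      have := congrArg (galMap τ) (h.subCenter_commute (ha g) (galMap_mem hH τ.symm hx))
      rw [map_mul, map_mul, galMap_galMap_symm] at this
      exact this.symm
    -- Since `a b` is Galois invariant, the cocycle also equals `b τ(b)⁻¹`, which lies in the
    -- closure of `[H,H]`.
    refine ⟨hblockclosed ?_, Subgroup.mem_centralizer_iff.2 fun x hx => ?_⟩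
    · have h1 : galMap τ (a g) * galMap τ (b g) = a g * b g := by
        rw [← map_mul, hab]
        exact galMap_map τ _
      have h2 : (a g)⁻¹ * galMap τ (a g) = b g * (galMap τ (b g))⁻¹ := by
        rw [eq_mul_inv_iff_mul_eq, mul_assoc, h1, inv_mul_cancel_left]
      rw [h2]
      exact mul_mem (hb g) (inv_mem (galMap_mem_zariskiClosure
        (fun τ d hd => galMap_mem_commutator hH τ hd) τ (hb g)))
    · rw [← mul_assoc, ← h.subCenter_commute (inv_mem (ha g)) hx, mul_assoc, hτc x hx, mul_assoc]
  -- The invariant of `g` is its cocycle as a function on embeddings of `E`, read at a chosen lift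
  -- `Function.invFun r σ`; the value at an embedding without a lift is arbitrary but harmless.
  refine Subgroup.relIndex_ne_zero_of_map _ _
    (fun g (σ : E →ₐ[F] K) => (⟨_, hcent (Function.invFun r σ) g⟩ : Ξ)) fun g g' hgg => ?_
  have h1 : ∀ τ : K ≃ₐ[F] K, (a g)⁻¹ * galMap τ (a g) = (a g')⁻¹ * galMap τ (a g') := by
    intro τ
    have h2 := congrArg Subtype.val (congrFun hgg (r τ))
    have h3 : r (Function.invFun r (r τ)) = r τ := Function.invFun_eq ⟨τ, rfl⟩
    change (a g)⁻¹ * galMap (Function.invFun r (r τ)) (a g) =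
      (a g')⁻¹ * galMap (Function.invFun r (r τ)) (a g') at h2
    rwa [hr _ _ h3, hr _ _ h3] at h2
  have h2 : (a g)⁻¹ * a g' ∈ h.subCenter E := mul_mem (inv_mem (ha g)) (ha g')
  have hw : ∀ τ : K ≃ₐ[F] K, galMap τ ((a g)⁻¹ * a g') = (a g)⁻¹ * a g' := by
    intro τ
    have h3 := h1 τ
    rw [inv_mul_eq_iff_eq_mul] at h3
    rw [map_mul, map_inv, h3, _root_.mul_inv_rev, _root_.mul_inv_rev, inv_inv, mul_assoc, mul_assoc]
    have h4 : galMap τ (a g') ∈ H := galMap_mem hH τ (h.subCenter_le (ha g'))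
    rw [← mul_assoc (a g'), h.subCenter_commute (ha g') (inv_mem (h.subCenter_le (ha g))),
      h.subCenter_commute h2 h4, inv_mul_cancel_left]
  obtain ⟨w, hw⟩ := exists_map_eq_of_fixed hw
  have hwH : w ∈ points F H := by
    change Matrix.GeneralLinearGroup.map (algebraMap F K) w ∈ H
    rw [hw]; exact h.subCenter_le h2
  have hwψ : pointsHom H ⟨w, hwH⟩ = (a g)⁻¹ * a g' := hw
  have hwc : (⟨w, hwH⟩ : points F H) ∈ Subgroup.center (points F H) := by
    refine Subgroup.mem_center_iff.2 fun x => pointsHom_injective ?_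
    rw [map_mul, map_mul, hwψ, h.subCenter_commute h2 (pointsHom_mem x)]
  rw [← mul_inv_cancel_left (⟨w, hwH⟩ : points F H) ((g : points F H)⁻¹ * (g' : points F H))]
  refine Subgroup.mul_mem_sup hwc ?_
  rw [Subgroup.mem_comap]
  have h5 : pointsHom H ((⟨w, hwH⟩ : points F H)⁻¹ * ((g : points F H)⁻¹ * (g' : points F H))) = (b g)⁻¹ * b g' := by
    rw [map_mul, map_mul, map_inv, map_inv, hwψ, ← hab, ← hab, inv_mul_eq_iff_eq_mul, _root_.mul_inv_rev,
      mul_assoc, ← mul_assoc (a g)⁻¹ (a g'), ← mul_assoc (b g)⁻¹,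
      ← h.subCenter_commute h2 (inv_mem (h.blockKer_le (hblockclosed (hb g)))), mul_assoc]
  rw [h5]
  exact hMG (mul_mem (inv_mem (hb g)) (hb g'))

end IsCentralDatum

theorem index_center_sup_ne_zero [CharZero K] [IsAlgClosed K] [IsGalois F K]
    (hidx : ∀ E : IntermediateField F K, FiniteDimensional F E →
      ∀ m ≠ 0, (powMonoidHom m : Eˣ →* Eˣ).range.index ≠ 0)
    (hH : IsConnectedReductive F H) (hG : IsZariskiClosed F (G : Set (GL (Fin n) K)))
    (hD : ⁅H, H⁆ ≤ G) :
    (Subgroup.center (points F H) ⊔ (points F G).subgroupOf (points F H)).index ≠ 0 := by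
  obtain ⟨ι, _, π, m, N, h⟩ := exists_centralDatum hH.closed.extend hH.reductive
  let s : Set K := Set.range fun q : ι × Fin n × Fin n => π q.1 q.2.1 q.2.2
  let E := IntermediateField.adjoin F s
  have hE : ∀ i a b, π i a b ∈ E := fun i a b =>
    IntermediateField.subset_adjoin F s ⟨(i, a, b), rfl⟩
  have hfd : FiniteDimensional F E := by
    have : Finite s := Set.finite_range _
    exact IntermediateField.finiteDimensional_adjoin fun x _ => Algebra.IsIntegral.isIntegral x
  have h1 := Subgroup.relIndex_ne_zero_trans (h.relIndex_center_ne_zero hE hH.closed hG hD)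
    (h.relIndex_sup_ne_zero hH.closed.extend hH.reductive)
  have h2 := Subgroup.relIndex_ne_zero_trans h1 (L := ⊤) (by
    rw [Subgroup.relIndex_top_right]
    exact h.index_sup_ne_zero hE hH.closed.extend hH.connected hH.reductive (hidx E hfd))
  rwa [Subgroup.relIndex_top_right] at h2

end Points

end LinAlgGroup

end

noncomputable section

/-! ### Schur's lemma in countable dimension. -/

section Resolvent

open Polynomial

variable {V : Type*} [AddCommGroup V] [Module ℂ V]

theorem aeval_injective_of_forall_sub_injective {f : Module.End ℂ V}
    (h : ∀ c : ℂ, Function.Injective (f - algebraMap ℂ (Module.End ℂ V) c)) {q : ℂ[X]} (hq : q ≠ 0) :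
    Function.Injective (aeval f q) := by
  have key : ∀ s : Multiset ℂ, Function.Injective (aeval f (s.map fun r => X - C r).prod) := by
    intro s
    induction s using Multiset.induction with
    | empty => exact fun a b hab => by simpa using hab
    | cons r s ih =>
      rw [Multiset.map_cons, Multiset.prod_cons, map_mul, Module.End.mul_eq_comp,
        LinearMap.coe_comp]
      refine Function.Injective.comp ?_ ih
      simpa using h r
  rw [(IsAlgClosed.splits q).eq_prod_roots, map_mul, aeval_C, Module.End.mul_eq_comp,
    LinearMap.coe_comp]
  refine Function.Injective.comp (fun a b hab => ?_) (key _)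
  simp only [Module.algebraMap_end_apply] at hab
  exact smul_right_injective V (leadingCoeff_ne_zero.2 hq) hab

/-- Clearing denominators in a relation among the `u c = (f - c)⁻¹ v` gives a polynomial `q` with
`q(f) v = 0`. Injectivity of all `f - c` forces `q = 0`, and evaluating `q` at `i` leaves the
coefficient `a i` times a nonzero product. -/
theorem linearIndependent_resolvent {f : Module.End ℂ V}
    (h : ∀ c : ℂ, Function.Injective (f - algebraMap ℂ (Module.End ℂ V) c)) {v : V} (hv : v ≠ 0)
    {u : ℂ → V} (hu : ∀ c, (f - algebraMap ℂ (Module.End ℂ V) c) (u c) = v) :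
    LinearIndependent ℂ u := by
  classical
  rw [linearIndependent_iff']
  intro s a ha i hi
  let q : ℂ[X] := ∑ c ∈ s, C (a c) * ∏ d ∈ s.erase c, (X - C d)
  have h1 : aeval f q v = 0 := by
    have h2 : ∀ c ∈ s, aeval f (C (a c) * ∏ d ∈ s.erase c, (X - C d)) v =
        aeval f (∏ d ∈ s, (X - C d)) (a c • u c) := by
      intro c hc
      rw [← Finset.prod_erase_mul s _ hc, map_mul, map_mul, aeval_C, map_sub, aeval_X, aeval_C,
        map_smul, Module.End.mul_apply, Module.End.mul_apply, hu, Module.algebraMap_end_apply]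
    rw [map_sum, LinearMap.sum_apply, Finset.sum_congr rfl h2, ← map_sum, ha, map_zero]
  have hq : q = 0 := by
    by_contra hq
    exact hv (aeval_injective_of_forall_sub_injective h hq (h1.trans (map_zero _).symm))
  have h3 : eval i q = a i * ∏ d ∈ s.erase i, (i - d) := by
    rw [eval_finsetSum, Finset.sum_eq_single i]
    · simp [eval_prod]
    · intro c _ hci
      rw [eval_mul, eval_prod, Finset.prod_eq_zero (Finset.mem_erase.2 ⟨hci.symm, hi⟩) (by simp),
        mul_zero]
    · exact fun h => absurd hi h
  rw [hq, eval_zero] at h3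
  refine (mul_eq_zero.1 h3.symm).resolve_right (Finset.prod_ne_zero_iff.2 fun d hd => ?_)
  exact sub_ne_zero.2 (Finset.ne_of_mem_erase hd).symm

/-- An endomorphism of a complex vector space of countable dimension has `f - c` not bijective for
some scalar `c`. -/
theorem exists_not_bijective_sub [Nontrivial V] {s : Set V} (hs : s.Countable)
    (hspan : Submodule.span ℂ s = ⊤) (f : Module.End ℂ V) :
    ∃ c : ℂ, ¬ Function.Bijective (f - algebraMap ℂ (Module.End ℂ V) c) := by
  by_contra! h
  obtain ⟨v, hv⟩ := exists_ne (0 : V)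
  choose u hu using fun c => (h c).2 v
  have h1 := (linearIndependent_resolvent (fun c => (h c).1) hv hu).cardinal_lift_le_rank
  have h2 := rank_span_le (R := ℂ) s
  rw [hspan, rank_top] at h2
  have h3 : Cardinal.mk s ≤ Cardinal.aleph0 := by
    have := hs.to_subtype; exact Cardinal.mk_le_aleph0
  have h4 := h1.trans (Cardinal.lift_le.2 (h2.trans h3))
  rw [Cardinal.mk_complex, Cardinal.lift_continuum, Cardinal.lift_aleph0] at h4
  exact absurd h4 (not_le.2 Cardinal.aleph0_lt_continuum)

end Resolvent

/-! ### Dimensions of Hom spaces into a finite product of simple modules. -/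

section Counting

variable {k : Type*} [Field k] [IsAlgClosed k] {R : Type*} [Ring R] [Algebra k R]
  {N : ℕ} {S : Fin N → Type*} [∀ i, AddCommGroup (S i)] [∀ i, Module R (S i)] [∀ i, Module k (S i)]
  [∀ i, IsScalarTower k R (S i)] [∀ i, IsSimpleModule R (S i)]
  {M : Type*} [AddCommGroup M] [Module R M] [Module k M] [IsScalarTower k R M]
  {T : Type*} [AddCommGroup T] [Module R T]

variable (k) in
/-- Composition with an isomorphism on the target. -/
def homCongrRight {M' : Type*} [AddCommGroup M'] [Module R M'] [Module k M'] [IsScalarTower k R M']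
    (e : M ≃ₗ[R] M') : (T →ₗ[R] M) ≃ₗ[k] (T →ₗ[R] M') where
  toFun f := e.toLinearMap ∘ₗ f
  invFun f := e.symm.toLinearMap ∘ₗ f
  map_add' f g := by ext; simp
  map_smul' c f := by
    ext x
    exact LinearMap.map_smul_of_tower e.toLinearMap c (f x)
  left_inv f := by ext; simp
  right_inv f := by ext; simp

variable (k) in
/-- Homomorphisms to a product. -/
def homPi : (T →ₗ[R] ∀ i, S i) ≃ₗ[k] ∀ i, T →ₗ[R] S i where
  toFun f i := LinearMap.proj i ∘ₗ f
  invFun f := LinearMap.pi f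
  map_add' _ _ := rfl
  map_smul' _ _ := rfl
  left_inv _ := rfl
  right_inv _ := rfl

variable (e : M ≃ₗ[R] ∀ i, S i) [FiniteDimensional k (M →ₗ[R] M)]

include e

/-- Endomorphisms of a factor embed into those of `M`, so they form a finite-dimensional division
algebra over an algebraically closed field. Schur's lemma for the summands needs no separate
countability argument. -/
theorem algebraMap_end_bijective_of_pi (i : Fin N) :
    Function.Bijective (algebraMap k (Module.End R (S i))) := by
  classical
  let F : Module.End R (S i) →ₗ[k] (M →ₗ[R] M) :=
    { toFun := fun f => e.symm.toLinearMap ∘ₗ LinearMap.single R S i ∘ₗ f ∘ₗ LinearMap.proj i ∘ₗ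
        e.toLinearMap
      map_add' := fun f g => by ext x; simp [Pi.single_add]
      map_smul' := fun c f => by
        ext x
        have h1 := LinearMap.map_smul_of_tower (LinearMap.single R S i) c (f (e x i))
        have h2 := LinearMap.map_smul_of_tower e.symm.toLinearMap c (LinearMap.single R S i (f (e x i)))
        rw [← h1] at h2
        exact h2 }
  have hF : Function.Injective F := by
    intro f g hfg
    ext x
    have h1 := LinearMap.congr_fun hfg (e.symm (Pi.single i x))
    have h2 := congrFun (congrArg e h1) i
    simpa [F] using h2
  have : FiniteDimensional k (Module.End R (S i)) := FiniteDimensional.of_injective F hF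
  classical
  exact IsAlgClosed.algebraMap_bijective_of_isIntegral

variable [IsSimpleModule R T]

theorem finrank_hom_simple (i : Fin N) : FiniteDimensional k (T →ₗ[R] S i) ∧
    (Nonempty (T ≃ₗ[R] S i) → Module.finrank k (T →ₗ[R] S i) = 1) ∧
      (¬ Nonempty (T ≃ₗ[R] S i) → Module.finrank k (T →ₗ[R] S i) = 0) := by
  by_cases h : Nonempty (T ≃ₗ[R] S i)
  · obtain ⟨φ⟩ := h
    let e1 : (T →ₗ[R] S i) ≃ₗ[k] (S i →ₗ[R] S i) := LinearEquiv.congrLeft (S i) k φ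
    let e2 : k ≃ₗ[k] (S i →ₗ[R] S i) := LinearEquiv.ofBijective
      (Algebra.linearMap k (Module.End R (S i))) (algebraMap_end_bijective_of_pi e i)
    refine ⟨Module.Finite.equiv (e2.trans e1.symm), fun _ => ?_, fun h => absurd ⟨φ⟩ h⟩
    rw [(e2.trans e1.symm).symm.finrank_eq, Module.finrank_self]
  · have h0 : Subsingleton (T →ₗ[R] S i) := ⟨fun f g => by
      have hz : ∀ f : T →ₗ[R] S i, f = 0 := fun f =>
        (LinearMap.bijective_or_eq_zero f).resolve_left fun hf =>
          h ⟨LinearEquiv.ofBijective f hf⟩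
      rw [hz f, hz g]⟩
    exact ⟨inferInstance, fun h' => absurd h' h, fun _ => Module.finrank_zero_of_subsingleton⟩

theorem finrank_hom_eq_card : FiniteDimensional k (T →ₗ[R] M) ∧
    Module.finrank k (T →ₗ[R] M) = Nat.card {i // Nonempty (T ≃ₗ[R] S i)} := by
  classical
  have hfd : ∀ i, FiniteDimensional k (T →ₗ[R] S i) := fun i => (finrank_hom_simple e i).1
  let E : (T →ₗ[R] M) ≃ₗ[k] ∀ i, T →ₗ[R] S i := (homCongrRight k e).trans (homPi k)
  refine ⟨Module.Finite.equiv E.symm, ?_⟩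
  rw [E.finrank_eq, Module.finrank_pi_fintype, Nat.card_eq_fintype_card, Fintype.card_subtype,
    Finset.card_filter]
  refine Finset.sum_congr rfl fun i _ => ?_
  split_ifs with h
  · exact (finrank_hom_simple e i).2.1 h
  · exact (finrank_hom_simple e i).2.2 h

omit [IsSimpleModule R T] in
theorem finrank_end_eq_sum : Module.finrank k (M →ₗ[R] M) =
    ∑ i, Module.finrank k (S i →ₗ[R] M) := by
  classical
  have hfd : ∀ i, FiniteDimensional k (S i →ₗ[R] M) := fun i => (finrank_hom_eq_card e).1
  let E : (M →ₗ[R] M) ≃ₗ[k] ∀ i, S i →ₗ[R] M :=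
    (LinearEquiv.congrLeft M k e).trans (LinearMap.lsum R S k).symm
  rw [E.finrank_eq, Module.finrank_pi_fintype]

end Counting

end

/-! ### Clifford theory: endomorphisms of the restriction and twists. -/

noncomputable section

namespace Representation

variable {Γt Γ : Type*} [Group Γt] [Group Γ] {V : Type*} [AddCommGroup V] [Module ℂ V]

/-- The restriction of a representation along a homomorphism. -/
abbrev pullback (ρ : Representation ℂ Γt V) (ι : Γ →* Γt) : Representation ℂ Γ V :=
  MonoidHom.comp ρ ι

theorem twist_apply (ρ : Representation ℂ Γt V) (χ : Γt →* ℂˣ) (g : Γt) (v : V) :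
    ρ.twist χ g v = (χ g : ℂ) • ρ g v := rfl

theorem IsIrreducible.twist {ρ : Representation ℂ Γt V} (h : ρ.IsIrreducible) (χ : Γt →* ℂˣ) :
    (ρ.twist χ).IsIrreducible := by
  let e : Subrepresentation (ρ.twist χ) ≃o Subrepresentation ρ :=
    { toFun := fun W => ⟨W.toSubmodule, fun g v hv => by
        have h1 := W.toSubmodule.smul_mem ((χ g : ℂ)⁻¹) (W.apply_mem_toSubmodule g hv)
        rwa [twist_apply, smul_smul, inv_mul_cancel₀ (χ g).ne_zero, one_smul] at h1⟩
      invFun := fun W => ⟨W.toSubmodule, fun g v hv =>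
        W.toSubmodule.smul_mem _ (W.apply_mem_toSubmodule g hv)⟩
      left_inv := fun _ => rfl
      right_inv := fun _ => rfl
      map_rel_iff' := Iff.rfl }
  exact e.isSimpleOrder_iff.2 h

theorem IsIrreducible.nontrivial_space {ρ : Representation ℂ Γt V} (h : ρ.IsIrreducible) :
    Nontrivial V := by
  by_contra hV
  rw [not_nontrivial_iff_subsingleton] at hV
  have : Nontrivial (Subrepresentation ρ) := h.toNontrivial
  exact bot_ne_top (α := Subrepresentation ρ) (Subrepresentation.toSubmodule_injective
    (Subsingleton.elim _ _))

theorem inv_apply_apply (ρ : Representation ℂ Γt V) (g : Γt) (v : V) : ρ g⁻¹ (ρ g v) = v := by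
  rw [← Module.End.mul_apply, ← map_mul, inv_mul_cancel, map_one, Module.End.one_apply]

theorem apply_inv_apply (ρ : Representation ℂ Γt V) (g : Γt) (v : V) : ρ g (ρ g⁻¹ v) = v := by
  rw [← Module.End.mul_apply, ← map_mul, mul_inv_cancel, map_one, Module.End.one_apply]

/-- Every endomorphism of an irreducible representation of countable dimension is a scalar. -/
theorem IsIrreducible.exists_eq_smul {ρ : Representation ℂ Γt V} (h : ρ.IsIrreducible) {s : Set V}
    (hs : s.Countable) (hspan : Submodule.span ℂ s = ⊤) (f : IntertwiningMap ρ ρ) :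
    ∃ c : ℂ, ∀ v, f v = c • v := by
  have := h.nontrivial_space
  obtain ⟨c, hc⟩ := exists_not_bijective_sub hs hspan f.toLinearMap
  refine ⟨c, fun v => ?_⟩
  have h1 := (IsIrreducible.bijective_or_eq_zero (f - c • (1 : IntertwiningMap ρ ρ))).resolve_left
    fun hb => hc hb
  have h2 := DFunLike.congr_fun h1 v
  rw [← sub_eq_zero]
  exact h2

/-- The situation of Clifford theory: an irreducible representation with Schur's lemma, whose
restriction along `ι` differs by the finite abelian quotient `q` only. -/
structure IsCliffordDatum {A : Type*} [CommGroup A] (ρ : Representation ℂ Γt V) (ι : Γ →* Γt)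
    (q : Γt →* A) : Prop where
  irr : ρ.IsIrreducible
  schur : ∀ f : IntertwiningMap ρ ρ, ∃ c : ℂ, ∀ v, f v = c • v
  surjective : Function.Surjective q
  map_eq_one : ∀ γ, q (ι γ) = 1
  -- The centre enters only through this clause: elements of the kernel of `q` act like elements of
  -- the small group, up to a scalar.
  ker : ∀ g, q g = 1 → ∃ (c : ℂ) (γ : Γ), c ≠ 0 ∧ ∀ v, ρ g v = c • ρ (ι γ) v
  normal : ∀ g γ, ∃ γ', g * ι γ = ι γ' * g

/-- The characters trivial on the image of `ι` that fix the representation. -/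
def fixingHoms (ρ : Representation ℂ Γt V) (ι : Γ →* Γt) : Set (Γt →* ℂˣ) :=
  {χ | (∀ γ, χ (ι γ) = 1) ∧ Nonempty (ρ.Equiv (ρ.twist χ))}

namespace IsCliffordDatum

variable {A : Type*} [CommGroup A] {ρ : Representation ℂ Γt V} {ι : Γ →* Γt}
  {q : Γt →* A} (h : IsCliffordDatum ρ ι q)

include h

theorem apply_ker (f : IntertwiningMap (ρ.pullback ι) (ρ.pullback ι)) {g : Γt} (hg : q g = 1) (v : V) :
    f (ρ g v) = ρ g (f v) := by
  obtain ⟨c, γ, -, hc⟩ := h.ker g hg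
  rw [hc, hc, map_smul]
  congr 1
  exact IntertwiningMap.isIntertwining _ _ f γ v

/-- The conjugate of an endomorphism depends only on the class of the conjugating element. -/
theorem conj_eq (f : IntertwiningMap (ρ.pullback ι) (ρ.pullback ι)) {g g' : Γt} (hg : q g = q g')
    (v : V) : ρ g⁻¹ (f (ρ g v)) = ρ g'⁻¹ (f (ρ g' v)) := by
  have h1 : q (g * g'⁻¹) = 1 := by rw [map_mul, map_inv, hg, mul_inv_cancel]
  have h2 : ρ g v = ρ (g * g'⁻¹) (ρ g' v) := by
    rw [map_mul, Module.End.mul_apply, ρ.inv_apply_apply]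
  rw [h2, h.apply_ker f h1, map_mul, Module.End.mul_apply, ρ.inv_apply_apply]

/-- An intertwining map between `ρ` and a twist is determined up to a scalar. -/
theorem exists_eq_smul_of_twist {χ : Γt →* ℂˣ} (φ : ρ.Equiv (ρ.twist χ))
    (f : IntertwiningMap ρ (ρ.twist χ)) : ∃ c : ℂ, ∀ v, f v = c • φ v := by
  obtain ⟨c, hc⟩ := h.schur (φ.symm.toIntertwiningMap.comp f)
  refine ⟨c, fun v => ?_⟩
  have h1 := congrArg φ (hc v)
  rw [map_smul] at h1
  rw [← h1]
  exact (Equiv.apply_symm_apply φ (f v)).symm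

/-- An isomorphism with the twist commutes with scalars and with the image of `ι`, hence with `ρ g`;
comparison with the twisted relation gives `χ g = 1`. So fixing characters factor through the finite
group `A`. -/
theorem eq_one_of_mem_fixingHoms {χ : Γt →* ℂˣ} (hχ : χ ∈ fixingHoms ρ ι) {g : Γt} (hg : q g = 1) :
    χ g = 1 := by
  obtain ⟨hχ1, ⟨φ⟩⟩ := hχ
  have := h.irr
  have := h.irr.nontrivial_space
  obtain ⟨v, hv⟩ := exists_ne (0 : V)
  obtain ⟨c, γ, hc0, hc⟩ := h.ker g hg
  have h1 : φ (ρ g v) = (χ g : ℂ) • ρ g (φ v) := IntertwiningMap.isIntertwining _ _ φ.toIntertwiningMap g v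
  have h2 : φ (ρ (ι γ) v) = (χ (ι γ) : ℂ) • ρ (ι γ) (φ v) :=
    IntertwiningMap.isIntertwining _ _ φ.toIntertwiningMap (ι γ) v
  rw [hχ1, Units.val_one, one_smul] at h2
  rw [hc, hc, map_smul, h2, smul_smul, mul_comm, mul_smul] at h1
  have h3 : ρ (ι γ) (φ v) = (χ g : ℂ) • ρ (ι γ) (φ v) := smul_right_injective V hc0 (by
    change c • _ = c • _
    rw [h1, smul_comm])
  have h4 : ρ (ι γ) (φ v) ≠ 0 := by
    intro h0
    have h5 := congrArg (ρ (ι γ)⁻¹) h0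
    rw [ρ.inv_apply_apply, map_zero] at h5
    exact hv (φ.toLinearEquiv.map_eq_zero_iff.1 h5)
  have h6 : ((χ g : ℂ) - 1) • ρ (ι γ) (φ v) = 0 := by rw [sub_smul, one_smul, ← h3, sub_self]
  exact Units.ext (sub_eq_zero.1 ((smul_eq_zero.1 h6).resolve_right h4))

omit h in
/-- An isomorphism with a twist, as an endomorphism of the restriction. -/
def ofTwist {χ : Γt →* ℂˣ} (hχ : ∀ γ, χ (ι γ) = 1) (f : IntertwiningMap ρ (ρ.twist χ)) :
    IntertwiningMap (ρ.pullback ι) (ρ.pullback ι) :=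
  ⟨f.toLinearMap, fun γ => by
    ext v
    have h1 : f (ρ (ι γ) v) = (χ (ι γ) : ℂ) • ρ (ι γ) (f v) := IntertwiningMap.isIntertwining _ _ f (ι γ) v
    rw [hχ, Units.val_one, one_smul] at h1
    exact h1⟩

-- Conjugation by `g` multiplies `f x` by `χ x g`, so a linear relation would be one between
-- distinct characters, contrary to Dedekind's independence.
omit [CommGroup A] h in
theorem linearIndependent_ofTwist {X : Type*} (χ : X → (Γt →* ℂˣ)) (hχ : Function.Injective χ)
    (f : X → IntertwiningMap (ρ.pullback ι) (ρ.pullback ι)) (hf : ∀ x, f x ≠ 0)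
    (hfχ : ∀ x g v, f x (ρ g v) = (χ x g : ℂ) • ρ g (f x v)) : LinearIndependent ℂ f := by
  rw [linearIndependent_iff']
  intro s a ha x hx
  by_contra hax
  refine hf x (IntertwiningMap.ext (LinearMap.ext fun v => ?_))
  change f x v = 0
  rw [← Module.forall_dual_apply_eq_zero_iff ℂ]
  intro l
  have hind : LinearIndependent ℂ fun x : X => ((Units.coeHom ℂ).comp (χ x) : Γt → ℂ) :=
    (linearIndependent_monoidHom Γt ℂ).comp (fun x => (Units.coeHom ℂ).comp (χ x)) fun x y hxy =>
      hχ (MonoidHom.ext fun g => Units.ext (DFunLike.congr_fun hxy g))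
  rw [linearIndependent_iff'] at hind
  have h1 := hind s (fun y => a y * l (f y v)) (by
    ext g
    have h2 := congrArg (fun F : IntertwiningMap (ρ.pullback ι) (ρ.pullback ι) =>
      l (ρ g⁻¹ (F (ρ g v)))) ha
    simp only [IntertwiningMap.sum_apply, IntertwiningMap.smul_apply, hfχ, map_sum, map_smul,
      ρ.inv_apply_apply] at h2
    simp only [Finset.sum_apply, Pi.smul_apply, smul_eq_mul] at h2 ⊢
    have h3 : l (ρ g⁻¹ ((0 : IntertwiningMap (ρ.pullback ι) (ρ.pullback ι)) (ρ g v))) = 0 := by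
      rw [IntertwiningMap.coe_zero]; simp
    rw [h3] at h2
    rw [Pi.zero_apply, ← h2]
    refine Finset.sum_congr rfl fun y _ => ?_
    change a y * l (f y v) * (χ y g : ℂ) = _
    ring) x hx
  exact (mul_eq_zero.1 h1).resolve_left hax

variable [Finite A]

theorem finite_fixingHoms : Finite (fixingHoms ρ ι) := by
  have hex : ∀ χ : fixingHoms ρ ι, ∃ ψ : AddChar (Additive A) ℂ, ∀ g,
      ((χ : Γt →* ℂˣ) g : ℂ) = ψ (Additive.ofMul (q g)) := by
    intro χ
    let χ' := q.liftOfSurjective h.surjective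
      ⟨(χ : Γt →* ℂˣ), fun g hg => h.eq_one_of_mem_fixingHoms χ.2 hg⟩
    refine ⟨⟨fun a => (χ' a.toMul : ℂ), by simp, fun a b => by simp⟩, fun g => ?_⟩
    have h1 := q.liftOfRightInverse_comp_apply _ (Function.rightInverse_surjInv h.surjective)
      ⟨(χ : Γt →* ℂˣ), fun g hg => h.eq_one_of_mem_fixingHoms χ.2 hg⟩ g
    exact congrArg Units.val h1.symm
  choose ψ hψ using hex
  refine Finite.of_injective ψ fun χ χ' hχ => Subtype.ext (MonoidHom.ext fun g => Units.ext ?_)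
  rw [hψ, hψ, hχ]

/-- The finite abelian group `A` acts on the endomorphisms of the restriction by conjugation, and
`f` is the average of its components `P ψ` over the characters of `A`. Each component intertwines
`ρ` with a twist, so it is zero or, by Schur's lemma, a multiple of the chosen isomorphism. -/
theorem span_fixingHoms (φ : ∀ χ : fixingHoms ρ ι, ρ.Equiv (ρ.twist χ))
    (f : IntertwiningMap (ρ.pullback ι) (ρ.pullback ι)) :
    f ∈ Submodule.span ℂ (Set.range fun χ : fixingHoms ρ ι =>
      ofTwist χ.2.1 (φ χ).toIntertwiningMap) := by
  classical
  have := h.irr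
  have := Fintype.ofFinite A
  choose s hs using h.surjective
  -- The conjugate of `f` by any lift of `a`; the choice is immaterial by `conj_eq`.
  let F : A → V →ₗ[ℂ] V := fun a => ρ (s a)⁻¹ ∘ₗ f.toLinearMap ∘ₗ ρ (s a)
  have hF : ∀ a g v, F a (ρ g v) = ρ g (F (a * q g) v) := by
    intro a g v
    have h1 := h.conj_eq f (g := s a * g) (g' := s (a * q g)) (by rw [map_mul, hs, hs]) v
    change ρ (s a)⁻¹ (f (ρ (s a) (ρ g v))) = ρ g (ρ (s (a * q g))⁻¹ (f (ρ (s (a * q g)) v)))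
    rw [← h1, ← Module.End.mul_apply (ρ (s a)), ← map_mul, _root_.mul_inv_rev, map_mul ρ g⁻¹,
      Module.End.mul_apply, ρ.apply_inv_apply]
  have hF1 : ∀ v, F 1 v = f v := by
    intro v
    have h1 := h.conj_eq f (g := s 1) (g' := 1) (by rw [hs, map_one]) v
    rw [inv_one, map_one, Module.End.one_apply, Module.End.one_apply] at h1
    exact h1
  -- The isotypic projection of `f`, without the factor `1/|A|`, which is restored in `hsum` by
  -- orthogonality of characters.
  let P : AddChar (Additive A) ℂ → V →ₗ[ℂ] V := fun ψ => ∑ a, ψ (Additive.ofMul a⁻¹) • F a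
  have hP : ∀ ψ g v, P ψ (ρ g v) = ψ (Additive.ofMul (q g)) • ρ g (P ψ v) := by
    intro ψ g v
    simp only [P, LinearMap.sum_apply, LinearMap.smul_apply, hF, map_sum, map_smul, Finset.smul_sum]
    refine Fintype.sum_equiv (_root_.Equiv.mulRight (q g)) _ _ fun a => ?_
    rw [_root_.Equiv.coe_mulRight, smul_smul, ← AddChar.map_add_eq_mul, ← ofMul_mul,
      _root_.mul_inv_rev, mul_inv_cancel_left]
  let χ : AddChar (Additive A) ℂ → (Γt →* ℂˣ) := fun ψ => MonoidHom.toHomUnits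
    { toFun := fun g => ψ (Additive.ofMul (q g))
      map_one' := by simp
      map_mul' := fun g g' => by rw [map_mul, ofMul_mul, AddChar.map_add_eq_mul] }
  let P' : ∀ ψ, IntertwiningMap ρ (ρ.twist (χ ψ)) := fun ψ =>
    ⟨P ψ, fun g => LinearMap.ext fun v => hP ψ g v⟩
  have hχι : ∀ ψ γ, χ ψ (ι γ) = 1 := fun ψ γ => Units.ext (by
    change ψ (Additive.ofMul (q (ι γ))) = 1
    rw [h.map_eq_one, ofMul_one, AddChar.map_zero_eq_one])
  have hmem : ∀ ψ, ofTwist (hχι ψ) (P' ψ) ∈ Submodule.span ℂ (Set.range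
      fun χ : fixingHoms ρ ι => ofTwist χ.2.1 (φ χ).toIntertwiningMap) := by
    intro ψ
    have := h.irr.twist (χ ψ)
    rcases IsIrreducible.bijective_or_eq_zero (P' ψ) with hb | h0
    · let x : fixingHoms ρ ι := ⟨χ ψ, hχι ψ, ⟨(P' ψ).ofBijective hb⟩⟩
      obtain ⟨c, hc⟩ := h.exists_eq_smul_of_twist (φ x) (P' ψ)
      have h1 : ofTwist (hχι ψ) (P' ψ) = c • ofTwist x.2.1 (φ x).toIntertwiningMap :=
        IntertwiningMap.ext (LinearMap.ext hc)
      rw [h1]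
      exact Submodule.smul_mem _ _ (Submodule.subset_span ⟨x, rfl⟩)
    · have h1 : ofTwist (hχι ψ) (P' ψ) = 0 :=
        IntertwiningMap.ext (LinearMap.ext fun v => DFunLike.congr_fun h0 v)
      rw [h1]; exact zero_mem _
  have hsum : f = (Fintype.card A : ℂ)⁻¹ • ∑ ψ, ofTwist (hχι ψ) (P' ψ) := by
    refine IntertwiningMap.ext (LinearMap.ext fun v => ?_)
    have h1 : ∑ ψ, P ψ v = (Fintype.card A : ℂ) • f v := by
      simp only [P, LinearMap.sum_apply, LinearMap.smul_apply]
      rw [Finset.sum_comm]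
      simp only [← Finset.sum_smul, AddChar.sum_apply_eq_ite]
      rw [Finset.sum_eq_single 1]
      · simp [hF1]
      · intro a _ ha
        rw [if_neg (by simpa using ha), zero_smul]
      · simp
    have h2 : ((Fintype.card A : ℂ)⁻¹ • ∑ ψ, ofTwist (hχι ψ) (P' ψ)) v =
        (Fintype.card A : ℂ)⁻¹ • ∑ ψ, P ψ v := by
      rw [IntertwiningMap.smul_apply, IntertwiningMap.sum_apply]; rfl
    change f v = ((Fintype.card A : ℂ)⁻¹ • ∑ ψ, ofTwist (hχι ψ) (P' ψ)) v
    rw [h2, h1, inv_smul_smul₀]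
    exact_mod_cast Fintype.card_ne_zero
  rw [hsum]
  exact Submodule.smul_mem _ _ (sum_mem fun ψ _ => hmem ψ)

theorem finiteDimensional_and_finrank :
    FiniteDimensional ℂ (IntertwiningMap (ρ.pullback ι) (ρ.pullback ι)) ∧
      Nat.card (fixingHoms ρ ι) =
        Module.finrank ℂ (IntertwiningMap (ρ.pullback ι) (ρ.pullback ι)) := by
  have hfin := h.finite_fixingHoms
  let φ := fun χ : fixingHoms ρ ι => Classical.choice χ.2.2
  have := h.irr
  have := h.irr.nontrivial_space
  obtain ⟨v, hv⟩ := exists_ne (0 : V)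
  have hind := linearIndependent_ofTwist (fun χ : fixingHoms ρ ι => (χ : Γt →* ℂˣ))
    Subtype.val_injective (fun χ => ofTwist χ.2.1 (φ χ).toIntertwiningMap)
    (fun χ h0 => hv ((φ χ).toLinearEquiv.map_eq_zero_iff.1 (DFunLike.congr_fun h0 v)))
    (fun χ g v => IntertwiningMap.isIntertwining _ _ (φ χ).toIntertwiningMap g v)
  let b := Module.Basis.mk hind fun f _ => h.span_fixingHoms φ f
  exact ⟨Module.Finite.of_basis b, (Module.finrank_eq_nat_card_basis b).symm⟩

end IsCliffordDatum

end Representation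

end

/-! ### Smooth representations: countable dimension and automatic continuity. -/

noncomputable section

namespace Representation

variable {Γ : Type*} [Group Γ] {V : Type*} [AddCommGroup V] [Module ℂ V]
  {ρ : Representation ℂ Γ V}

theorem IsIrreducible.span_orbit_eq_top (h : ρ.IsIrreducible) {v : V} (hv : v ≠ 0) :
    Submodule.span ℂ (Set.range fun g => ρ g v) = ⊤ := by
  let W : Subrepresentation ρ := ⟨Submodule.span ℂ (Set.range fun g => ρ g v), fun g w hw => by
    induction hw using Submodule.span_induction with
    | mem x hx =>
      obtain ⟨g', rfl⟩ := hx
      exact Submodule.subset_span ⟨g * g', by simp⟩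
    | zero => rw [map_zero]; exact zero_mem _
    | add x y _ _ hx hy => rw [map_add]; exact add_mem hx hy
    | smul c x _ hx => rw [map_smul]; exact Submodule.smul_mem _ c hx⟩
  rcases h.eq_bot_or_eq_top W with hW | hW
  · have h1 : v ∈ W := Submodule.subset_span ⟨1, by simp⟩
    rw [hW] at h1
    exact absurd ((Submodule.mem_bot ℂ).1 h1) hv
  · exact congrArg Subrepresentation.toSubmodule hW

variable [TopologicalSpace Γ] [IsTopologicalGroup Γ]

/-- A smooth irreducible representation is spanned by the translates of a nonzero vector under a
dense set. -/
theorem IsSmooth.span_image_dense_eq_top (hs : ρ.IsSmooth) (h : ρ.IsIrreducible) {D : Set Γ}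
    (hD : Dense D) {v : V} (hv : v ≠ 0) :
    Submodule.span ℂ ((fun g => ρ g v) '' D) = ⊤ := by
  rw [← h.span_orbit_eq_top hv]
  congr 1
  refine (Set.image_subset_range _ _).antisymm ?_
  rintro _ ⟨g, rfl⟩
  have ho : IsOpen {x : Γ | ρ (g⁻¹ * x) v = v} := (hs v).preimage (continuous_const_mul g⁻¹)
  obtain ⟨d, hd, hdD⟩ := hD.inter_open_nonempty _ ho ⟨g, by simp⟩
  refine ⟨d, hdD, ?_⟩
  have h1 := congrArg (ρ g) hd
  rwa [map_mul, Module.End.mul_apply, ρ.apply_inv_apply] at h1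

/-- A character fixing a smooth representation is continuous. -/
theorem IsSmooth.continuous_of_equiv_twist [Nontrivial V] (hs : ρ.IsSmooth) {χ : Γ →* ℂˣ}
    (φ : ρ.Equiv (ρ.twist χ)) : Continuous χ := by
  obtain ⟨v, hv⟩ := exists_ne (0 : V)
  refine continuous_of_continuousAt_one χ ?_
  have hU : {g | ρ g v = v} ∩ {g | ρ g (φ v) = φ v} ∈ nhds (1 : Γ) :=
    ((hs v).inter (hs (φ v))).mem_nhds (by simp)
  have h1 : (fun _ : Γ => (1 : ℂˣ)) =ᶠ[nhds 1] χ := by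
    filter_upwards [hU] with g hg
    have h2 : φ (ρ g v) = (χ g : ℂ) • ρ g (φ v) :=
      IntertwiningMap.isIntertwining _ _ φ.toIntertwiningMap g v
    rw [hg.1, hg.2] at h2
    have h3 : ((χ g : ℂ) - 1) • φ v = 0 := by rw [sub_smul, one_smul, ← h2, sub_self]
    have h4 : φ v ≠ 0 := fun h0 => hv (φ.toLinearEquiv.map_eq_zero_iff.1 h0)
    exact (Units.ext (sub_eq_zero.1 ((smul_eq_zero.1 h3).resolve_right h4))).symm
  exact continuousAt_const.congr h1

end Representation

instance Matrix.GeneralLinearGroup.secondCountableTopology {n : Type*} [Fintype n] [DecidableEq n]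
    {F : Type*} [CommRing F] [TopologicalSpace F] [SecondCountableTopology F] :
    SecondCountableTopology (GL n F) :=
  have : SecondCountableTopology (Matrix n n F) :=
    inferInstanceAs (SecondCountableTopology (n → n → F))
  have : SecondCountableTopology (Matrix n n F)ᵐᵒᵖ :=
    MulOpposite.opHomeomorph.symm.isEmbedding.secondCountableTopology
  Units.isEmbedding_embedProduct.secondCountableTopology

end

/-! ### Semisimplicity of the restriction. -/

noncomputable section

namespace Representation

open MonoidAlgebra

section AsModule

variable {Γ : Type*} [Group Γ] {V : Type*} [AddCommGroup V] [Module ℂ V]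
  {W : Type*} [AddCommGroup W] [Module ℂ W]

theorem nonempty_equiv_iff {ρ : Representation ℂ Γ V} {σ : Representation ℂ Γ W} :
    Nonempty (ρ.Equiv σ) ↔ Nonempty (ρ.asModule ≃ₗ[ℂ[Γ]] σ.asModule) := by
  constructor
  · rintro ⟨φ⟩
    exact ⟨LinearEquiv.ofBijective (IntertwiningMap.equivLinearMapAsModule ρ σ φ.toIntertwiningMap)
      φ.toLinearEquiv.bijective⟩
  · rintro ⟨e⟩
    exact ⟨((IntertwiningMap.equivLinearMapAsModule ρ σ).symm e.toLinearMap).ofBijective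
      e.bijective⟩

theorem IsIrreducible.of_equiv {ρ : Representation ℂ Γ V} {σ : Representation ℂ Γ W}
    (h : ρ.IsIrreducible) (φ : ρ.Equiv σ) : σ.IsIrreducible := by
  rw [irreducible_iff_isSimpleModule_asModule] at h ⊢
  obtain ⟨e⟩ := nonempty_equiv_iff.1 ⟨φ⟩
  exact IsSimpleModule.congr e.symm

/-- The inclusion of a subrepresentation. -/
def _root_.Subrepresentation.subtype {ρ : Representation ℂ Γ V} (U : Subrepresentation ρ) :
    IntertwiningMap U.toRepresentation ρ :=
  ⟨U.toSubmodule.subtype, fun _ => rfl⟩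

/-- The module of a subrepresentation is the corresponding submodule. -/
def _root_.Subrepresentation.asModuleEquivAsSubmodule {ρ : Representation ℂ Γ V}
    (U : Subrepresentation ρ) : U.toRepresentation.asModule ≃ₗ[ℂ[Γ]] U.asSubmodule :=
  let f : U.toRepresentation.asModule →ₗ[ℂ[Γ]] ρ.asModule :=
    IntertwiningMap.equivLinearMapAsModule _ _ U.subtype
  LinearEquiv.ofBijective (f.codRestrict U.asSubmodule fun x => x.2)
    ⟨fun x y hxy => by
      have h1 : f x = f y := congrArg Subtype.val hxy
      exact Subtype.ext h1, fun y => ⟨⟨y.1, y.2⟩, rfl⟩⟩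

end AsModule

variable {Γt Γ : Type*} [Group Γt] [Group Γ] {V : Type*} [AddCommGroup V] [Module ℂ V]

namespace IsCliffordDatum

variable {A : Type*} [CommGroup A] {ρ : Representation ℂ Γt V} {ι : Γ →* Γt}
  {q : Γt →* A} (h : IsCliffordDatum ρ ι q)

include h

/-- The translate of a subrepresentation of the restriction. -/
def translate (g : Γt) (U : Subrepresentation (ρ.pullback ι)) :
    Subrepresentation (ρ.pullback ι) where
  toSubmodule := U.toSubmodule.comap (ρ g⁻¹)
  apply_mem_toSubmodule γ v hv := by
    obtain ⟨γ', hγ'⟩ := h.normal g⁻¹ γ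
    change ρ g⁻¹ (ρ (ι γ) v) ∈ U
    rw [← Module.End.mul_apply, ← map_mul, hγ', map_mul]
    exact U.apply_mem_toSubmodule γ' hv

theorem mem_translate {g : Γt} {U : Subrepresentation (ρ.pullback ι)} {v : V} :
    v ∈ h.translate g U ↔ ρ g⁻¹ v ∈ U := Iff.rfl

/-- Translation as an order isomorphism. -/
def translateIso (g : Γt) :
    Subrepresentation (ρ.pullback ι) ≃o Subrepresentation (ρ.pullback ι) where
  toFun := h.translate g
  invFun := h.translate g⁻¹
  left_inv U := SetLike.ext fun v => by
    rw [mem_translate, mem_translate, ρ.apply_inv_apply]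
  right_inv U := SetLike.ext fun v => by
    rw [mem_translate, mem_translate, ρ.inv_apply_apply]
  map_rel_iff' {U U'} := by
    refine ⟨fun hU v hv => ?_, fun hU v hv => hU hv⟩
    have h1 : ρ g v ∈ h.translate g U := by
      rw [mem_translate, ρ.inv_apply_apply]; exact hv
    have h2 : ρ g v ∈ h.translate g U' := hU h1
    rwa [mem_translate, ρ.inv_apply_apply] at h2

theorem translate_le_of_eq {g g' : Γt} (hg : q g = q g') (U : Subrepresentation (ρ.pullback ι)) :
    h.translate g U ≤ h.translate g' U := by
  intro v hv
  obtain ⟨c, γ, -, hc⟩ := h.ker (g'⁻¹ * g) (by rw [map_mul, map_inv, hg, inv_mul_cancel])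
  have h1 : ρ g'⁻¹ v = ρ (g'⁻¹ * g) (ρ g⁻¹ v) := by
    rw [map_mul, Module.End.mul_apply, ρ.apply_inv_apply]
  rw [mem_translate, h1, hc]
  exact U.toSubmodule.smul_mem c (U.apply_mem_toSubmodule γ hv)

variable [Finite A]

/-- The translates of one nonzero vector by representatives of `A` generate over the small group. -/
theorem finite_asModule : Module.Finite ℂ[Γ] (ρ.pullback ι).asModule := by
  have := h.irr.nontrivial_space
  obtain ⟨v, hv⟩ := exists_ne (0 : V)
  choose s hs using h.surjective
  let w : A → (ρ.pullback ι).asModule := fun a => ρ (s a) v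
  refine Module.finite_def.2 (Submodule.fg_def.2 ⟨Set.range w, Set.finite_range w, ?_⟩)
  let U := Subrepresentation.ofSubmodule' (ρ := ρ.pullback ι)
    (Submodule.span ℂ[Γ] (Set.range w))
  have hU : U.toSubmodule = ⊤ := by
    rw [eq_top_iff, ← h.irr.span_orbit_eq_top hv, Submodule.span_le]
    rintro _ ⟨g, rfl⟩
    obtain ⟨c, γ, -, hc⟩ := h.ker (g * (s (q g))⁻¹) (by rw [map_mul, map_inv, hs, mul_inv_cancel])
    have h1 : ρ g v = c • ρ (ι γ) (ρ (s (q g)) v) := by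
      rw [← hc, map_mul, Module.End.mul_apply, ρ.inv_apply_apply]
    have h2 : w (q g) ∈ Submodule.span ℂ[Γ] (Set.range w) := Submodule.subset_span ⟨q g, rfl⟩
    change ρ g v ∈ U.toSubmodule
    rw [h1]
    exact U.toSubmodule.smul_mem c (U.apply_mem_toSubmodule γ h2)
  exact Submodule.eq_top_iff'.2 fun x => (Submodule.eq_top_iff'.1 hU x : x ∈ U.toSubmodule)

/-- Finite generation yields a maximal proper subrepresentation `U`. The intersection of its
translates is stable under the big group and proper, hence zero. A translate depends only on the
class in `A`, so the restriction embeds into a finite product of simple quotients. -/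
theorem isSemisimpleModule : IsSemisimpleModule ℂ[Γ] (ρ.pullback ι).asModule := by
  have := h.irr.nontrivial_space
  have := h.finite_asModule
  have : Nontrivial (ρ.pullback ι).asModule := inferInstanceAs (Nontrivial V)
  choose s hs using h.surjective
  obtain ⟨M, hM, -⟩ := (eq_top_or_exists_le_coatom
    (⊥ : Submodule ℂ[Γ] (ρ.pullback ι).asModule)).resolve_left bot_ne_top
  let I : Subrepresentation (ρ.pullback ι) ≃o Submodule ℂ[Γ] (ρ.pullback ι).asModule :=
    Subrepresentation.subrepresentationSubmoduleOrderIso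
  let U := I.symm M
  have hU : IsCoatom U := (I.symm.isCoatom_iff M).2 hM
  let Q : A → Submodule ℂ[Γ] (ρ.pullback ι).asModule := fun a => I (h.translate (s a) U)
  have hQ : ∀ a, IsSimpleModule ℂ[Γ] ((ρ.pullback ι).asModule ⧸ Q a) := fun a =>
    isSimpleModule_iff_isCoatom.2
      ((I.isCoatom_iff _).2 (((h.translateIso (s a)).isCoatom_iff U).2 hU))
  let C : Subrepresentation ρ :=
    ⟨⨅ g, (h.translate g U).toSubmodule, fun g v hv => by
      rw [Submodule.mem_iInf] at hv ⊢
      intro g'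
      have h1 := hv (g⁻¹ * g')
      change ρ g'⁻¹ (ρ g v) ∈ U
      change ρ (g⁻¹ * g')⁻¹ v ∈ U at h1
      rwa [_root_.mul_inv_rev, inv_inv, map_mul] at h1⟩
  have hC : C = ⊥ := (h.irr.eq_bot_or_eq_top C).resolve_right fun hC => hU.1 (by
    refine SetLike.ext fun v => ⟨fun _ => True.intro, fun _ => ?_⟩
    have h1 : v ∈ C := by rw [hC]; exact True.intro
    have h2 := (Submodule.mem_iInf _).1 h1 1
    change ρ 1⁻¹ v ∈ U at h2
    rwa [inv_one, map_one] at h2)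
  refine IsSemisimpleModule.of_injective (LinearMap.pi fun a => (Q a).mkQ) ?_
  rw [← LinearMap.ker_eq_bot, LinearMap.ker_pi, eq_bot_iff]
  intro v hv
  rw [Submodule.mem_iInf] at hv
  have h1 : v ∈ C := by
    refine (Submodule.mem_iInf _).2 fun g => ?_
    have h2 := hv (q g)
    rw [Submodule.ker_mkQ] at h2
    exact h.translate_le_of_eq (hs (q g)) U h2
  rw [hC] at h1
  exact h1

theorem exists_linearEquiv_pi : ∃ (N : ℕ) (U : Fin N → Subrepresentation (ρ.pullback ι)),
    (∀ i, (U i).toRepresentation.IsIrreducible) ∧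
      Nonempty ((ρ.pullback ι).asModule ≃ₗ[ℂ[Γ]] ∀ i, (U i).toRepresentation.asModule) := by
  have := h.isSemisimpleModule
  have := h.finite_asModule
  obtain ⟨N, S, e, hS⟩ := IsSemisimpleModule.exists_linearEquiv_fin_dfinsupp ℂ[Γ]
    (ρ.pullback ι).asModule
  let U : Fin N → Subrepresentation (ρ.pullback ι) := fun i => Subrepresentation.ofSubmodule' (S i)
  refine ⟨N, U, fun i => ?_, ⟨e.trans (DFinsupp.linearEquivFunOnFintype.trans
    (LinearEquiv.piCongrRight fun i => (U i).asModuleEquivAsSubmodule.symm))⟩⟩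
  rw [irreducible_iff_isSimpleModule_asModule]
  have : IsSimpleModule ℂ[Γ] (U i).asSubmodule := hS i
  exact IsSimpleModule.congr (U i).asModuleEquivAsSubmodule

end IsCliffordDatum

end Representation

end

/-! ### Conjugacy of the constituents and their common multiplicity. -/

noncomputable section

namespace Representation

open MonoidAlgebra

theorem irreducible_toRepresentation_iff_isAtom {Γ : Type*} [Group Γ] {V : Type*} [AddCommGroup V]
    [Module ℂ V] {ρ : Representation ℂ Γ V} {U : Subrepresentation ρ} :
    U.toRepresentation.IsIrreducible ↔ IsAtom U := by
  rw [irreducible_iff_isSimpleModule_asModule,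
    ← Subrepresentation.subrepresentationSubmoduleOrderIso.isAtom_iff U, ← isSimpleModule_iff_isAtom]
  exact ⟨fun _ => IsSimpleModule.congr U.asModuleEquivAsSubmodule.symm,
    fun (_ : IsSimpleModule ℂ[Γ] U.asSubmodule) => IsSimpleModule.congr U.asModuleEquivAsSubmodule⟩

/-- An irreducible subrepresentation as a constituent. -/
theorem exists_irrConstituent_equiv {Γ : Type*} [Group Γ] {V : Type*} [AddCommGroup V]
    [Module ℂ V] {ρ : Representation ℂ Γ V} {U : Subrepresentation ρ}
    (hU : U.toRepresentation.IsIrreducible) :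
    ∃ c : IrrConstituent ρ, Nonempty (c.rep.Equiv U.toRepresentation) := by
  let f : IntertwiningMap U.toRepresentation (U.toRepresentation.quotient
      ((⊥ : Subrepresentation ρ).toSubmodule.submoduleOf U.toSubmodule)
      (fun g _ hv => (⊥ : Subrepresentation ρ).apply_mem_toSubmodule g hv)) :=
    ⟨Submodule.mkQ _, fun _ => rfl⟩
  have hf : Function.Bijective f := by
    refine ⟨LinearMap.ker_eq_bot.1 ?_, Submodule.mkQ_surjective _⟩
    refine (Submodule.ker_mkQ _).trans (eq_bot_iff.2 fun x hx => ?_)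
    exact (Submodule.mem_bot ℂ).2 (Subtype.ext ((Submodule.mem_bot ℂ).1 hx))
  exact ⟨⟨⊥, U, bot_le, hU.of_equiv (f.ofBijective hf)⟩, ⟨(f.ofBijective hf).symm⟩⟩

variable {Γt Γ : Type*} [Group Γt] [Group Γ] {V : Type*} [AddCommGroup V] [Module ℂ V]

namespace IsCliffordDatum

variable {A : Type*} [CommGroup A] {ρ : Representation ℂ Γt V} {ι : Γ →* Γt}
  {q : Γt →* A} (h : IsCliffordDatum ρ ι q)

/-- Conjugation of intertwining maps with an element of the big group. -/
def conjHom (g : Γt) (U : Subrepresentation (ρ.pullback ι)) :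
    IntertwiningMap U.toRepresentation (ρ.pullback ι) →ₗ[ℂ]
      IntertwiningMap (h.translate g U).toRepresentation (ρ.pullback ι) where
  toFun f := ⟨ρ g ∘ₗ f.toLinearMap ∘ₗ (ρ g⁻¹).restrict fun _ hv => hv, fun γ => by
    ext x
    obtain ⟨γ', hγ'⟩ := h.normal g⁻¹ γ
    have h1 : g * ι γ' = ι γ * g := by
      rw [eq_comm, ← inv_mul_eq_iff_eq_mul, ← mul_assoc, hγ', inv_mul_cancel_right]
    let y : U.toSubmodule := ⟨ρ g⁻¹ x.1, x.2⟩
    have h2 : (⟨ρ g⁻¹ (ρ (ι γ) x.1), (h.translate g U).apply_mem_toSubmodule γ x.2⟩ :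
        U.toSubmodule) = U.toRepresentation γ' y := Subtype.ext (by
      change ρ g⁻¹ (ρ (ι γ) x.1) = ρ (ι γ') (ρ g⁻¹ x.1)
      rw [← Module.End.mul_apply, ← map_mul, hγ', map_mul, Module.End.mul_apply])
    have h3 : f (U.toRepresentation γ' y) = ρ (ι γ') (f y) :=
      IntertwiningMap.isIntertwining _ _ f γ' y
    change ρ g (f ⟨ρ g⁻¹ (ρ (ι γ) x.1), _⟩) = ρ (ι γ) (ρ g (f y))
    rw [h2, h3, ← Module.End.mul_apply, ← map_mul, h1, map_mul, Module.End.mul_apply]⟩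
  map_add' f f' := IntertwiningMap.ext (LinearMap.ext fun x => map_add (ρ g) _ _)
  map_smul' c f := IntertwiningMap.ext (LinearMap.ext fun x => map_smul (ρ g) c _)

theorem conjHom_injective (g : Γt) (U : Subrepresentation (ρ.pullback ι)) :
    Function.Injective (h.conjHom g U) := by
  intro f f' hff
  refine IntertwiningMap.ext (LinearMap.ext fun u => ?_)
  have hu : ρ g⁻¹ (ρ g u.1) ∈ U := by rw [ρ.inv_apply_apply]; exact u.2
  have h1 : ρ g (f ⟨ρ g⁻¹ (ρ g u.1), hu⟩) = ρ g (f' ⟨ρ g⁻¹ (ρ g u.1), hu⟩) :=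
    DFunLike.congr_fun hff (⟨ρ g u.1, hu⟩ : (h.translate g U).toSubmodule)
  have h2 : (⟨ρ g⁻¹ (ρ g u.1), hu⟩ : U.toSubmodule) = u := Subtype.ext (ρ.inv_apply_apply g u.1)
  rw [h2] at h1
  have h3 := congrArg (ρ g⁻¹) h1
  rwa [ρ.inv_apply_apply, ρ.inv_apply_apply] at h3

variable {N : ℕ} {U : Fin N → Subrepresentation (ρ.pullback ι)}
  (hU : ∀ i, (U i).toRepresentation.IsIrreducible)
  (e : (ρ.pullback ι).asModule ≃ₗ[ℂ[Γ]] ∀ i, (U i).toRepresentation.asModule)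

include hU e

omit h in
theorem exists_equiv_of_injective {W : Type*} [AddCommGroup W] [Module ℂ W]
    {σ : Representation ℂ Γ W} (hσ : σ.IsIrreducible)
    (f : σ.asModule →ₗ[ℂ[Γ]] (ρ.pullback ι).asModule) (hf : Function.Injective f) :
    ∃ i, Nonempty (σ.Equiv (U i).toRepresentation) := by
  have := hσ.nontrivial_space
  obtain ⟨w, hw⟩ := exists_ne (0 : W)
  have hw1 : e (f w) ≠ 0 := fun h0 => hw (hf ((e.map_eq_zero_iff.1 h0).trans (map_zero f).symm))
  obtain ⟨i, hi⟩ := Function.ne_iff.1 hw1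
  refine ⟨i, nonempty_equiv_iff.2 ⟨LinearEquiv.ofBijective
    (LinearMap.proj i ∘ₗ e.toLinearMap ∘ₗ f) ?_⟩⟩
  have := hU i
  refine (LinearMap.bijective_or_eq_zero _).resolve_right fun h0 => hi ?_
  exact LinearMap.congr_fun h0 w

variable [Finite A]

include h

theorem finrank_intertwiningMap_eq_card {W : Type*} [AddCommGroup W] [Module ℂ W]
    {σ : Representation ℂ Γ W} (hσ : σ.IsIrreducible) :
    FiniteDimensional ℂ (IntertwiningMap σ (ρ.pullback ι)) ∧
      Module.finrank ℂ (IntertwiningMap σ (ρ.pullback ι)) =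
        Nat.card {i // Nonempty (σ.Equiv (U i).toRepresentation)} := by
  have := h.finiteDimensional_and_finrank.1
  have : FiniteDimensional ℂ
      ((ρ.pullback ι).asModule →ₗ[ℂ[Γ]] (ρ.pullback ι).asModule) :=
    Module.Finite.equiv (IntertwiningMap.equivLinearMapAsModule (ρ.pullback ι) (ρ.pullback ι))
  obtain ⟨h1, h2⟩ := finrank_hom_eq_card (k := ℂ) (T := σ.asModule) e
  refine ⟨Module.Finite.equiv (IntertwiningMap.equivLinearMapAsModule σ (ρ.pullback ι)).symm, ?_⟩
  rw [(IntertwiningMap.equivLinearMapAsModule σ (ρ.pullback ι)).finrank_eq, h2]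
  exact Nat.card_congr (Equiv.subtypeEquivRight fun i => nonempty_equiv_iff.symm)

theorem finrank_end_eq_sum : Module.finrank ℂ (IntertwiningMap (ρ.pullback ι) (ρ.pullback ι)) =
    ∑ i, Module.finrank ℂ (IntertwiningMap (U i).toRepresentation (ρ.pullback ι)) := by
  have := h.finiteDimensional_and_finrank.1
  have : FiniteDimensional ℂ
      ((ρ.pullback ι).asModule →ₗ[ℂ[Γ]] (ρ.pullback ι).asModule) :=
    Module.Finite.equiv (IntertwiningMap.equivLinearMapAsModule (ρ.pullback ι) (ρ.pullback ι))
  rw [(IntertwiningMap.equivLinearMapAsModule (ρ.pullback ι) (ρ.pullback ι)).finrank_eq,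
    _root_.finrank_end_eq_sum (k := ℂ) e]
  exact Finset.sum_congr rfl fun i _ =>
    (IntertwiningMap.equivLinearMapAsModule (U i).toRepresentation (ρ.pullback ι)).finrank_eq.symm

-- The translates of a nonzero vector of `U i` span the whole space, so the projection to `U j` is
-- nonzero on some translate of `U i`; both being irreducible, it is an isomorphism there.
omit [Finite A] in
theorem exists_translate_equiv (i j : Fin N) : ∃ g,
    Nonempty ((h.translate g (U i)).toRepresentation.Equiv (U j).toRepresentation) := by
  classical
  obtain ⟨⟨u, hu⟩, hu0⟩ := @exists_ne _ (hU i).nontrivial_space (0 : (U i).toSubmodule)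
  have hu0' : u ≠ 0 := fun h0 => hu0 (Subtype.ext h0)
  let P : (ρ.pullback ι).asModule →ₗ[ℂ[Γ]] (U j).toRepresentation.asModule :=
    LinearMap.proj j ∘ₗ e.toLinearMap
  let P' : IntertwiningMap (ρ.pullback ι) (U j).toRepresentation :=
    (IntertwiningMap.equivLinearMapAsModule _ _).symm P
  have hex : ∃ g, P' (ρ g u) ≠ 0 := by
    by_contra! h0
    have h1 : (⊤ : Submodule ℂ V) ≤ LinearMap.ker P'.toLinearMap := by
      rw [← h.irr.span_orbit_eq_top hu0', Submodule.span_le]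
      rintro _ ⟨g, rfl⟩
      exact h0 g
    obtain ⟨x, hx⟩ : ∃ x : (U j).toRepresentation.asModule, x ≠ 0 :=
      @exists_ne _ (hU j).nontrivial_space 0
    let y : ∀ i, (U i).toRepresentation.asModule :=
      Pi.single j x
    have h2 : P (e.symm y) = 0 := h1 (Submodule.mem_top (x := (e.symm y : V)))
    have h3 : P (e.symm y) = y j := congrFun (e.apply_symm_apply y) j
    have h4 : y j = x := Pi.single_eq_same (M := fun i => (U i).toRepresentation.asModule) j x
    exact hx (h4.symm.trans (h3.symm.trans h2))
  obtain ⟨g, hg⟩ := hex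
  have hirr : (h.translate g (U i)).toRepresentation.IsIrreducible :=
    irreducible_toRepresentation_iff_isAtom.2 (((h.translateIso g).isAtom_iff (U i)).2
      (irreducible_toRepresentation_iff_isAtom.1 (hU i)))
  have := hU j
  let f := P'.comp (h.translate g (U i)).subtype
  refine ⟨g, ⟨f.ofBijective ((IsIrreducible.bijective_or_eq_zero f).resolve_right fun h0 => hg ?_)⟩⟩
  have hm : ρ g u ∈ h.translate g (U i) := by
    rw [mem_translate, ρ.inv_apply_apply]; exact hu
  exact DFunLike.congr_fun h0 (⟨ρ g u, hm⟩ : (h.translate g (U i)).toSubmodule)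

/-- Conjugation by `g` embeds the Hom space of `U i` into that of its translate, which is isomorphic
to `U j`. Exchanging `i` and `j` gives equality of all multiplicities. -/
theorem finrank_le (i j : Fin N) :
    Module.finrank ℂ (IntertwiningMap (U i).toRepresentation (ρ.pullback ι)) ≤
      Module.finrank ℂ (IntertwiningMap (U j).toRepresentation (ρ.pullback ι)) := by
  obtain ⟨g, ⟨φ⟩⟩ := h.exists_translate_equiv hU e i j
  have hirr : (h.translate g (U i)).toRepresentation.IsIrreducible := (hU j).of_equiv φ.symm
  obtain ⟨h1, h2⟩ := h.finrank_intertwiningMap_eq_card hU e hirr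
  refine (LinearMap.finrank_le_finrank_of_injective (h.conjHom_injective g (U i))).trans ?_
  rw [h2, (h.finrank_intertwiningMap_eq_card hU e (hU j)).2]
  exact (Nat.card_congr (Equiv.subtypeEquivRight fun l =>
    ⟨fun ⟨ψ⟩ => ⟨φ.symm.trans ψ⟩, fun ⟨ψ⟩ => ⟨φ.trans ψ⟩⟩)).le

/-- By semisimplicity the quotient map of a constituent splits, so every subquotient is already a
subrepresentation and therefore isomorphic to one of the summands. -/
theorem exists_rep_equiv (c : IrrConstituent (ρ.pullback ι)) :
    ∃ i, Nonempty (c.rep.Equiv (U i).toRepresentation) := by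
  have := h.isSemisimpleModule
  have : IsSemisimpleModule ℂ[Γ] c.upper.toRepresentation.asModule :=
    IsSemisimpleModule.congr c.upper.asModuleEquivAsSubmodule
  let π : IntertwiningMap c.upper.toRepresentation c.rep := ⟨Submodule.mkQ _, fun _ => rfl⟩
  have hπ : Function.Surjective π :=
    Submodule.mkQ_surjective (c.lower.toSubmodule.submoduleOf c.upper.toSubmodule)
  let π' : c.upper.toRepresentation.asModule →ₗ[ℂ[Γ]] c.rep.asModule :=
    IntertwiningMap.equivLinearMapAsModule _ _ π
  obtain ⟨s, hs⟩ := IsSemisimpleModule.lifting_property π' hπ LinearMap.id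
  refine exists_equiv_of_injective hU e (σ := c.rep) c.irreducible
    (IntertwiningMap.equivLinearMapAsModule _ _ c.upper.subtype ∘ₗ s) ?_
  rw [LinearMap.coe_comp]
  refine Function.Injective.comp (fun x y hxy => Subtype.ext hxy) ?_
  exact Function.LeftInverse.injective (g := π')
    fun x => LinearMap.congr_fun hs x

omit hU e in
theorem finite_constituentClasses_and_finrank : Finite (ConstituentClasses (ρ.pullback ι)) ∧
    ∀ {W : Type*} [AddCommGroup W] [Module ℂ W] (σ : Representation ℂ Γ W),
      σ.IsIrreducible → σ.IsConstituent (ρ.pullback ι) →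
      FiniteDimensional ℂ (IntertwiningMap σ (ρ.pullback ι)) ∧
      Module.finrank ℂ (IntertwiningMap (ρ.pullback ι) (ρ.pullback ι)) =
        Nat.card (ConstituentClasses (ρ.pullback ι)) *
          Module.finrank ℂ (IntertwiningMap σ (ρ.pullback ι)) ^ 2 := by
  classical
  obtain ⟨N, U, hU, ⟨e⟩⟩ := h.exists_linearEquiv_pi
  choose c hc using fun i => exists_irrConstituent_equiv (hU i)
  let f : Fin N → ConstituentClasses (ρ.pullback ι) := fun i => Quotient.mk _ (c i)
  have hf : Function.Surjective f := by
    intro x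
    induction x using Quotient.ind with
    | _ d =>
      obtain ⟨i, ⟨φ⟩⟩ := h.exists_rep_equiv hU e d
      obtain ⟨ψ⟩ := hc i
      exact ⟨i, Quotient.sound ⟨ψ.trans φ.symm⟩⟩
  have hfin : Finite (ConstituentClasses (ρ.pullback ι)) := Finite.of_surjective f hf
  refine ⟨hfin, ?_⟩
  intro W _ _ σ hσ ⟨d, ⟨φ⟩⟩
  obtain ⟨h1, h2⟩ := h.finrank_intertwiningMap_eq_card hU e hσ
  refine ⟨h1, ?_⟩
  set m := Module.finrank ℂ (IntertwiningMap σ (ρ.pullback ι)) with hm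
  obtain ⟨i₀, ⟨ψ₀⟩⟩ := h.exists_rep_equiv hU e d
  have hcard : ∀ i, Nat.card {l // Nonempty ((U i).toRepresentation.Equiv (U l).toRepresentation)}
      = m := by
    intro i
    rw [← (h.finrank_intertwiningMap_eq_card hU e (hU i)).2,
      (h.finrank_le hU e i i₀).antisymm (h.finrank_le hU e i₀ i),
      (h.finrank_intertwiningMap_eq_card hU e (hU i₀)).2, h2]
    exact Nat.card_congr (Equiv.subtypeEquivRight fun l =>
      ⟨fun ⟨θ⟩ => ⟨(φ.trans ψ₀).trans θ⟩, fun ⟨θ⟩ => ⟨(φ.trans ψ₀).symm.trans θ⟩⟩)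
  have hend : Module.finrank ℂ (IntertwiningMap (ρ.pullback ι) (ρ.pullback ι)) = N * m := by
    rw [h.finrank_end_eq_sum hU e, Finset.sum_congr rfl fun i _ =>
      (h.finrank_intertwiningMap_eq_card hU e (hU i)).2.trans (hcard i)]
    simp
  -- The `N` summands are sorted by isomorphism class, each class having exactly `m` members.
  have hN : N = Nat.card (ConstituentClasses (ρ.pullback ι)) * m := by
    have := Fintype.ofFinite (ConstituentClasses (ρ.pullback ι))
    have h3 := Nat.card_congr (_root_.Equiv.sigmaFiberEquiv f)
    rw [Nat.card_fin, Nat.card_sigma, Finset.sum_congr rfl (g := fun _ => m)] at h3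
    · rw [← h3]; simp
    · intro x _
      obtain ⟨i, rfl⟩ := hf x
      rw [← hcard i]
      refine Nat.card_congr (Equiv.subtypeEquivRight fun l => ?_)
      obtain ⟨θ⟩ := hc i
      obtain ⟨θ'⟩ := hc l
      refine ⟨fun hl => ?_, fun ⟨ψ⟩ => Quotient.sound ⟨(θ'.trans ψ.symm).trans θ.symm⟩⟩
      obtain ⟨ψ⟩ := Quotient.exact hl
      exact ⟨(θ.symm.trans ψ.symm).trans θ'⟩
  rw [hend]
  nth_rewrite 1 [hN]
  ring

end IsCliffordDatum

end Representation

end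

/-! ### Assembly of the two halves. -/

noncomputable section

universe u

open scoped commutatorElement

namespace Representation

/-- The Clifford datum attached to a homomorphism whose image contains the commutator subgroup and
has finite index modulo the center. -/
theorem exists_isCliffordDatum {Γt : Type u} {Γ : Type*} [Group Γt] [Group Γ] {V : Type*} [AddCommGroup V]
    [Module ℂ V] {ρ : Representation ℂ Γt V} (irr : ρ.IsIrreducible)
    (schur : ∀ f : IntertwiningMap ρ ρ, ∃ c : ℂ, ∀ v, f v = c • v) (ι : Γ →* Γt)
    (hcomm : ∀ x y : Γt, ⁅x, y⁆ ∈ ι.range) (hidx : (Subgroup.center Γt ⊔ ι.range).index ≠ 0) :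
    ∃ (A : Type u) (_ : CommGroup A) (_ : Finite A) (q : Γt →* A), IsCliffordDatum ρ ι q := by
  let Q := Subgroup.center Γt ⊔ ι.range
  have hQ : commutator Γt ≤ Q :=
    (Subgroup.commutator_le.2 fun x _ y _ => hcomm x y).trans le_sup_right
  have hn : Q.Normal := Subgroup.Normal.of_commutator_le Γt hQ
  let _ : CommGroup (Γt ⧸ Q) :=
    { (inferInstance : Group (Γt ⧸ Q)) with
      mul_comm := ((Subgroup.Normal.quotient_commutative_iff_commutator_le (N := Q)).2 hQ).is_comm.comm }
  have : Q.FiniteIndex := ⟨hidx⟩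
  refine ⟨Γt ⧸ Q, inferInstance, Subgroup.finite_quotient_of_finiteIndex,
    QuotientGroup.mk' Q, irr, schur, QuotientGroup.mk'_surjective Q, fun γ => ?_, fun g hg => ?_,
    fun g γ => ?_⟩
  · exact (QuotientGroup.eq_one_iff _).2 (le_sup_right (a := Subgroup.center Γt) ⟨γ, rfl⟩)
  · have h1 : g ∈ Q := (QuotientGroup.eq_one_iff _).1 hg
    obtain ⟨z, hz, _, ⟨γ, rfl⟩, rfl⟩ := Subgroup.mem_sup_of_normal_left.1 h1
    obtain ⟨c, hc⟩ := schur (IntertwiningMap.centralMul ρ z hz)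
    have hc' : ∀ v, ρ z v = c • v := hc
    refine ⟨c, γ, fun h0 => ?_, fun v => ?_⟩
    · have := irr.nontrivial_space
      obtain ⟨v, hv⟩ := exists_ne (0 : V)
      refine hv ?_
      rw [← ρ.inv_apply_apply z v, hc', h0, zero_smul, map_zero]
    · rw [map_mul, Module.End.mul_apply, hc']
  -- Conjugating `ι γ` by `g` multiplies it by a commutator, which is in the image of `ι`.
  · obtain ⟨δ, hδ⟩ := hcomm g (ι γ)
    refine ⟨δ * γ, ?_⟩
    rw [map_mul, hδ, commutatorElement_def]
    group

end Representation

namespace LinAlgGroup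

theorem commutatorElement_mem_range_inclusion {n : ℕ} {K F : Type*} [Field K] [Field F]
    [Algebra F K] {G Gt : Subgroup (GL (Fin n) K)} (hle : G ≤ Gt) (hder : ⁅G, G⁆ = ⁅Gt, Gt⁆)
    (x y : points F Gt) : ⁅x, y⁆ ∈ (Subgroup.inclusion (points_mono F hle)).range := by
  rw [Subgroup.inclusion_range, Subgroup.mem_subgroupOf]
  have h1 : ⁅Gt, Gt⁆ ≤ G := hder ▸ Subgroup.commutator_le.2 fun a ha b hb =>
    mul_mem (mul_mem (mul_mem ha hb) (inv_mem ha)) (inv_mem hb)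
  have h2 := h1 (Subgroup.commutator_mem_commutator x.2 y.2)
  rw [← map_commutatorElement] at h2
  exact h2

end LinAlgGroup

end

theorem mainTheorem8
    (p : ℕ) [Fact p.Prime]
    (F : Type*) [NormedField F] [NormedAlgebra ℚ_[p] F] [FiniteDimensional ℚ_[p] F]
    (n : ℕ) (G Gt : Subgroup (GL (Fin n) (AlgebraicClosure F)))
    (hGt : LinAlgGroup.IsConnectedReductive F Gt)
    (hG : LinAlgGroup.IsZariskiClosed F (G : Set (GL (Fin n) (AlgebraicClosure F))))
    (hle : G ≤ Gt) (hder : ⁅G, G⁆ = ⁅Gt, Gt⁆)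
    {V : Type*} [AddCommGroup V] [Module ℂ V]
    (σt : Representation ℂ (LinAlgGroup.points F Gt) V)
    (hσt_smooth : σt.IsSmooth) (hσt_irr : σt.IsIrreducible) :
    Finite (LinAlgGroup.fixingCharacters hle σt) ∧
    FiniteDimensional ℂ
      (Representation.IntertwiningMap (LinAlgGroup.res hle σt) (LinAlgGroup.res hle σt)) ∧
    Finite (Representation.ConstituentClasses (LinAlgGroup.res hle σt)) ∧
    Nat.card (LinAlgGroup.fixingCharacters hle σt) =
      Module.finrank ℂ
        (Representation.IntertwiningMap (LinAlgGroup.res hle σt) (LinAlgGroup.res hle σt)) ∧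
    ∀ {W : Type*} [AddCommGroup W] [Module ℂ W]
      (σ : Representation ℂ (LinAlgGroup.points F G) W),
      σ.IsSmooth → σ.IsIrreducible → σ.IsConstituent (LinAlgGroup.res hle σt) →
      FiniteDimensional ℂ (Representation.IntertwiningMap σ (LinAlgGroup.res hle σt)) ∧
      Module.finrank ℂ
          (Representation.IntertwiningMap (LinAlgGroup.res hle σt) (LinAlgGroup.res hle σt)) =
        Nat.card (Representation.ConstituentClasses (LinAlgGroup.res hle σt)) *
          Module.finrank ℂ (Representation.IntertwiningMap σ (LinAlgGroup.res hle σt)) ^ 2 := by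
  have : CharZero F := charZero_of_injective_algebraMap (algebraMap ℚ_[p] F).injective
  have : CharZero (AlgebraicClosure F) :=
    charZero_of_injective_algebraMap (algebraMap F (AlgebraicClosure F)).injective
  have : ProperSpace F := FiniteDimensional.proper ℚ_[p] F
  have hV := hσt_irr.nontrivial_space
  have hD : ⁅Gt, Gt⁆ ≤ G := hder ▸ Subgroup.commutator_le.2 fun a ha b hb =>
    mul_mem (mul_mem (mul_mem ha hb) (inv_mem ha)) (inv_mem hb)
  have hidx := LinAlgGroup.index_center_sup_ne_zero (F := F) (fun E hE m hm => by
    have : FiniteDimensional ℚ_[p] E := FiniteDimensional.trans ℚ_[p] F E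
    exact index_range_pow_ne_zero p E hm) hGt hG hD
  obtain ⟨v, hv⟩ := exists_ne (0 : V)
  have : SecondCountableTopology (LinAlgGroup.points F Gt) :=
    TopologicalSpace.Subtype.secondCountableTopology _
  -- Stabilizers are open, so the translates of `v` by a countable dense set already give the whole
  -- orbit. The space is of countable dimension and Schur's lemma applies.
  obtain ⟨D, hDc, hDd⟩ := TopologicalSpace.exists_countable_dense (LinAlgGroup.points F Gt)
  have schur := hσt_irr.exists_eq_smul (hDc.image fun g => σt g v)
    (hσt_smooth.span_image_dense_eq_top hσt_irr hDd hv)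
  obtain ⟨A, _, _, q, h⟩ := Representation.exists_isCliffordDatum hσt_irr schur
    (Subgroup.inclusion (LinAlgGroup.points_mono F hle))
    (LinAlgGroup.commutatorElement_mem_range_inclusion hle hder)
    (by rw [Subgroup.inclusion_range]; exact hidx)
  -- Forgetting continuity loses nothing: a character fixing a smooth representation is trivial on
  -- an open neighbourhood of `1`.
  let E : LinAlgGroup.fixingCharacters hle σt ≃
      Representation.fixingHoms σt (Subgroup.inclusion (LinAlgGroup.points_mono F hle)) :=
    { toFun := fun χ => ⟨χ.1, χ.2⟩
      invFun := fun χ => ⟨⟨χ.1, hσt_smooth.continuous_of_equiv_twist (Classical.choice χ.2.2)⟩, χ.2⟩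
      left_inv := fun _ => rfl
      right_inv := fun _ => rfl }
  have hfin := h.finite_fixingHoms
  obtain ⟨h1, h2⟩ := h.finiteDimensional_and_finrank
  obtain ⟨h3, h4⟩ := h.finite_constituentClasses_and_finrank
  exact ⟨Finite.of_equiv _ E.symm, h1, h3, (Nat.card_congr E).trans h2,
    fun σ _ hσ hσc => h4 σ hσ hσc⟩
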